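/- **Setting.** A *plane straight-line (PSL) graph* has a finite set of points of $\mathbb R^2$ as vertices and interior-disjoint segments between them as edges. The *cardinal degrees* of a vertex $v$ are the numbers of edges at $v$ whose other endpoint lies strictly north, south, east, west of $v$. A *cardinal signature* $\sigma$ is a vertex set with four prescribed degree functions; a *realization* of $\sigma$ is a PSL graph on that vertex set with exactly these cardinal degrees. *Tilings.* A $w\times h$ tiling $X$ is a grid of tiles of seventeen types: blank; a red or a blue wire joining two of the four sides ($\mathrm{NE},\mathrm{NW},\mathrm{SE},\mathrm{SW},\mathrm{NS},\mathrm{EW}$); and Crossing i–iv, which occur only together as one block (iii below i and to the right of ii, iv below ii; a red and a blue wire pass through each inner side of the block; outside, Crossing i has red on its west and blue on its east side, and Crossing iv has blue on its west and red on its south side). Sides of adjacent tiles match and no wire leaves the grid. Crossing ii and iii are *critical*. *Frame graphs.* A *frame cell* is a PSL 16-cycle $v_0,\bar v_1,\dots,\bar v_7,v_8,v_7,\dots,v_1$ (counterclockwise) with possible interior vertices $p,q$; by increasing $x$ its vertices are $\bar v_4,\bar v_5,\bar v_6,\bar v_7,v_8,p,\bar v_3,\bar v_2,\bar v_1,v_0,v_1,v_2,v_3,q,v_7,v_6,v_5,v_4$,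 by increasing $y$ they are $v_4,v_5,v_6,v_7,v_8,q,v_3,v_2,v_1,v_0,\bar v_1,\bar v_2,\bar v_3,p,\bar v_7,\bar v_6,\bar v_5,\bar v_4$, and $p$, $q$ lie south-west of the segments $\bar v_3\bar v_7$, $v_3v_7$. A *frame graph* for $X$ arranges one frame cell per tile in a $w\times h$ grid in which adjacent cells share a side, and has an additional *cone vertex* south and west of everything else that is joined to all vertices of the west sides of the first column and of the south sides of the bottom row. All vertices are in general position with distinct $x$- and distinct $y$-coordinates; each nearly vertical grid path lies on the boundary of the convex hull of the vertices not east of its southmost vertex, and each nearly horizontal one on that of the vertices not north of its westmost vertex. *Gadgets.* Each tile type is assigned a *gadget*: the vertices of a frame cell (with or without $p$, $q$) and a graph $U$ on them with edges colored black, light or dark red, light or dark blue, whose black edges include the cell boundary. A *local coloring* $\chi$ consists of black, one shade of red and one shade of blue; $U^\chi$ is the subgraph of its edges, and it has as many edges as a triangulation of the cell. In the graph that results from gluing gadgets along matching tile sides, every vertex has, in each cardinal direction, as many light red as dark red and as many light blue as dark blue edges (at interior vertices, at the four corners of a cell, and on tile sides without a wire, already within a single gadget). The gadgets are drawn in the cells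 of the frame graph such that each edge lies in its closed cell, and such that edges of $U^\chi$ cross at most if the tile is critical and $\chi$ is light red and light blue. The *intended realizations* of a gadget are the graphs $U^\chi$ without crossing edges. *The signature $\sigma$.* Its vertices are those of the frame graph, including $p,q$ where present. In each direction the degree of a vertex is its number of black edges plus half its number of colored edges, in the union of the frame graph and all the graphs $U$. Let $\mathcal R$ be the set of realizations of $\sigma$ that contain, for every frame cell, an intended realization of its gadget. *Correctness.* A direction is *unconstrained* for a vertex of a cell in the following cases, and *constrained* otherwise: north for $v_0,\bar v_1,\dots,\bar v_4,v_4$; east for $v_0,\dots,v_4,\bar v_4$; south for $v_0,v_1,v_2,v_3$; west for $v_0,\bar v_1,\bar v_2,\bar v_3$. A vertex *matches* $\chi$ in a direction if its degree in that direction equals that in $U^\chi$. A triangulation of a gadget (on its vertices, with the cell boundary as outer boundary) is *valid* if each vertex matches some local coloring in all its constrained directions, all of $\bar v_4,\bar v_5,\bar v_6,\bar v_7,v_8$ match one common local coloring in their constrained directions, and so do all of $v_4,\dots,v_8$. A gadget is *correct* if its valid triangulations are exactly its intended realizations. **Lemma.** If the gadgets in all frame cells are correct, then every realization of $\sigma$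 lies in $\mathcal R$. -/

import Mathlib

namespace CardinalRealization

/-! ## Plane straight-line graphs and cardinal signatures -/

/-- The plane, with `z.1` the `x`-coordinate (eastward) and `z.2` the `y`-coordinate (northward). -/
abbrev Plane : Type := ℝ × ℝ

/-- The four cardinal directions. -/
inductive Dir
  | north | south | east | west
  deriving DecidableEq

/-- The point `u` lies strictly in direction `d` from the point `v`. -/
def Toward : Dir → Plane → Plane → Prop
  | .north, v, u => v.2 < u.2
  | .south, v, u => u.2 < v.2
  | .east, v, u => v.1 < u.1
  | .west, v, u => u.1 < v.1

/-- Distinct edges are drawn as segments with disjoint interiors. -/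
def CrossingFree (G : SimpleGraph Plane) : Prop :=
  ∀ a b c d : Plane, G.Adj a b → G.Adj c d → s(a, b) ≠ s(c, d) →
    Disjoint (openSegment ℝ a b) (openSegment ℝ c d)

/-- `G` (its edges being pairs of points) is a plane straight-line graph with vertex set `V`. -/
structure IsPSLGraph (V : Finset Plane) (G : SimpleGraph Plane) : Prop where
  mem : ∀ a b, G.Adj a b → a ∈ V ∧ b ∈ V
  crossingFree : CrossingFree G
  not_mem_edge : ∀ a b, G.Adj a b → ∀ v ∈ V, v ∉ openSegment ℝ a b

/-- The cardinal degree of `v` in direction `d`. -/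
noncomputable def cardinalDegree (G : SimpleGraph Plane) (d : Dir) (v : Plane) : ℕ :=
  {u | G.Adj v u ∧ Toward d v u}.ncard

/-- A cardinal signature: a finite vertex set with four degree functions on it. -/
structure CardinalSignature where
  verts : Finset Plane
  deg : Dir → verts → ℕ

/-- The cardinal signature of a graph with vertex set `V`. -/
noncomputable def signatureOf (V : Finset Plane) (G : SimpleGraph Plane) : CardinalSignature where
  verts := V
  deg d v := cardinalDegree G d v

/-- `G` is a realization of `σ`: a plane straight-line graph on the vertices of `σ` whose
cardinal signature is `σ`. -/
def IsRealization (σ : CardinalSignature) (G : SimpleGraph Plane) : Prop :=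
  IsPSLGraph σ.verts G ∧ signatureOf σ.verts G = σ

/-- Distinct `x`-coordinates, distinct `y`-coordinates, no three points on a line. -/
structure InGeneralPosition (V : Finset Plane) : Prop where
  fst_injOn : Set.InjOn Prod.fst (V : Set Plane)
  snd_injOn : Set.InjOn Prod.snd (V : Set Plane)
  not_collinear : ∀ a ∈ V, ∀ b ∈ V, ∀ c ∈ V, a ≠ b → b ≠ c → a ≠ c → ¬ Collinear ℝ {a, b, c}

/-- Twice the signed area of the triangle `abc`; positive iff `c` is to the left of the line
directed from `a` to `b`. -/
def orient (a b c : Plane) : ℝ :=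
  (b.1 - a.1) * (c.2 - a.2) - (b.2 - a.2) * (c.1 - a.1)

/-- `ab` is an edge of the boundary of the convex hull of `S`
(for a finite set `S` without three collinear points): `S` lies on one side of the line `ab`. -/
def IsHullEdge (S : Set Plane) (a b : Plane) : Prop :=
  a ∈ S ∧ b ∈ S ∧ a ≠ b ∧ ((∀ z ∈ S, 0 ≤ orient a b z) ∨ (∀ z ∈ S, orient a b z ≤ 0))

/-! ## Tilings -/

/-- The two hues of wires (cycles). -/
inductive Hue
  | red | blue
  deriving DecidableEq

/-- The two shades of each hue. -/
inductive Shade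
  | light | dark
  deriving DecidableEq

instance : Fintype Hue := ⟨{.red, .blue}, by intro x; cases x <;> simp⟩

instance : Fintype Shade := ⟨{.light, .dark}, by intro x; cases x <;> simp⟩

/-- The two sides of a tile that a wire in a monochromatic tile connects. -/
inductive WireShape
  | NE | NW | SE | SW | NS | EW
  deriving DecidableEq

/-- The seventeen tile types: the blank tile, the six monochromatic tiles in both hues, and the
four crossing tiles. -/
inductive TileType
  | blank
  | wire (hue : Hue) (shape : WireShape)
  | crossing1 | crossing2 | crossing3 | crossing4
  deriving DecidableEq

/-- What passes through a side of a tile: nothing, a single wire, or (inside the block formed by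
the four crossing tiles) both wires.  The three sides inside such a block are kept apart, so that
tiles with matching sides use the four crossing tiles only as a complete block. -/
inductive SideType
  | none
  | single (hue : Hue)
  | both13 | both23 | both24
  deriving DecidableEq

/-- A wire of the given shape passes through the side in direction `d`. -/
def WireShape.Uses : WireShape → Dir → Bool
  | .NE, .north => true
  | .NE, .east => true
  | .NW, .north => true
  | .NW, .west => true
  | .SE, .south => true
  | .SE, .east => true
  | .SW, .south => true
  | .SW, .west => true
  | .NS, .north => true
  | .NS, .south => true
  | .EW, .east => true
  | .EW, .west => true
  | _, _ => false

/-- What passes through the side of a tile in direction `d`.  In a block of crossing tiles,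
Crossing iii lies below Crossing i and to the right of Crossing ii, and Crossing iv lies below
Crossing ii. -/
def TileType.side : TileType → Dir → SideType
  | .blank, _ => .none
  | .wire c s, d => if s.Uses d then .single c else .none
  | .crossing1, .west => .single .red
  | .crossing1, .east => .single .blue
  | .crossing1, .south => .both13
  | .crossing1, .north => .none
  | .crossing2, .east => .both23
  | .crossing2, .south => .both24
  | .crossing2, .north => .none
  | .crossing2, .west => .none
  | .crossing3, .north => .both13
  | .crossing3, .west => .both23
  | .crossing3, .south => .none
  | .crossing3, .east => .none
  | .crossing4, .north => .both24
  | .crossing4, .west => .single .blue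
  | .crossing4, .south => .single .red
  | .crossing4, .east => .none

/-- The critical tile types: Crossing ii and Crossing iii. -/
def TileType.Critical (t : TileType) : Prop :=
  t = .crossing2 ∨ t = .crossing3

/-- A `w × h` grid of tiles; `tile i j` is in column `i` from the left and row `j` from the bottom.
The sides of adjacent tiles match, and nothing passes through the boundary of the grid. -/
structure Tiling (w h : ℕ) where
  tile : Fin w → Fin h → TileType
  horizontal : ∀ (i i' : Fin w) (j : Fin h), (i' : ℕ) = i + 1 →
    (tile i j).side .east = (tile i' j).side .west
  vertical : ∀ (i : Fin w) (j j' : Fin h), (j' : ℕ) = j + 1 →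
    (tile i j).side .north = (tile i j').side .south
  west_end : ∀ (i : Fin w) (j : Fin h), (i : ℕ) = 0 → (tile i j).side .west = .none
  east_end : ∀ (i : Fin w) (j : Fin h), (i : ℕ) + 1 = w → (tile i j).side .east = .none
  south_end : ∀ (i : Fin w) (j : Fin h), (j : ℕ) = 0 → (tile i j).side .south = .none
  north_end : ∀ (i : Fin w) (j : Fin h), (j : ℕ) + 1 = h → (tile i j).side .north = .none

/-! ## Gadgets -/

/-- The names of the vertices of a frame cell: the sixteen boundary vertices and the two possible
interior vertices `p` and `q`.  In counterclockwise order, the boundary is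
`v0, b1, b2, b3, b4, b5, b6, b7, v8, v7, v6, v5, v4, v3, v2, v1`. -/
inductive CellVertex
  | v0 | v1 | v2 | v3 | v4 | v5 | v6 | v7 | v8
  | b1 | b2 | b3 | b4 | b5 | b6 | b7
  | p | q
  deriving DecidableEq

instance : Fintype CellVertex where
  elems := {.v0, .v1, .v2, .v3, .v4, .v5, .v6, .v7, .v8, .b1, .b2, .b3, .b4, .b5, .b6, .b7, .p, .q}
  complete := by intro x; cases x <;> simp

namespace CellVertex

/-- The vertices of a frame cell by increasing `x`-coordinate. -/
def xOrder : List CellVertex :=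
  [b4, b5, b6, b7, v8, p, b3, b2, b1, v0, v1, v2, v3, q, v7, v6, v5, v4]

/-- The vertices of a frame cell by increasing `y`-coordinate. -/
def yOrder : List CellVertex :=
  [v4, v5, v6, v7, v8, q, v3, v2, v1, v0, b1, b2, b3, p, b7, b6, b5, b4]

/-- The cell vertex `b` lies in direction `d` from the cell vertex `a`. -/
def Toward : Dir → CellVertex → CellVertex → Prop
  | .north, a, b => yOrder.idxOf a < yOrder.idxOf b
  | .south, a, b => yOrder.idxOf b < yOrder.idxOf a
  | .east, a, b => xOrder.idxOf a < xOrder.idxOf b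
  | .west, a, b => xOrder.idxOf b < xOrder.idxOf a

/-- The edges of the west boundary followed by those of the south boundary. -/
def southWestEdges : List (CellVertex × CellVertex) :=
  [(b4, b5), (b5, b6), (b6, b7), (b7, v8), (v8, v7), (v7, v6), (v6, v5), (v5, v4)]

/-- The edges of the east boundary followed by those of the north boundary. -/
def northEastEdges : List (CellVertex × CellVertex) :=
  [(v4, v3), (v3, v2), (v2, v1), (v1, v0), (v0, b1), (b1, b2), (b2, b3), (b3, b4)]

def boundaryEdges : List (CellVertex × CellVertex) := southWestEdges ++ northEastEdges

def westBoundary : List CellVertex := [b4, b5, b6, b7, v8]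

def southBoundary : List CellVertex := [v4, v5, v6, v7, v8]

/-- The four corners of a frame cell. -/
def corners : List CellVertex := [v0, b4, v8, v4]

/-- The three vertices inside the side in direction `d`: from north to south on the west and east
sides, from west to east on the south and north sides. -/
def sideVertex : Dir → Fin 3 → CellVertex
  | .west => ![b5, b6, b7]
  | .east => ![v1, v2, v3]
  | .south => ![v7, v6, v5]
  | .north => ![b3, b2, b1]

/-- The unconstrained cardinal directions of a vertex. -/
def Unconstrained : Dir → CellVertex → Prop
  | .north, a => a ∈ [v0, b1, b2, b3, b4, v4]
  | .east, a => a ∈ [v0, v1, v2, v3, v4, b4]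
  | .south, a => a ∈ [v0, v1, v2, v3]
  | .west, a => a ∈ [v0, b1, b2, b3]

end CellVertex

/-- The five colors of edges of a gadget: black, and each hue in two shades. -/
inductive EdgeColor
  | black
  | tint (c : Hue) (s : Shade)
  deriving DecidableEq

/-- A local coloring: black, and one shade of each hue. -/
abbrev LocalColoring : Type := Hue → Shade

/-- The color belongs to the local coloring. -/
def LocalColoring.Uses (χ : LocalColoring) : EdgeColor → Prop
  | .black => True
  | .tint c s => χ c = s

/-- The edge-colored graph that defines a gadget.  `color e = none` means that `e` is not an edge.
The edges of the frame cell boundary are black, and every local coloring selects as many edges as a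
triangulation of a 16-gon with at most two interior points has. -/
structure Gadget where
  hasP : Bool
  hasQ : Bool
  color : Sym2 CellVertex → Option EdgeColor
  not_loop : ∀ a, color s(a, a) = none
  noP : hasP = false → ∀ a, color s(.p, a) = none
  noQ : hasQ = false → ∀ a, color s(.q, a) = none
  boundary_black : ∀ e ∈ CellVertex.boundaryEdges, color s(e.1, e.2) = some .black
  edge_count : ∀ χ : LocalColoring,
    {e | ∃ c, color e = some c ∧ χ.Uses c}.ncard = 29 + 3 * hasP.toNat + 3 * hasQ.toNat

namespace Gadget

/-- The vertices of the gadget. -/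
def verts (g : Gadget) : Finset CellVertex :=
  Finset.univ.filter fun a => (a = .p → g.hasP = true) ∧ (a = .q → g.hasQ = true)

/-- The number of edges of hue `c` and shade `s` at `a` in direction `d`. -/
noncomputable def tintDegree (g : Gadget) (c : Hue) (s : Shade) (d : Dir) (a : CellVertex) : ℕ :=
  {b | g.color s(a, b) = some (.tint c s) ∧ CellVertex.Toward d a b}.ncard

/-- At the vertex `a`, every cardinal direction has as many light as dark edges of hue `c`. -/
def BalancedAt (g : Gadget) (a : CellVertex) : Prop :=
  ∀ c d, g.tintDegree c .light d a = g.tintDegree c .dark d a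

/-- When the vertex `a` of a copy of `g` and the vertex `a'` of a copy of `g'` coincide, every
cardinal direction has as many light as dark edges of each hue there. -/
def BalancedWith (g : Gadget) (a : CellVertex) (g' : Gadget) (a' : CellVertex) : Prop :=
  ∀ c d, g.tintDegree c .light d a + g'.tintDegree c .light d a' =
    g.tintDegree c .dark d a + g'.tintDegree c .dark d a'

end Gadget

/-- A choice of a gadget for each of the seventeen tile types, such that in the graph that results
from gluing gadgets of tiles with matching sides, every vertex has in each cardinal direction as
many light red as dark red, and as many light blue as dark blue edges; at interior vertices, at
corners, and on sides that nothing passes through, this holds in each single gadget. -/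
structure GadgetSystem where
  gadget : TileType → Gadget
  balanced_p : ∀ t, (gadget t).BalancedAt .p
  balanced_q : ∀ t, (gadget t).BalancedAt .q
  balanced_corner : ∀ t, ∀ a ∈ CellVertex.corners, (gadget t).BalancedAt a
  balanced_free : ∀ t d, t.side d = .none →
    ∀ k, (gadget t).BalancedAt (CellVertex.sideVertex d k)
  balanced_horizontal : ∀ t t' : TileType, t.side .east = t'.side .west → ∀ k,
    (gadget t).BalancedWith (CellVertex.sideVertex .east k)
      (gadget t') (CellVertex.sideVertex .west k)
  balanced_vertical : ∀ t t' : TileType, t.side .north = t'.side .south → ∀ k,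
    (gadget t).BalancedWith (CellVertex.sideVertex .north k)
      (gadget t') (CellVertex.sideVertex .south k)

/-! ## Gadgets drawn in a frame cell

`f : CellVertex → Plane` gives the positions of the vertices of a frame cell. -/

/-- The polygonal path formed by the listed edges. -/
def pathOf (f : CellVertex → Plane) (l : List (CellVertex × CellVertex)) : Set Plane :=
  {z | ∃ e ∈ l, z ∈ segment ℝ (f e.1) (f e.2)}

/-- The closed region bounded by the frame cell.  As its two boundary paths between the
north-west corner `b4` and the south-east corner `v4` descend eastward, it consists of the points
that are weakly north-east of the south-west path and weakly south-west of the north-east path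
(`≤` on points is coordinatewise). -/
def cellRegion (f : CellVertex → Plane) : Set Plane :=
  {z | (∃ a ∈ pathOf f CellVertex.southWestEdges, a ≤ z) ∧
    (∃ b ∈ pathOf f CellVertex.northEastEdges, z ≤ b)}

/-- The boundary cycle of a frame cell, as a graph on points. -/
def boundaryGraph (f : CellVertex → Plane) : SimpleGraph Plane :=
  SimpleGraph.fromRel fun x y => ∃ e ∈ CellVertex.boundaryEdges, f e.1 = x ∧ f e.2 = y

namespace Gadget

/-- The subgraph of the edges of the local coloring `χ`, drawn at the positions `f`. -/
def graph (g : Gadget) (f : CellVertex → Plane) (χ : LocalColoring) : SimpleGraph Plane :=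
  SimpleGraph.fromRel fun x y => ∃ a b c, g.color s(a, b) = some c ∧ χ.Uses c ∧ f a = x ∧ f b = y

/-- The positions of the vertices of the gadget. -/
noncomputable def points (g : Gadget) (f : CellVertex → Plane) : Finset Plane :=
  g.verts.image f

/-- `f` places the vertices of the gadget as those of a frame cell: the boundary is a plane cycle,
the coordinates are ordered as prescribed, `p` is south-west of `b3 b7` and `q` is south-west
of `v3 v7`. -/
structure IsFrameCell (g : Gadget) (f : CellVertex → Plane) : Prop where
  crossingFree : CrossingFree (boundaryGraph f)
  x_order : ∀ a ∈ g.verts, ∀ b ∈ g.verts, CellVertex.Toward .east a b → (f a).1 < (f b).1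
  y_order : ∀ a ∈ g.verts, ∀ b ∈ g.verts, CellVertex.Toward .north a b → (f a).2 < (f b).2
  p_side : g.hasP = true → 0 < orient (f .b3) (f .b7) (f .p)
  q_side : g.hasQ = true → 0 < orient (f .v7) (f .v3) (f .q)

/-- A plane straight-line graph on the vertices of the gadget that contains the frame cell boundary
and lies in the region bounded by it. -/
structure IsCellGraph (g : Gadget) (f : CellVertex → Plane) (G : SimpleGraph Plane) : Prop where
  psl : IsPSLGraph (g.points f) G
  boundary_le : boundaryGraph f ≤ G
  inside : ∀ a b, G.Adj a b → segment ℝ a b ⊆ cellRegion f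

/-- A triangulation of the gadget: no edge can be added within the frame cell, that is, the frame
cell boundary is the boundary of the outer face and all bounded faces are triangles. -/
def IsTriangulation (g : Gadget) (f : CellVertex → Plane) (G : SimpleGraph Plane) : Prop :=
  Maximal (g.IsCellGraph f) G

/-- The intended realizations: the graphs of local colorings without crossing edges. -/
def intended (g : Gadget) (f : CellVertex → Plane) : Set (SimpleGraph Plane) :=
  {G | ∃ χ, G = g.graph f χ ∧ CrossingFree G}

/-- The vertex `a` matches the local coloring `χ` in all its constrained directions. -/
def Matches (g : Gadget) (f : CellVertex → Plane) (G : SimpleGraph Plane) (χ : LocalColoring)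
    (a : CellVertex) : Prop :=
  ∀ d, ¬ CellVertex.Unconstrained d a →
    cardinalDegree G d (f a) = cardinalDegree (g.graph f χ) d (f a)

/-- Valid triangulations of the gadget. -/
structure IsValid (g : Gadget) (f : CellVertex → Plane) (G : SimpleGraph Plane) : Prop where
  triangulation : g.IsTriangulation f G
  vertex : ∀ a ∈ g.verts, ∃ χ, g.Matches f G χ a
  west : ∃ χ, ∀ a ∈ CellVertex.westBoundary, g.Matches f G χ a
  south : ∃ χ, ∀ a ∈ CellVertex.southBoundary, g.Matches f G χ a

/-- The gadget is correct: its valid triangulations are exactly the intended ones. -/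
def IsCorrect (g : Gadget) (f : CellVertex → Plane) : Prop :=
  {G | g.IsValid f G} = g.intended f

end Gadget

/-! ## Frame graphs and the constructed cardinal signature -/

/-- Position of a vertex of a frame cell in a `4 × 4` grid; the subdivided vertical path `i` has
first coordinate `4 * i`, and the subdivided horizontal path `j` has second coordinate `4 * j`. -/
def CellVertex.offset : CellVertex → ℕ × ℕ
  | .v0 => (4, 4)
  | .v1 => (4, 3)
  | .v2 => (4, 2)
  | .v3 => (4, 1)
  | .v4 => (4, 0)
  | .v5 => (3, 0)
  | .v6 => (2, 0)
  | .v7 => (1, 0)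
  | .v8 => (0, 0)
  | .b1 => (3, 4)
  | .b2 => (2, 4)
  | .b3 => (1, 4)
  | .b4 => (0, 4)
  | .b5 => (0, 3)
  | .b6 => (0, 2)
  | .b7 => (0, 1)
  | .p => (1, 3)
  | .q => (3, 1)

/-- The positions of the vertices of the frame cell in column `i` and row `j`. -/
def cellAt (pos : ℕ × ℕ → Plane) (i j : ℕ) (a : CellVertex) : Plane :=
  pos (4 * i + a.offset.1, 4 * j + a.offset.2)

/-- The vertex set of the frame graph of a tiling: the cone vertex and the vertices of all
gadgets. -/
noncomputable def frameVerts {w h : ℕ} (S : GadgetSystem) (X : Tiling w h) (pos : ℕ × ℕ → Plane)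
    (cone : Plane) : Finset Plane :=
  insert cone (Finset.univ.biUnion fun i : Fin w => Finset.univ.biUnion fun j : Fin h =>
    (S.gadget (X.tile i j)).points (cellAt pos i j))

/-- A frame graph for the tiling `X`, with the gadgets drawn in its frame cells. -/
structure FrameGraph {w h : ℕ} (S : GadgetSystem) (X : Tiling w h) where
  pos : ℕ × ℕ → Plane
  cone : Plane
  generalPosition : InGeneralPosition (frameVerts S X pos cone)
  frameCell : ∀ (i : Fin w) (j : Fin h), (S.gadget (X.tile i j)).IsFrameCell (cellAt pos i j)
  /-- Each nearly vertical path lies on the convex hull of all the vertices that are not to the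
  east of its southmost vertex. -/
  vertical_hull : ∀ i ≤ w, ∀ m < 4 * h,
    IsHullEdge {z | z ∈ frameVerts S X pos cone ∧ z.1 ≤ (pos (4 * i, 0)).1}
      (pos (4 * i, m)) (pos (4 * i, m + 1))
  /-- Each nearly horizontal path lies on the convex hull of all the vertices that are not to the
  north of its westmost vertex. -/
  horizontal_hull : ∀ j ≤ h, ∀ m < 4 * w,
    IsHullEdge {z | z ∈ frameVerts S X pos cone ∧ z.2 ≤ (pos (0, 4 * j)).2}
      (pos (m, 4 * j)) (pos (m + 1, 4 * j))
  /-- The cone vertex is to the south and west of all frame cells. -/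
  cone_southWest : ∀ z ∈ frameVerts S X pos cone, z ≠ cone → cone.1 < z.1 ∧ cone.2 < z.2
  /-- Gadgets are drawn inside their frame cells. -/
  drawn_inside : ∀ (i : Fin w) (j : Fin h) (χ : LocalColoring) (a b : Plane),
    ((S.gadget (X.tile i j)).graph (cellAt pos i j) χ).Adj a b →
      segment ℝ a b ⊆ cellRegion (cellAt pos i j)
  /-- Edges of a local coloring cross only for the light-light coloring of a critical tile. -/
  drawn_crossingFree : ∀ (i : Fin w) (j : Fin h) (χ : LocalColoring),
    ¬ ((X.tile i j).Critical ∧ χ = fun _ => .light) →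
      CrossingFree ((S.gadget (X.tile i j)).graph (cellAt pos i j) χ)

namespace FrameGraph

variable {w h : ℕ} {S : GadgetSystem} {X : Tiling w h}

/-- The vertex set. -/
noncomputable def verts (F : FrameGraph S X) : Finset Plane := frameVerts S X F.pos F.cone

/-- The gadget in column `i` and row `j`. -/
def gadget (_ : FrameGraph S X) (i : Fin w) (j : Fin h) : Gadget := S.gadget (X.tile i j)

/-- The frame cell in column `i` and row `j`. -/
def cell (F : FrameGraph S X) (i : Fin w) (j : Fin h) : CellVertex → Plane := cellAt F.pos i j

/-- The edges of color `c` in the union of the frame graph and all the gadgets' edge-colored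
graphs.  Besides the edges in the gadgets (which include the boundaries of the frame cells), there
are the black edges from the cone vertex to the first vertical and the first horizontal path. -/
def colorGraph (F : FrameGraph S X) (c : EdgeColor) : SimpleGraph Plane :=
  SimpleGraph.fromRel fun x y =>
    (∃ i j a b, (F.gadget i j).color s(a, b) = some c ∧ F.cell i j a = x ∧ F.cell i j b = y) ∨
    (c = .black ∧ x = F.cone ∧
      ((∃ m ≤ 4 * h, y = F.pos (0, m)) ∨ (∃ m ≤ 4 * w, y = F.pos (m, 0))))

/-- The constructed cardinal signature: in each direction, a vertex has its number of black edges
plus half of its number of colored edges. -/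
noncomputable def signature (F : FrameGraph S X) : CardinalSignature where
  verts := F.verts
  deg d v := cardinalDegree (F.colorGraph .black) d v +
    (∑ c : Hue, ∑ s : Shade, cardinalDegree (F.colorGraph (.tint c s)) d v) / 2

/-- The class of realizations of the constructed signature that contain, for every frame cell,
an intended realization of its gadget. -/
def intendedRealizations (F : FrameGraph S X) : Set (SimpleGraph Plane) :=
  {T | IsRealization F.signature T ∧
    ∀ i j, ∃ R ∈ (F.gadget i j).intended (F.cell i j), R ≤ T}

/-- The gadgets of all frame cells are correct. -/
def AllCorrect (F : FrameGraph S X) : Prop :=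
  ∀ i j, (F.gadget i j).IsCorrect (F.cell i j)

end FrameGraph

end CardinalRealization

/-! The signature is realized degree-wise by the union of the frame and the light edges of all
gadgets: by balance, half of the colored degree at a vertex is its degree in the light colors. This
union need not be plane, since light edges of a critical tile may cross. It serves only to count
edges, and the counts leave a plane realization `T` no freedom at the frame.

The counting tool is `IsPSLGraph.edge_bound`: a plane graph on `n` vertices has at most `3n - 5 -
|U| - |D|` edges if no edge passes above a vertex of `U` or below a vertex of `D`. Take the vertices
that are not east of the southmost vertex of a vertical path. Western neighbors of such vertices are
again of this kind, so the sum of their west degrees, which the signature prescribes, is the number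
of edges of `T` among them. This sum attains the bound with `U` the inner vertices of the upper
hull. A missing hull edge could then be added without crossings, against the bound, so `T` contains
the vertical path (`IsModel.adj_path`). South degrees give the horizontal paths by reflection. West
degrees on the first path force the edges to the cone vertex (`adj_cone`), because the only other
candidates to the west are later vertices of the same convex path. Altogether `T` contains the frame
(`IsModel.isFramed`).

Convexity of the paths together with the cone edges prevents any other edge from crossing a path
(`IsFramed.not_across`), so every edge is at the cone vertex or within a cell. A chord of a path
bends into the cell to its west or south and is counted there. Attributing side edges in the same
way makes degrees add up over cells (`IsModel.sum_cellPart`). Each cell can hold at most as many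
edges as a triangulation, and the total is that of triangulations everywhere, so every cell part is
a triangulation (`IsModel.edge_count`, `IsModel.cellPart_maximal`).

It remains to see that each cell part is valid, by induction on column plus row. In a constrained
direction, a vertex that is not inside the west or south side has known degrees in all other cells
that contain it: there only edges of a side go in this direction, or the other cell lies to the
south-west and, by induction, carries a local coloring whose degrees at corners are independent of
the coloring (`part_eq_light`). Inside the west side, the coloring of the western neighbor and the
balance across the shared side force the degrees of the same coloring in the current cell; the south
side is analogous (`part_eq_of_pair`). Thus the part is a valid triangulation, and correctness of
the gadget makes it an intended realization. -/

namespace CardinalRealization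

/-! ### Lines, segments and orientations -/

/-- The height at `x` of the line through `a` and `b`. -/
noncomputable def lineAt (a b : Plane) (x : ℝ) : ℝ :=
  a.2 + (b.2 - a.2) / (b.1 - a.1) * (x - a.1)

theorem lineAt_left (a b : Plane) : lineAt a b a.1 = a.2 := by simp [lineAt]

theorem lineAt_right {a b : Plane} (h : a.1 < b.1) : lineAt a b b.1 = b.2 := by
  have : b.1 - a.1 ≠ 0 := by linarith
  unfold lineAt; field_simp; ring

theorem orient_eq_lineAt {a b : Plane} (h : a.1 < b.1) (z : Plane) :
    orient a b z = (b.1 - a.1) * (z.2 - lineAt a b z.1) := by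
  have : b.1 - a.1 ≠ 0 := by linarith
  unfold lineAt orient; field_simp; ring

theorem orient_pos_iff {a b : Plane} (h : a.1 < b.1) (z : Plane) :
    0 < orient a b z ↔ lineAt a b z.1 < z.2 := by
  have : 0 < b.1 - a.1 := by linarith
  rw [orient_eq_lineAt h, mul_pos_iff_of_pos_left this, sub_pos]

theorem orient_neg_iff {a b : Plane} (h : a.1 < b.1) (z : Plane) :
    orient a b z < 0 ↔ z.2 < lineAt a b z.1 := by
  have : 0 < b.1 - a.1 := by linarith
  rw [orient_eq_lineAt h, ← neg_pos, ← mul_neg, mul_pos_iff_of_pos_left this]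
  constructor <;> intro h <;> linarith

theorem orient_nonpos_iff {a b : Plane} (h : a.1 < b.1) (z : Plane) :
    orient a b z ≤ 0 ↔ z.2 ≤ lineAt a b z.1 := by
  rw [← not_lt, orient_pos_iff h, not_lt]

theorem orient_nonneg_iff {a b : Plane} (h : a.1 < b.1) (z : Plane) :
    0 ≤ orient a b z ↔ lineAt a b z.1 ≤ z.2 := by
  rw [← not_lt, orient_neg_iff h, not_lt]

theorem lineAt_continuous (a b : Plane) : Continuous (lineAt a b) := by
  unfold lineAt; fun_prop

theorem mem_segment_iff_lineAt {a b : Plane} (h : a.1 < b.1) (z : Plane) :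
    z ∈ segment ℝ a b ↔ a.1 ≤ z.1 ∧ z.1 ≤ b.1 ∧ z.2 = lineAt a b z.1 := by
  have hp : 0 < b.1 - a.1 := by linarith
  rw [segment_eq_image']
  constructor
  · rintro ⟨t, ⟨h0, h1⟩, rfl⟩
    refine ⟨?_, ?_, ?_⟩
    · simp only [Prod.fst_add, Prod.smul_fst, Prod.fst_sub, smul_eq_mul]; nlinarith
    · simp only [Prod.fst_add, Prod.smul_fst, Prod.fst_sub, smul_eq_mul]; nlinarith
    · simp only [Prod.fst_add, Prod.smul_fst, Prod.fst_sub, Prod.snd_add, Prod.smul_snd,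
        Prod.snd_sub, smul_eq_mul, lineAt]
      field_simp; ring
  · rintro ⟨h0, h1, h2⟩
    refine ⟨(z.1 - a.1) / (b.1 - a.1), ⟨div_nonneg (by linarith) hp.le,
      (div_le_one hp).2 (by linarith)⟩, ?_⟩
    ext
    · simp; field_simp; ring
    · rw [h2]; simp [lineAt]; field_simp

theorem mem_openSegment_iff_lineAt {a b : Plane} (h : a.1 < b.1) (z : Plane) :
    z ∈ openSegment ℝ a b ↔ a.1 < z.1 ∧ z.1 < b.1 ∧ z.2 = lineAt a b z.1 := by
  have hp : 0 < b.1 - a.1 := by linarith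
  rw [openSegment_eq_image']
  constructor
  · rintro ⟨t, ⟨h0, h1⟩, rfl⟩
    refine ⟨?_, ?_, ?_⟩
    · simp only [Prod.fst_add, Prod.smul_fst, Prod.fst_sub, smul_eq_mul]; nlinarith
    · simp only [Prod.fst_add, Prod.smul_fst, Prod.fst_sub, smul_eq_mul]; nlinarith
    · simp only [Prod.fst_add, Prod.smul_fst, Prod.fst_sub, Prod.snd_add, Prod.smul_snd,
        Prod.snd_sub, smul_eq_mul, lineAt]
      field_simp; ring
  · rintro ⟨h0, h1, h2⟩
    refine ⟨(z.1 - a.1) / (b.1 - a.1), ⟨div_pos (by linarith) hp,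
      (div_lt_one hp).2 (by linarith)⟩, ?_⟩
    ext
    · simp; field_simp; ring
    · rw [h2]; simp [lineAt]; field_simp

/-- Two affine functions without a common value strictly between two arguments do not exchange
their order between these arguments. -/
theorem lineAt_le_of_no_crossing {a b c d : Plane} {x₀ x₁ : ℝ}
    (h0 : lineAt a b x₀ < lineAt c d x₀)
    (hne : ∀ x, min x₀ x₁ < x → x < max x₀ x₁ → lineAt a b x ≠ lineAt c d x) :
    lineAt a b x₁ ≤ lineAt c d x₁ := by
  by_contra! h1
  have hc : Continuous fun x => lineAt a b x - lineAt c d x :=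
    (lineAt_continuous a b).sub (lineAt_continuous c d)
  rcases le_total x₀ x₁ with hle | hle
  · obtain ⟨x, ⟨hx0, hx1⟩, hx⟩ := intermediate_value_Ioo hle hc.continuousOn
      (show (0 : ℝ) ∈ Set.Ioo _ _ from ⟨by linarith, by linarith⟩)
    exact hne x (by simpa [hle] using hx0) (by simpa [hle] using hx1) (by dsimp at hx; linarith)
  · obtain ⟨x, ⟨hx0, hx1⟩, hx⟩ := intermediate_value_Ioo' hle hc.continuousOn
      (show (0 : ℝ) ∈ Set.Ioo _ _ from ⟨by linarith, by linarith⟩)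
    exact hne x (by simpa [hle] using hx0) (by simpa [hle] using hx1) (by dsimp at hx; linarith)

/-- Of two edges of a crossing-free graph, the one that is lower at one common abscissa is weakly
lower at every common abscissa. -/
theorem CrossingFree.lineAt_le {G : SimpleGraph Plane} (hG : CrossingFree G) {a b c d : Plane}
    (hab : G.Adj a b) (hcd : G.Adj c d) (h1 : a.1 < b.1) (h2 : c.1 < d.1) {x₀ x₁ : ℝ}
    (h0 : lineAt a b x₀ < lineAt c d x₀)
    (ha₀ : a.1 ≤ x₀) (hb₀ : x₀ ≤ b.1) (hc₀ : c.1 ≤ x₀) (hd₀ : x₀ ≤ d.1)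
    (ha₁ : a.1 ≤ x₁) (hb₁ : x₁ ≤ b.1) (hc₁ : c.1 ≤ x₁) (hd₁ : x₁ ≤ d.1) :
    lineAt a b x₁ ≤ lineAt c d x₁ := by
  refine lineAt_le_of_no_crossing h0 fun x hx0 hx1 hx => ?_
  have hne : s(a, b) ≠ s(c, d) := by
    intro h
    rcases Sym2.eq_iff.1 h with ⟨rfl, rfl⟩ | ⟨rfl, rfl⟩
    · exact lt_irrefl _ h0
    · linarith
  have hdis := hG a b c d hab hcd hne
  have l1 : a.1 < x := lt_of_le_of_lt (le_min ha₀ ha₁) hx0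
  have l2 : x < b.1 := lt_of_lt_of_le hx1 (max_le hb₀ hb₁)
  have l3 : c.1 < x := lt_of_le_of_lt (le_min hc₀ hc₁) hx0
  have l4 : x < d.1 := lt_of_lt_of_le hx1 (max_le hd₀ hd₁)
  exact Set.disjoint_left.1 hdis
    ((mem_openSegment_iff_lineAt h1 (x, lineAt a b x)).2 ⟨l1, l2, rfl⟩)
    ((mem_openSegment_iff_lineAt h2 (x, lineAt a b x)).2 ⟨l3, l4, hx⟩)

theorem IsPSLGraph.ne_lineAt {V : Finset Plane} {G : SimpleGraph Plane} (hG : IsPSLGraph V G)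
    {a b v : Plane} (hab : G.Adj a b) (hv : v ∈ V) (h1 : a.1 < v.1) (h2 : v.1 < b.1) :
    v.2 ≠ lineAt a b v.1 := fun h =>
  hG.not_mem_edge a b hab v hv
    ((mem_openSegment_iff_lineAt (h1.trans h2) v).2 ⟨h1, h2, h⟩)

theorem lineAt_lt_lineAt_iff {v a b : Plane} {x : ℝ} (hx : v.1 < x) :
    lineAt v a x < lineAt v b x ↔
      (a.2 - v.2) / (a.1 - v.1) < (b.2 - v.2) / (b.1 - v.1) := by
  have : 0 < x - v.1 := by linarith
  unfold lineAt
  rw [add_lt_add_iff_left, mul_lt_mul_iff_left₀ this]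


/-! ### An upper bound on the number of edges -/

/-- The slope of the line through two points. -/
noncomputable def slopeTo (v u : Plane) : ℝ := (u.2 - v.2) / (u.1 - v.1)

/-- `u` and `u'` are east neighbors of `v` that are consecutive by slope, `u'` above `u`. -/
structure IsWedge (G : SimpleGraph Plane) (v u u' : Plane) : Prop where
  adj_low : G.Adj v u
  adj_high : G.Adj v u'
  lt_low : v.1 < u.1
  lt_high : v.1 < u'.1
  slope_lt : slopeTo v u < slopeTo v u'
  consecutive : ∀ t, G.Adj v t → v.1 < t.1 → slopeTo v u < slopeTo v t → slopeTo v u' ≤ slopeTo v t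

/-- `z` lies in the closed region between the edges of the wedge, east of its apex. -/
structure InWedge (v u u' z : Plane) : Prop where
  lt : v.1 < z.1
  le_low : z.1 ≤ u.1
  le_high : z.1 ≤ u'.1
  above : lineAt v u z.1 ≤ z.2
  below : z.2 ≤ lineAt v u' z.1

variable {V : Finset Plane} {G : SimpleGraph Plane}

theorem IsPSLGraph.fst_ne (hinj : Set.InjOn Prod.fst (V : Set Plane)) (hG : IsPSLGraph V G)
    {a b : Plane} (h : G.Adj a b) : a.1 ≠ b.1 := fun he =>
  h.ne (hinj (hG.mem a b h).1 (hG.mem a b h).2 he)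

/-- Of two distinct neighbors in the same direction, the nearer one would lie in the interior of the
edge to the farther one. -/
theorem IsPSLGraph.slopeTo_injective (hinj : Set.InjOn Prod.fst (V : Set Plane))
    (hG : IsPSLGraph V G) {v a b : Plane} (ha : G.Adj v a) (hb : G.Adj v b) (h1 : v.1 < a.1)
    (h2 : v.1 < b.1) (h : slopeTo v a = slopeTo v b) : a = b := by
  have key : ∀ x, lineAt v a x = lineAt v b x := by
    intro x; unfold lineAt; unfold slopeTo at h; rw [h]
  by_contra hne
  have hne' : a.1 ≠ b.1 := fun he => hne (hinj (hG.mem _ _ ha).2 (hG.mem _ _ hb).2 he)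
  rcases lt_or_gt_of_ne hne' with hl | hl
  · exact hG.ne_lineAt hb (hG.mem _ _ ha).2 h1 hl (by rw [← key, lineAt_right h1])
  · exact hG.ne_lineAt ha (hG.mem _ _ hb).2 h2 hl (by rw [key, lineAt_right h2])

/-- The region contains the nearer of the two ends, so there is a westmost vertex in it. The first
vertex may itself be an end; the charging argument in `IsPSLGraph.edge_bound` distinguishes whether
it is the upper one. -/
theorem IsWedge.exists_first (hG : IsPSLGraph V G) {v u u' : Plane} (hw : IsWedge G v u u') :
    ∃ c ∈ V, InWedge v u u' c ∧ ∀ z ∈ V, InWedge v u u' z → c.1 ≤ z.1 := by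
  classical
  have hne : (V.filter (InWedge v u u')).Nonempty := by
    rcases le_total u.1 u'.1 with h | h
    · refine ⟨u, Finset.mem_filter.2 ⟨(hG.mem _ _ hw.adj_low).2, hw.lt_low, le_rfl, h,
        (lineAt_right hw.lt_low).le, ?_⟩⟩
      rw [← lineAt_right hw.lt_low]
      exact ((lineAt_lt_lineAt_iff hw.lt_low).2 hw.slope_lt).le
    · refine ⟨u', Finset.mem_filter.2 ⟨(hG.mem _ _ hw.adj_high).2, hw.lt_high, h, le_rfl, ?_,
        (lineAt_right hw.lt_high).ge⟩⟩
      conv_rhs => rw [← lineAt_right hw.lt_high]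
      exact ((lineAt_lt_lineAt_iff hw.lt_high).2 hw.slope_lt).le
  obtain ⟨c, hc, hmin⟩ := Finset.exists_min_image _ Prod.fst hne
  rw [Finset.mem_filter] at hc
  exact ⟨c, hc.1, hc.2, fun z hz hz' => hmin z (Finset.mem_filter.2 ⟨hz, hz'⟩)⟩

/-- No edge runs strictly between the two edges of a wedge above the first vertex in it. -/
theorem IsWedge.no_edge_between (hinj : Set.InjOn Prod.fst (V : Set Plane)) (hG : IsPSLGraph V G)
    {w y y' c v u : Plane} (hw : IsWedge G w y y') (hc : InWedge w y y' c)
    (hfirst : ∀ z ∈ V, InWedge w y y' z → c.1 ≤ z.1) (hvu : G.Adj v u) (h1 : v.1 < c.1)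
    (h2 : c.1 ≤ u.1) (hlow : lineAt w y c.1 < lineAt v u c.1)
    (hhigh : lineAt v u c.1 < lineAt w y' c.1) : False := by
  have hv := (hG.mem _ _ hvu).1
  have hwV := (hG.mem _ _ hw.adj_low).1
  -- An edge starting west of the apex would be squeezed through the apex; one starting at the apex
  -- contradicts that the two edges are consecutive; one starting east of it starts at a vertex of
  -- the wedge before the first one.
  rcases lt_trichotomy v.1 w.1 with hlt | heq | hgt
  · have e1 := hG.crossingFree.lineAt_le hw.adj_low hvu hw.lt_low (h1.trans_le h2) hlow
      hc.lt.le hc.le_low h1.le h2 le_rfl hw.lt_low.le hlt.le (hc.lt.le.trans h2) (x₁ := w.1)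
    have e2 := hG.crossingFree.lineAt_le hvu hw.adj_high (h1.trans_le h2) hw.lt_high hhigh
      h1.le h2 hc.lt.le hc.le_high hlt.le (hc.lt.le.trans h2) le_rfl hw.lt_high.le (x₁ := w.1)
    rw [lineAt_left] at e1 e2
    exact hG.ne_lineAt hvu hwV hlt (hc.lt.trans_le h2) (le_antisymm e1 e2)
  · obtain rfl := hinj hv hwV heq
    rw [lineAt_lt_lineAt_iff hc.lt] at hlow hhigh
    exact absurd (hw.consecutive u hvu (h1.trans_le h2) hlow) (not_le.2 hhigh)
  · have e1 := hG.crossingFree.lineAt_le hw.adj_low hvu hw.lt_low (h1.trans_le h2) hlow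
      hc.lt.le hc.le_low h1.le h2 hgt.le (h1.le.trans hc.le_low) le_rfl (h1.le.trans h2)
      (x₁ := v.1)
    have e2 := hG.crossingFree.lineAt_le hvu hw.adj_high (h1.trans_le h2) hw.lt_high hhigh
      h1.le h2 hc.lt.le hc.le_high le_rfl (h1.le.trans h2) hgt.le (h1.le.trans hc.le_high)
      (x₁ := v.1)
    rw [lineAt_left] at e1 e2
    exact absurd (hfirst v hv ⟨hgt, h1.le.trans hc.le_low, h1.le.trans hc.le_high, e1, e2⟩)
      (not_le.2 h1)

theorem IsWedge.eq_of_high_eq (hinj : Set.InjOn Prod.fst (V : Set Plane)) (hG : IsPSLGraph V G)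
    {v u y u' : Plane} (h : IsWedge G v u u') (h' : IsWedge G v y u') : u = y := by
  refine hG.slopeTo_injective hinj h.adj_low h'.adj_low h.lt_low h'.lt_low (le_antisymm ?_ ?_)
  · by_contra! hlt
    exact absurd (h'.consecutive u h.adj_low h.lt_low hlt) (not_le.2 h.slope_lt)
  · by_contra! hlt
    exact absurd (h.consecutive y h'.adj_low h'.lt_low hlt) (not_le.2 h'.slope_lt)

/-- Two edges at the same height above or below a vertex are equal. -/
theorem IsPSLGraph.eq_of_lineAt_eq (hG : IsPSLGraph V G) {a b c d : Plane} {x : ℝ}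
    (hab : G.Adj a b) (hcd : G.Adj c d) (h1 : a.1 < x) (h2 : x < b.1) (h3 : c.1 < x)
    (h4 : x < d.1) (h : lineAt a b x = lineAt c d x) : a = c ∧ b = d := by
  by_contra hne
  have hne' : s(a, b) ≠ s(c, d) := by
    intro he
    rcases Sym2.eq_iff.1 he with he | ⟨rfl, rfl⟩
    · exact hne he
    · linarith
  exact Set.disjoint_left.1 (hG.crossingFree a b c d hab hcd hne')
    ((mem_openSegment_iff_lineAt (h1.trans h2) (x, lineAt a b x)).2 ⟨h1, h2, rfl⟩)
    ((mem_openSegment_iff_lineAt (h3.trans h4) (x, lineAt a b x)).2 ⟨h3, h4, h⟩)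

open Classical in
theorem cardinalDegree_eq_card_filter (hG : ∀ a b, G.Adj a b → a ∈ V ∧ b ∈ V) (d : Dir)
    (v : Plane) :
    cardinalDegree G d v = (V.filter fun u => G.Adj v u ∧ Toward d v u).card := by
  rw [cardinalDegree, ← Set.ncard_coe_finset]
  congr 1
  ext u
  simp only [Set.mem_ofPred_eq, Finset.coe_filter]
  exact ⟨fun h => ⟨(hG _ _ h.1).2, h⟩, fun h => h.2⟩

/-- The number of edges of a plane straight-line graph with `n` vertices is at most
`3 n - 5 - |U| - |D|` if no vertex of `U` lies below and no vertex of `D` lies above an edge. -/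
theorem IsPSLGraph.edge_bound (hinj : Set.InjOn Prod.fst (V : Set Plane)) (hG : IsPSLGraph V G)
    {l r : Plane} (hl : l ∈ V) (hr : r ∈ V) (hlr : l ≠ r) (hlmin : ∀ z ∈ V, l.1 ≤ z.1)
    (hrmax : ∀ z ∈ V, z.1 ≤ r.1) (U D : Finset Plane) (hUV : U ⊆ V) (hDV : D ⊆ V)
    (hlU : l ∉ U) (hrU : r ∉ U) (hlD : l ∉ D) (hrD : r ∉ D)
    (hU : ∀ u ∈ U, ∀ a b, G.Adj a b → a.1 < u.1 → u.1 < b.1 → lineAt a b u.1 ≤ u.2)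
    (hD : ∀ u ∈ D, ∀ a b, G.Adj a b → a.1 < u.1 → u.1 < b.1 → u.2 ≤ lineAt a b u.1) :
    ∑ v ∈ V, cardinalDegree G .east v + U.card + D.card + 5 ≤ 3 * V.card := by
  classical
  -- lower edges of wedges
  let N : Plane → Finset Plane := fun v => V.filter fun u => G.Adj v u ∧ v.1 < u.1
  let L : Plane → Finset Plane := fun v => (N v).filter fun u => ∃ t ∈ N v, slopeTo v u < slopeTo v t
  have hN : ∀ v, cardinalDegree G .east v = (N v).card := fun v =>
    cardinalDegree_eq_card_filter hG.mem .east v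
  -- Every eastward edge except the steepest one at its west end is the lower edge of a wedge. One
  -- edge is lost per vertex, and none at the eastmost vertex `r`.
  have hNL : ∀ v, (N v).card ≤ (L v).card + 1 := by
    intro v
    have hsub : L v ⊆ N v := Finset.filter_subset _ _
    have : (N v \ L v).card ≤ 1 := by
      refine Finset.card_le_one.2 fun a ha b hb => ?_
      simp only [L, Finset.mem_sdiff, Finset.mem_filter, not_and, not_exists, not_lt] at ha hb
      have ha' := (Finset.mem_filter.1 ha.1).2
      have hb' := (Finset.mem_filter.1 hb.1).2
      exact hG.slopeTo_injective hinj ha'.1 hb'.1 ha'.2 hb'.2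
        (le_antisymm (hb.2 hb.1 a ha.1) (ha.2 ha.1 b hb.1))
    have := Finset.card_sdiff_add_card_eq_card hsub
    omega
  have hNr : N r = ∅ := by
    refine Finset.filter_eq_empty_iff.2 fun u hu h => ?_
    exact absurd (hrmax u hu) (not_le.2 h.2)
  have hsum : ∑ v ∈ V, (N v).card ≤ ∑ v ∈ V, (L v).card + (V.card - 1) := by
    rw [← Finset.sum_erase_add V _ hr, hNr, Finset.card_empty, add_zero,
      ← Finset.card_erase_of_mem hr]
    calc ∑ v ∈ V.erase r, (N v).card ≤ ∑ v ∈ V.erase r, ((L v).card + 1) :=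
          Finset.sum_le_sum fun v _ => hNL v
      _ = ∑ v ∈ V.erase r, (L v).card + (V.erase r).card := by
          rw [Finset.sum_add_distrib, Finset.sum_const, smul_eq_mul, mul_one]
      _ ≤ _ := by
          gcongr
          exact Finset.erase_subset _ _
  -- the upper edge and the first vertex of a wedge
  have hex : ∀ e : (Σ _ : Plane, Plane), e ∈ V.sigma L → ∃ u' c, IsWedge G e.1 e.2 u' ∧ c ∈ V ∧
      InWedge e.1 e.2 u' c ∧ ∀ z ∈ V, InWedge e.1 e.2 u' z → c.1 ≤ z.1 := by
    rintro ⟨v, u⟩ he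
    simp only [Finset.mem_sigma, L, Finset.mem_filter] at he
    obtain ⟨hv, hu, t, ht, hut⟩ := he
    obtain ⟨u', hu', hmin⟩ := Finset.exists_min_image
      ((N v).filter fun t => slopeTo v u < slopeTo v t) (slopeTo v) ⟨t, Finset.mem_filter.2 ⟨ht, hut⟩⟩
    rw [Finset.mem_filter] at hu'
    have hu1 := (Finset.mem_filter.1 hu).2
    have hu1' := (Finset.mem_filter.1 hu'.1).2
    have hw : IsWedge G v u u' := ⟨hu1.1, hu1'.1, hu1.2, hu1'.2, hu'.2, fun s hs hs1 hs2 =>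
      hmin s (Finset.mem_filter.2 ⟨Finset.mem_filter.2 ⟨(hG.mem _ _ hs).2, hs, hs1⟩, hs2⟩)⟩
    obtain ⟨c, hc⟩ := hw.exists_first hG
    exact ⟨u', c, hw, hc⟩
  choose! hi fi hhi hfiV hfi hfirst using hex
  -- Each wedge is charged to its first vertex and to the bit that tells whether this is the upper
  -- end. With bit `false` the vertex lies strictly below the upper edge and so avoids `U`; with bit
  -- `true` it lies strictly above the lower edge and so avoids `D`. In both cases it is neither `l`
  -- nor `r`.
  let φ : (Σ _ : Plane, Plane) → Plane × Bool := fun e => (fi e, decide (fi e = hi e))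
  let tgt : Finset (Plane × Bool) :=
    (((V.erase l).erase r) \ U) ×ˢ {false} ∪ (((V.erase l).erase r) \ D) ×ˢ {true}
  -- position of the first vertex
  have hup : ∀ e ∈ V.sigma L, fi e ≠ hi e → (fi e).1 < (hi e).1 ∧
      (fi e).2 < lineAt e.1 (hi e) (fi e).1 := by
    intro e he hne
    have hlt : (fi e).1 < (hi e).1 := lt_of_le_of_ne (hfi e he).le_high fun h =>
      hne (hinj (hfiV e he) (hG.mem _ _ (hhi e he).adj_high).2 h)
    exact ⟨hlt, lt_of_le_of_ne (hfi e he).below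
      (hG.ne_lineAt (hhi e he).adj_high (hfiV e he) (hfi e he).lt hlt)⟩
  have hdown : ∀ e ∈ V.sigma L, fi e = hi e → (fi e).1 < e.2.1 ∧
      lineAt e.1 e.2 (fi e).1 < (fi e).2 := by
    intro e he heq
    have hne : fi e ≠ e.2 := by
      intro h
      have := (hhi e he).slope_lt
      rw [← heq, h] at this
      exact lt_irrefl _ this
    have hlt : (fi e).1 < e.2.1 := lt_of_le_of_ne (hfi e he).le_low fun h =>
      hne (hinj (hfiV e he) (hG.mem _ _ (hhi e he).adj_low).2 h)
    exact ⟨hlt, lt_of_le_of_ne (hfi e he).above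
      (hG.ne_lineAt (hhi e he).adj_low (hfiV e he) (hfi e he).lt hlt).symm⟩
  have hmaps : ∀ e ∈ V.sigma L, φ e ∈ tgt := by
    intro e he
    have hne_l : fi e ≠ l := by
      intro h
      have h1 := (hfi e he).lt
      rw [h] at h1
      exact absurd (hlmin _ (Finset.mem_sigma.1 he).1) (not_le.2 h1)
    have hmem_high := (hG.mem _ _ (hhi e he).adj_high).2
    have hmem_low := (hG.mem _ _ (hhi e he).adj_low).2
    by_cases heq : fi e = hi e
    · obtain ⟨h1, h2⟩ := hdown e he heq
      refine Finset.mem_union_right _ (Finset.mem_product.2 ⟨?_, by simp [φ, heq]⟩)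
      refine Finset.mem_sdiff.2 ⟨Finset.mem_erase.2 ⟨?_, Finset.mem_erase.2 ⟨hne_l, hfiV e he⟩⟩, ?_⟩
      · intro h
        change fi e = r at h
        rw [h] at h1
        exact absurd (hrmax _ hmem_low) (not_le.2 h1)
      · intro h
        exact absurd (hD _ h _ _ (hhi e he).adj_low (hfi e he).lt h1) (not_le.2 h2)
    · obtain ⟨h1, h2⟩ := hup e he heq
      refine Finset.mem_union_left _ (Finset.mem_product.2 ⟨?_, by simp [φ, heq]⟩)
      refine Finset.mem_sdiff.2 ⟨Finset.mem_erase.2 ⟨?_, Finset.mem_erase.2 ⟨hne_l, hfiV e he⟩⟩, ?_⟩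
      · intro h
        change fi e = r at h
        rw [h] at h1
        exact absurd (hrmax _ hmem_high) (not_le.2 h1)
      · intro h
        exact absurd (hU _ h _ _ (hhi e he).adj_high (hfi e he).lt h1) (not_le.2 h2)
  -- With bit `true` the lower edge is the first edge directly below the charged vertex, with bit
  -- `false` the upper edge is the first one directly above it. If two wedges with the same charge
  -- differed here, one of these edges would run strictly between the two edges of the other wedge.
  have hφ : Set.InjOn φ (V.sigma L : Set (Σ _ : Plane, Plane)) := by
    intro e he e' he' heq
    have hc : fi e = fi e' := congrArg Prod.fst heq
    have hb : decide (fi e = hi e) = decide (fi e' = hi e') := congrArg Prod.snd heq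
    rw [decide_eq_decide] at hb
    by_cases hd : fi e = hi e
    · have hd' := hb.1 hd
      obtain ⟨h1, h2⟩ := hdown e he hd
      obtain ⟨h1', h2'⟩ := hdown e' he' hd'
      have k := (hfi e he).lt
      have k' := (hfi e' he').lt
      have t : lineAt e.1 (hi e) (fi e).1 = (fi e).2 := by rw [hd, lineAt_right (hhi e he).lt_high]
      have t' : lineAt e'.1 (hi e') (fi e').1 = (fi e').2 := by
        rw [hd', lineAt_right (hhi e' he').lt_high]
      rcases lt_trichotomy (lineAt e.1 e.2 (fi e).1) (lineAt e'.1 e'.2 (fi e).1) with hlt | h | hlt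
      · exact ((hhi e he).no_edge_between hinj hG (hfi e he) (hfirst e he) (hhi e' he').adj_low
          (hc ▸ k') (hc ▸ h1'.le) hlt (by rw [t, hc]; exact h2')).elim
      · rw [hc] at k h1 h
        obtain ⟨ha, hb⟩ := hG.eq_of_lineAt_eq (hhi e he).adj_low (hhi e' he').adj_low k h1 k' h1' h
        exact Sigma.ext ha (heq_of_eq hb)
      · rw [hc] at hlt k h1 h2
        exact ((hhi e' he').no_edge_between hinj hG (hfi e' he') (hfirst e' he') (hhi e he).adj_low
          k h1.le hlt (by rw [t']; exact h2)).elim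
    · have hd' := fun h => hd (hb.2 h)
      obtain ⟨h1, h2⟩ := hup e he hd
      obtain ⟨h1', h2'⟩ := hup e' he' hd'
      have k := (hfi e he).lt
      have k' := (hfi e' he').lt
      rcases lt_trichotomy (lineAt e.1 (hi e) (fi e).1) (lineAt e'.1 (hi e') (fi e).1)
        with hlt | h | hlt
      · rw [hc] at hlt k h1 h2
        exact ((hhi e' he').no_edge_between hinj hG (hfi e' he') (hfirst e' he') (hhi e he).adj_high
          k h1.le ((hfi e' he').above.trans_lt h2) hlt).elim
      · rw [hc] at k h1 h
        obtain ⟨ha, hb⟩ := hG.eq_of_lineAt_eq (hhi e he).adj_high (hhi e' he').adj_high k h1 k' h1' h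
        obtain ⟨v, u⟩ := e
        obtain ⟨v', y⟩ := e'
        dsimp only at ha
        subst ha
        have hw := hhi _ he
        rw [hb] at hw
        obtain rfl := hw.eq_of_high_eq hinj hG (hhi _ he')
        rfl
      · rw [← hc] at k' h1' h2'
        exact ((hhi e he).no_edge_between hinj hG (hfi e he) (hfirst e he) (hhi e' he').adj_high
          k' h1'.le ((hfi e he).above.trans_lt h2') hlt).elim
  -- With `n` vertices, there are at most `n - 1` steepest edges and `2 (n - 2) - |U| - |D|`
  -- charges, which adds up to `3 n - 5 - |U| - |D|`.
  have hcard := Finset.card_le_card_of_injOn φ hmaps hφ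
  rw [Finset.card_sigma] at hcard
  have hrl : r ∈ V.erase l := Finset.mem_erase.2 ⟨hlr.symm, hr⟩
  have hsubU : U ⊆ (V.erase l).erase r := fun z hz => Finset.mem_erase.2
    ⟨fun h => hrU (h ▸ hz), Finset.mem_erase.2 ⟨fun h => hlU (h ▸ hz), hUV hz⟩⟩
  have hsubD : D ⊆ (V.erase l).erase r := fun z hz => Finset.mem_erase.2
    ⟨fun h => hrD (h ▸ hz), Finset.mem_erase.2 ⟨fun h => hlD (h ▸ hz), hDV hz⟩⟩
  have hcV : ((V.erase l).erase r).card = V.card - 1 - 1 := by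
    rw [Finset.card_erase_of_mem hrl, Finset.card_erase_of_mem hl]
  have hV2 : 2 ≤ V.card := by
    have := Finset.card_le_card (Finset.insert_subset hl (Finset.singleton_subset_iff.2 hr))
    rwa [Finset.card_pair hlr] at this
  have htgt : tgt.card ≤ (((V.erase l).erase r) \ U).card + (((V.erase l).erase r) \ D).card := by
    refine (Finset.card_union_le _ _).trans ?_
    simp
  have c1 := Finset.card_sdiff_add_card_eq_card hsubU
  have c2 := Finset.card_sdiff_add_card_eq_card hsubD
  simp only [hN]
  omega


/-! ### Transposition of the plane and of frame cells -/

namespace CellVertex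

instance (d : Dir) (a b : CellVertex) : Decidable (Toward d a b) := by
  cases d <;> unfold Toward <;> infer_instance

/-- The reflection of a frame cell in its diagonal through `v8` and `v0`. -/
def swap : CellVertex → CellVertex
  | .v0 => .v0
  | .v1 => .b1
  | .v2 => .b2
  | .v3 => .b3
  | .v4 => .b4
  | .v5 => .b5
  | .v6 => .b6
  | .v7 => .b7
  | .v8 => .v8
  | .b1 => .v1
  | .b2 => .v2
  | .b3 => .v3
  | .b4 => .v4
  | .b5 => .v5
  | .b6 => .v6
  | .b7 => .v7
  | .p => .q
  | .q => .p

@[simp] theorem swap_swap (a : CellVertex) : a.swap.swap = a := by cases a <;> rfl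

theorem swap_injective : Function.Injective swap := fun a b h => by
  rw [← swap_swap a, h, swap_swap]

theorem offset_swap (a : CellVertex) : a.swap.offset = a.offset.swap := by cases a <;> rfl

theorem toward_north_swap : ∀ a b : CellVertex, Toward .north a.swap b.swap ↔ Toward .east a b := by
  decide

theorem toward_east_swap (a b : CellVertex) : Toward .east a.swap b.swap ↔ Toward .north a b := by
  rw [← toward_north_swap, swap_swap, swap_swap]

theorem offset_fst_le (a : CellVertex) : a.offset.1 ≤ 4 := by cases a <;> decide

theorem offset_snd_le (a : CellVertex) : a.offset.2 ≤ 4 := by cases a <;> decide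

theorem offset_injective : Function.Injective offset := by decide

theorem exists_offset_eq : ∀ x ≤ 4, ∀ y ≤ 4, (x = 0 ∨ x = 4 ∨ y = 0 ∨ y = 4) →
    ∃ a : CellVertex, a ≠ .p ∧ a ≠ .q ∧ a.offset = (x, y) := by
  have key : ∀ x ∈ Finset.range 5, ∀ y ∈ Finset.range 5, (x = 0 ∨ x = 4 ∨ y = 0 ∨ y = 4) →
    ∃ a : CellVertex, a ≠ .p ∧ a ≠ .q ∧ a.offset = (x, y) := by decide
  exact fun x hx y hy => key x (by simp; omega) y (by simp; omega)

theorem offset_boundary : ∀ a : CellVertex, a ≠ .p → a ≠ .q →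
    (a.offset.1 = 0 ∨ a.offset.1 = 4 ∨ a.offset.2 = 0 ∨ a.offset.2 = 4) := by decide

end CellVertex

theorem orient_swap (a b c : Plane) : orient a.swap b.swap c.swap = -orient a b c := by
  simp only [orient, Prod.fst_swap, Prod.snd_swap]; ring

theorem orient_comm (a b c : Plane) : orient b a c = -orient a b c := by
  simp only [orient]; ring

/-! ### Layouts -/

/-- The geometric part of a frame graph: the positions of its vertices. -/
structure Layout (w h : ℕ) where
  pos : ℕ × ℕ → Plane
  cone : Plane
  verts : Finset Plane
  present : ℕ → ℕ → Finset CellVertex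
  w_pos : 0 < w
  h_pos : 0 < h
  mem_present : ∀ i j a, a ≠ .p → a ≠ .q → a ∈ present i j
  mem_verts : ∀ z, z ∈ verts ↔ z = cone ∨ ∃ i < w, ∃ j < h, ∃ a ∈ present i j, z = cellAt pos i j a
  fst_injOn : Set.InjOn Prod.fst (verts : Set Plane)
  snd_injOn : Set.InjOn Prod.snd (verts : Set Plane)
  orient_ne_zero : ∀ a ∈ verts, ∀ b ∈ verts, ∀ c ∈ verts, a ≠ b → b ≠ c → a ≠ c → orient a b c ≠ 0
  x_order : ∀ i < w, ∀ j < h, ∀ a ∈ present i j, ∀ b ∈ present i j, CellVertex.Toward .east a b →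
    (cellAt pos i j a).1 < (cellAt pos i j b).1
  y_order : ∀ i < w, ∀ j < h, ∀ a ∈ present i j, ∀ b ∈ present i j, CellVertex.Toward .north a b →
    (cellAt pos i j a).2 < (cellAt pos i j b).2
  vertical_hull : ∀ i ≤ w, ∀ m < 4 * h,
    (∀ z ∈ verts, z.1 ≤ (pos (4 * i, 0)).1 → 0 ≤ orient (pos (4 * i, m)) (pos (4 * i, m + 1)) z) ∨
    (∀ z ∈ verts, z.1 ≤ (pos (4 * i, 0)).1 → orient (pos (4 * i, m)) (pos (4 * i, m + 1)) z ≤ 0)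
  horizontal_hull : ∀ j ≤ h, ∀ m < 4 * w,
    (∀ z ∈ verts, z.2 ≤ (pos (0, 4 * j)).2 → 0 ≤ orient (pos (m, 4 * j)) (pos (m + 1, 4 * j)) z) ∨
    (∀ z ∈ verts, z.2 ≤ (pos (0, 4 * j)).2 → orient (pos (m, 4 * j)) (pos (m + 1, 4 * j)) z ≤ 0)
  cone_southWest : ∀ z ∈ verts, z ≠ cone → cone.1 < z.1 ∧ cone.2 < z.2

/-- The index of a cell vertex among the positions. -/
def cellIndex (i j : ℕ) (a : CellVertex) : ℕ × ℕ := (4 * i + a.offset.1, 4 * j + a.offset.2)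

theorem cellIndex_swap (i j : ℕ) (a : CellVertex) :
    cellIndex j i a.swap = (cellIndex i j a).swap := by
  simp [cellIndex, CellVertex.offset_swap]

theorem cellAt_transpose (pos : ℕ × ℕ → Plane) (i j : ℕ) (a : CellVertex) :
    cellAt (fun k => (pos k.swap).swap) i j a = (cellAt pos j i a.swap).swap := by
  simp [cellAt, CellVertex.offset_swap]

namespace Layout

variable {w h : ℕ}

/-- The reflection of a layout in the diagonal of the plane. -/
noncomputable def transpose (Λ : Layout w h) : Layout h w where
  pos k := (Λ.pos k.swap).swap
  cone := Λ.cone.swap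
  verts := Λ.verts.image Prod.swap
  present i j := (Λ.present j i).image CellVertex.swap
  w_pos := Λ.h_pos
  h_pos := Λ.w_pos
  mem_present i j a hp hq := by
    refine Finset.mem_image.2 ⟨a.swap, Λ.mem_present j i _ ?_ ?_, a.swap_swap⟩
    · rintro h; exact hq (by rw [← a.swap_swap, h]; rfl)
    · rintro h; exact hp (by rw [← a.swap_swap, h]; rfl)
  mem_verts z := by
    simp only [Finset.mem_image, Λ.mem_verts, cellAt_transpose]
    constructor
    · rintro ⟨z, rfl | ⟨i, hi, j, hj, a, ha, rfl⟩, rfl⟩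
      · exact Or.inl rfl
      · exact Or.inr ⟨j, hj, i, hi, a.swap, ⟨a, ha, rfl⟩, by rw [CellVertex.swap_swap]⟩
    · rintro (rfl | ⟨j, hj, i, hi, _, ⟨a, ha, rfl⟩, rfl⟩)
      · exact ⟨_, Or.inl rfl, rfl⟩
      · exact ⟨_, Or.inr ⟨i, hi, j, hj, a, ha, rfl⟩, by rw [CellVertex.swap_swap]⟩
  fst_injOn := by
    intro a ha b hb hab
    obtain ⟨a, ha', rfl⟩ := Finset.mem_image.1 ha
    obtain ⟨b, hb', rfl⟩ := Finset.mem_image.1 hb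
    rw [Λ.snd_injOn ha' hb' hab]
  snd_injOn := by
    intro a ha b hb hab
    obtain ⟨a, ha', rfl⟩ := Finset.mem_image.1 ha
    obtain ⟨b, hb', rfl⟩ := Finset.mem_image.1 hb
    rw [Λ.fst_injOn ha' hb' hab]
  orient_ne_zero a ha b hb c hc hab hbc hac := by
    obtain ⟨a, ha', rfl⟩ := Finset.mem_image.1 ha
    obtain ⟨b, hb', rfl⟩ := Finset.mem_image.1 hb
    obtain ⟨c, hc', rfl⟩ := Finset.mem_image.1 hc
    rw [orient_swap, neg_ne_zero]
    exact Λ.orient_ne_zero a ha' b hb' c hc' (fun h => hab (h ▸ rfl)) (fun h => hbc (h ▸ rfl))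
      (fun h => hac (h ▸ rfl))
  x_order i hi j hj a ha b hb hab := by
    obtain ⟨a, ha', rfl⟩ := Finset.mem_image.1 ha
    obtain ⟨b, hb', rfl⟩ := Finset.mem_image.1 hb
    simp only [cellAt_transpose, CellVertex.swap_swap, Prod.fst_swap]
    exact Λ.y_order j hj i hi a ha' b hb' ((CellVertex.toward_east_swap _ _).1 hab)
  y_order i hi j hj a ha b hb hab := by
    obtain ⟨a, ha', rfl⟩ := Finset.mem_image.1 ha
    obtain ⟨b, hb', rfl⟩ := Finset.mem_image.1 hb
    simp only [cellAt_transpose, CellVertex.swap_swap, Prod.snd_swap]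
    exact Λ.x_order j hj i hi a ha' b hb' ((CellVertex.toward_north_swap _ _).1 hab)
  vertical_hull i hi m hm := by
    simp only [Finset.forall_mem_image, orient_swap, Prod.swap_prod_mk, Left.nonneg_neg_iff,
      Left.neg_nonpos_iff, Prod.fst_swap]
    exact (Λ.horizontal_hull i hi m hm).symm
  horizontal_hull j hj m hm := by
    simp only [Finset.forall_mem_image, orient_swap, Prod.swap_prod_mk, Left.nonneg_neg_iff,
      Left.neg_nonpos_iff, Prod.snd_swap]
    exact (Λ.vertical_hull j hj m hm).symm
  cone_southWest z hz hne := by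
    obtain ⟨z, hz', rfl⟩ := Finset.mem_image.1 hz
    exact (Λ.cone_southWest z hz' (fun h => hne (h ▸ rfl))).symm

variable (Λ : Layout w h)

/-- The index of a vertex other than the cone vertex. -/
def Used (k : ℕ × ℕ) : Prop := ∃ i < w, ∃ j < h, ∃ a ∈ Λ.present i j, k = cellIndex i j a

/-- The vertices of a cell that are not on its west or south side. -/
def own (i j : ℕ) : Finset CellVertex :=
  (Λ.present i j).filter fun a => 0 < a.offset.1 ∧ 0 < a.offset.2

variable {Λ}

theorem mem_verts_iff {z : Plane} : z ∈ Λ.verts ↔ z = Λ.cone ∨ ∃ k, Λ.Used k ∧ z = Λ.pos k := by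
  rw [Λ.mem_verts]
  refine or_congr_right ⟨?_, ?_⟩
  · rintro ⟨i, hi, j, hj, a, ha, rfl⟩
    exact ⟨cellIndex i j a, ⟨i, hi, j, hj, a, ha, rfl⟩, rfl⟩
  · rintro ⟨_, ⟨i, hi, j, hj, a, ha, rfl⟩, rfl⟩
    exact ⟨i, hi, j, hj, a, ha, rfl⟩

theorem Used.mem {k : ℕ × ℕ} (hk : Λ.Used k) : Λ.pos k ∈ Λ.verts :=
  mem_verts_iff.2 (Or.inr ⟨k, hk, rfl⟩)

theorem cone_mem : Λ.cone ∈ Λ.verts := mem_verts_iff.2 (Or.inl rfl)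

theorem used_transpose {k : ℕ × ℕ} : Λ.transpose.Used k ↔ Λ.Used k.swap := by
  constructor
  · rintro ⟨i, hi, j, hj, a, ha, rfl⟩
    obtain ⟨a, ha', rfl⟩ := Finset.mem_image.1 ha
    exact ⟨j, hj, i, hi, a, ha', by rw [cellIndex_swap, Prod.swap_swap]⟩
  · rintro ⟨i, hi, j, hj, a, ha, h⟩
    exact ⟨j, hj, i, hi, a.swap, Finset.mem_image_of_mem _ ha, by
      rw [cellIndex_swap, ← h, Prod.swap_swap]⟩

/-- A used index that lies in the closed range of a cell is that of a vertex of the cell. -/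
theorem Used.exists_cell {k : ℕ × ℕ} (hk : Λ.Used k) {i j : ℕ} (h1 : 4 * i ≤ k.1)
    (h2 : k.1 ≤ 4 * i + 4) (h3 : 4 * j ≤ k.2) (h4 : k.2 ≤ 4 * j + 4) :
    ∃ a ∈ Λ.present i j, k = cellIndex i j a := by
  obtain ⟨i', hi', j', hj', a, ha, rfl⟩ := hk
  simp only [cellIndex] at h1 h2 h3 h4 ⊢
  have b1 := a.offset_fst_le
  have b2 := a.offset_snd_le
  -- The indices of `p` and `q` determine their cell. A boundary vertex may have been named in an
  -- adjacent cell and is renamed relative to the requested one.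
  by_cases hpq : a = .p ∨ a = .q
  · have : i' = i ∧ j' = j := by
      rcases hpq with rfl | rfl <;> simp only [CellVertex.offset] at h1 h2 h3 h4 <;> omega
    obtain ⟨rfl, rfl⟩ := this
    exact ⟨a, ha, rfl⟩
  · rw [not_or] at hpq
    have hb := CellVertex.offset_boundary a hpq.1 hpq.2
    obtain ⟨a', hp, hq, hoff⟩ := CellVertex.exists_offset_eq (4 * i' + a.offset.1 - 4 * i) (by omega)
      (4 * j' + a.offset.2 - 4 * j) (by omega) (by omega)
    refine ⟨a', Λ.mem_present i j a' hp hq, ?_⟩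
    rw [hoff]
    ext <;> dsimp only <;> omega

theorem used_of_cell {i j : ℕ} (hi : i < w) (hj : j < h) {a : CellVertex}
    (ha : a ∈ Λ.present i j) : Λ.Used (cellIndex i j a) := ⟨i, hi, j, hj, a, ha, rfl⟩

theorem used_of_boundary {m n : ℕ} (hm : m ≤ 4 * w) (hn : n ≤ 4 * h) (hd : 4 ∣ m ∨ 4 ∣ n) :
    Λ.Used (m, n) := by
  have hw := Λ.w_pos
  have hh := Λ.h_pos
  obtain ⟨i, hi, x, hx, rfl⟩ : ∃ i < w, ∃ x ≤ 4, m = 4 * i + x := by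
    rcases eq_or_lt_of_le hm with e | e
    -- There is no column `w`, so the last vertical path is read as the east side of column `w - 1`.
    · exact ⟨w - 1, by omega, 4, le_rfl, by omega⟩
    · exact ⟨m / 4, by omega, m % 4, by omega, by omega⟩
  obtain ⟨j, hj, y, hy, rfl⟩ : ∃ j < h, ∃ y ≤ 4, n = 4 * j + y := by
    rcases eq_or_lt_of_le hn with e | e
    · exact ⟨h - 1, by omega, 4, le_rfl, by omega⟩
    · exact ⟨n / 4, by omega, n % 4, by omega, by omega⟩
  obtain ⟨a, hp, hq, ha⟩ := CellVertex.exists_offset_eq x hx y hy (by omega)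
  exact ⟨i, hi, j, hj, a, Λ.mem_present i j a hp hq, by simp [cellIndex, ha]⟩

/-- This splits the vertices for counting: the first path, the rest of the bottom row, and for each
cell the vertices off its west and south sides. -/
theorem Used.cases {k : ℕ × ℕ} (hk : Λ.Used k) : (k.1 = 0 ∧ k.2 ≤ 4 * h) ∨
    (k.2 = 0 ∧ 0 < k.1 ∧ k.1 ≤ 4 * w) ∨ ∃ i < w, ∃ j < h, ∃ a ∈ Λ.own i j, k = cellIndex i j a := by
  have hk' := hk
  obtain ⟨i, hi, j, hj, a, ha, rfl⟩ := hk
  have b1 := a.offset_fst_le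
  have b2 := a.offset_snd_le
  simp only [cellIndex] at hk' ⊢
  by_cases h1 : 4 * i + a.offset.1 = 0
  · exact Or.inl ⟨h1, by omega⟩
  by_cases h2 : 4 * j + a.offset.2 = 0
  · exact Or.inr (Or.inl ⟨h2, by omega, by omega⟩)
  -- Subtracting one before dividing by four assigns a vertex on a shared side to the cell to its
  -- west or south.
  obtain ⟨a', ha', h'⟩ := hk'.exists_cell (i := (4 * i + a.offset.1 - 1) / 4)
    (j := (4 * j + a.offset.2 - 1) / 4) (by dsimp only; omega) (by dsimp only; omega)
    (by dsimp only; omega) (by dsimp only; omega)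
  rw [h']
  have e1 := congrArg Prod.fst h'
  have e2 := congrArg Prod.snd h'
  simp only [cellIndex] at e1 e2
  exact Or.inr (Or.inr ⟨_, by omega, _, by omega, a', Finset.mem_filter.2 ⟨ha', by omega, by omega⟩,
    rfl⟩)

theorem path_step {i n : ℕ} (hi : i ≤ w) (hn : n < 4 * h) :
    (Λ.pos (4 * i, n + 1)).1 < (Λ.pos (4 * i, n)).1 ∧
      (Λ.pos (4 * i, n)).2 < (Λ.pos (4 * i, n + 1)).2 := by
  have hw := Λ.w_pos
  obtain ⟨j, hj, k, hk, rfl⟩ : ∃ j < h, ∃ k < 4, n = 4 * j + k := ⟨n / 4, by omega, n % 4, by omega, by omega⟩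
  have key : ∀ i' < w, ∀ a b : CellVertex, a ≠ .p → a ≠ .q → b ≠ .p → b ≠ .q →
      CellVertex.Toward .east b a → CellVertex.Toward .north a b →
      4 * i' + a.offset.1 = 4 * i → 4 * i' + b.offset.1 = 4 * i → a.offset.2 = k →
      b.offset.2 = k + 1 → (Λ.pos (4 * i, 4 * j + k + 1)).1 < (Λ.pos (4 * i, 4 * j + k)).1 ∧
      (Λ.pos (4 * i, 4 * j + k)).2 < (Λ.pos (4 * i, 4 * j + k + 1)).2 := by
    intro i' hi' a b ap aq bp bq hE hN h1 h2 h3 h4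
    have ha := Λ.mem_present i' j a ap aq
    have hb := Λ.mem_present i' j b bp bq
    have e1 := Λ.x_order i' hi' j hj b hb a ha hE
    have e2 := Λ.y_order i' hi' j hj a ha b hb hN
    simp only [cellAt, h1, h2, h3, h4] at e1 e2
    exact ⟨e1, e2⟩
  -- The last path occurs only as an east side; any other path is read as the west side of its
  -- column.
  rcases eq_or_lt_of_le hi with rfl | hlt
  · have hs : ∀ x, x = 4 → 4 * (i - 1) + x = 4 * i := by omega
    interval_cases k
    · exact key (i - 1) (by omega) .v4 .v3 (by decide) (by decide) (by decide) (by decide)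
        (by decide) (by decide) (hs _ rfl) (hs _ rfl) rfl rfl
    · exact key (i - 1) (by omega) .v3 .v2 (by decide) (by decide) (by decide) (by decide)
        (by decide) (by decide) (hs _ rfl) (hs _ rfl) rfl rfl
    · exact key (i - 1) (by omega) .v2 .v1 (by decide) (by decide) (by decide) (by decide)
        (by decide) (by decide) (hs _ rfl) (hs _ rfl) rfl rfl
    · exact key (i - 1) (by omega) .v1 .v0 (by decide) (by decide) (by decide) (by decide)
        (by decide) (by decide) (hs _ rfl) (hs _ rfl) rfl rfl
  · interval_cases k
    · exact key i hlt .v8 .b7 (by decide) (by decide) (by decide) (by decide)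
        (by decide) (by decide) rfl rfl rfl rfl
    · exact key i hlt .b7 .b6 (by decide) (by decide) (by decide) (by decide)
        (by decide) (by decide) rfl rfl rfl rfl
    · exact key i hlt .b6 .b5 (by decide) (by decide) (by decide) (by decide)
        (by decide) (by decide) rfl rfl rfl rfl
    · exact key i hlt .b5 .b4 (by decide) (by decide) (by decide) (by decide)
        (by decide) (by decide) rfl rfl rfl rfl

theorem path_lt {i n n' : ℕ} (hi : i ≤ w) (hn : n < n') (hn' : n' ≤ 4 * h) :
    (Λ.pos (4 * i, n')).1 < (Λ.pos (4 * i, n)).1 ∧ (Λ.pos (4 * i, n)).2 < (Λ.pos (4 * i, n')).2 := by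
  induction n', hn using Nat.le_induction with
  | base => exact path_step hi hn'
  | succ m hm ih =>
    have h1 := ih (by omega)
    have h2 := path_step (Λ := Λ) hi (n := m) (by omega)
    exact ⟨h2.1.trans h1.1, h1.2.trans h2.2⟩

theorem path_le {i n n' : ℕ} (hi : i ≤ w) (hn : n ≤ n') (hn' : n' ≤ 4 * h) :
    (Λ.pos (4 * i, n')).1 ≤ (Λ.pos (4 * i, n)).1 ∧ (Λ.pos (4 * i, n)).2 ≤ (Λ.pos (4 * i, n')).2 := by
  rcases eq_or_lt_of_le hn with rfl | hlt
  · exact ⟨le_rfl, le_rfl⟩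
  · exact ⟨(path_lt hi hlt hn').1.le, (path_lt hi hlt hn').2.le⟩

/-- Rows are paths of the transposed layout, and the order relations swap along with the
coordinates. Later statements about rows are obtained in the same way. -/
theorem row_lt {j m m' : ℕ} (hj : j ≤ h) (hm : m < m') (hm' : m' ≤ 4 * w) :
    (Λ.pos (m, 4 * j)).1 < (Λ.pos (m', 4 * j)).1 ∧ (Λ.pos (m', 4 * j)).2 < (Λ.pos (m, 4 * j)).2 :=
  (path_lt (Λ := Λ.transpose) hj hm hm').symm

theorem row_le {j m m' : ℕ} (hj : j ≤ h) (hm : m ≤ m') (hm' : m' ≤ 4 * w) :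
    (Λ.pos (m, 4 * j)).1 ≤ (Λ.pos (m', 4 * j)).1 ∧ (Λ.pos (m', 4 * j)).2 ≤ (Λ.pos (m, 4 * j)).2 :=
  (path_le (Λ := Λ.transpose) hj hm hm').symm

theorem own_gt {i j : ℕ} (hi : i < w) (hj : j < h) {a : CellVertex} (ha : a ∈ Λ.own i j) :
    (Λ.pos (4 * i, 4 * j)).1 < (Λ.pos (cellIndex i j a)).1 ∧
      (Λ.pos (4 * i, 4 * j)).2 < (Λ.pos (cellIndex i j a)).2 := by
  obtain ⟨ha, h1, h2⟩ := Finset.mem_filter.1 ha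
  have h8 := Λ.mem_present i j .v8 (by decide) (by decide)
  have key : ∀ a : CellVertex, 0 < a.offset.1 → 0 < a.offset.2 →
    CellVertex.Toward .east .v8 a ∧ CellVertex.Toward .north .v8 a := by decide
  exact ⟨Λ.x_order i hi j hj _ h8 a ha (key a h1 h2).1,
    Λ.y_order i hi j hj _ h8 a ha (key a h1 h2).2⟩

/-- `cone_southWest` excludes the cone vertex, so a coincidence with a grid vertex has to be ruled
out: every vertex of a cell has `b4` to its west or `v4` to its south, which the cone vertex cannot
have. -/
theorem cone_lt {k : ℕ × ℕ} (hk : Λ.Used k) :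
    Λ.cone.1 < (Λ.pos k).1 ∧ Λ.cone.2 < (Λ.pos k).2 := by
  refine Λ.cone_southWest _ hk.mem fun hc => ?_
  obtain ⟨i, hi, j, hj, a, ha, rfl⟩ := hk
  have hne : ∀ b, Λ.pos (cellIndex i j b) ≠ Λ.cone → b ∈ Λ.present i j →
      (Λ.pos (cellIndex i j a)).1 < (Λ.pos (cellIndex i j b)).1 ∧
      (Λ.pos (cellIndex i j a)).2 < (Λ.pos (cellIndex i j b)).2 := fun b hb hb' => by
    rw [hc]; exact Λ.cone_southWest _ (used_of_cell hi hj hb').mem hb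
  have h4 := Λ.mem_present i j .b4 (by decide) (by decide)
  have h4' := Λ.mem_present i j .v4 (by decide) (by decide)
  have key : ∀ a : CellVertex, CellVertex.Toward .east .b4 a ∨ CellVertex.Toward .north .v4 a := by
    decide
  rcases key a with ht | ht
  · have hx := Λ.x_order i hi j hj _ h4 a ha ht
    exact lt_asymm hx (hne .b4 (fun e => by rw [← hc] at e; exact hx.ne (congrArg Prod.fst e)) h4).1
  · have hy := Λ.y_order i hi j hj _ h4' a ha ht
    exact lt_asymm hy (hne .v4 (fun e => by rw [← hc] at e; exact hy.ne (congrArg Prod.snd e)) h4').2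

end Layout

/-! ### Position of the vertices relative to the hull paths -/

theorem lineAt_lt_of_northEast {a b z : Plane} (h1 : a.1 < b.1) (h2 : b.2 < a.2)
    (hz : (a.1 < z.1 ∧ a.2 < z.2) ∨ (b.1 < z.1 ∧ b.2 < z.2)) : lineAt a b z.1 < z.2 := by
  rw [← orient_pos_iff h1]
  unfold orient
  rcases hz with ⟨h3, h4⟩ | ⟨h3, h4⟩ <;> nlinarith [mul_pos (sub_pos.2 h1) (sub_pos.2 h4),
    mul_pos (sub_pos.2 h2) (sub_pos.2 h3)]

theorem lt_lineAt_of_southWest {a b z : Plane} (h1 : a.1 < b.1) (h2 : b.2 < a.2)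
    (hz : (z.1 < a.1 ∧ z.2 < a.2) ∨ (z.1 < b.1 ∧ z.2 < b.2)) : z.2 < lineAt a b z.1 := by
  rw [← orient_neg_iff h1]
  unfold orient
  rcases hz with ⟨h3, h4⟩ | ⟨h3, h4⟩ <;> nlinarith [mul_pos (sub_pos.2 h1) (sub_pos.2 h4),
    mul_pos (sub_pos.2 h2) (sub_pos.2 h3)]

namespace Layout

variable {w h : ℕ} {Λ : Layout w h}

theorem used_path {i n : ℕ} (hi : i ≤ w) (hn : n ≤ 4 * h) : Λ.Used (4 * i, n) :=
  used_of_boundary (by omega) hn (Or.inl ⟨i, rfl⟩)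

theorem used_row {j m : ℕ} (hj : j ≤ h) (hm : m ≤ 4 * w) : Λ.Used (m, 4 * j) :=
  used_of_boundary hm (by omega) (Or.inr ⟨j, rfl⟩)

/-- The hull condition does not tell on which side the vertices lie. The cone vertex decides: it is
south-west of a descending edge, hence strictly below its line. -/
theorem vertical_orient {i n : ℕ} (hi : i ≤ w) (hn : n < 4 * h) {z : Plane} (hz : z ∈ Λ.verts)
    (hx : z.1 ≤ (Λ.pos (4 * i, 0)).1) :
    orient (Λ.pos (4 * i, n + 1)) (Λ.pos (4 * i, n)) z ≤ 0 := by
  rw [orient_comm]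
  rcases Λ.vertical_hull i hi n hn with H | H
  · linarith [H z hz hx]
  · exfalso
    have hs := path_step (Λ := Λ) hi hn
    have hc := H Λ.cone cone_mem (cone_lt (used_path hi (Nat.zero_le _))).1.le
    have := (orient_neg_iff hs.1 Λ.cone).2 (lt_lineAt_of_southWest hs.1 hs.2
      (Or.inl (cone_lt (used_path hi (by omega)))))
    rw [orient_comm] at this
    linarith

theorem vertical_le {i n : ℕ} (hi : i ≤ w) (hn : n < 4 * h) {z : Plane} (hz : z ∈ Λ.verts)
    (hx : z.1 ≤ (Λ.pos (4 * i, 0)).1) :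
    z.2 ≤ lineAt (Λ.pos (4 * i, n + 1)) (Λ.pos (4 * i, n)) z.1 :=
  (orient_nonpos_iff (path_step hi hn).1 z).1 (vertical_orient hi hn hz hx)

theorem horizontal_orient {j m : ℕ} (hj : j ≤ h) (hm : m < 4 * w) {z : Plane} (hz : z ∈ Λ.verts)
    (hy : z.2 ≤ (Λ.pos (0, 4 * j)).2) :
    orient (Λ.pos (m, 4 * j)) (Λ.pos (m + 1, 4 * j)) z ≤ 0 := by
  have := vertical_orient (Λ := Λ.transpose) hj hm (z := z.swap)
    (Finset.mem_image_of_mem _ hz) hy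
  change orient (Λ.pos (m + 1, 4 * j)).swap (Λ.pos (m, 4 * j)).swap z.swap ≤ 0 at this
  rwa [orient_swap, orient_comm, neg_neg] at this

theorem horizontal_le {j m : ℕ} (hj : j ≤ h) (hm : m < 4 * w) {z : Plane} (hz : z ∈ Λ.verts)
    (hy : z.2 ≤ (Λ.pos (0, 4 * j)).2) :
    z.2 ≤ lineAt (Λ.pos (m, 4 * j)) (Λ.pos (m + 1, 4 * j)) z.1 :=
  (orient_nonpos_iff (row_lt hj (Nat.lt_succ_self m) hm).1 z).1 (horizontal_orient hj hm hz hy)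

/-- A grid corner weakly east of a vertical path is east of its end or north-east of one of its
vertices. -/
theorem corner_northEast {i i' j' : ℕ} (hi : i ≤ i') (hi' : i' ≤ w) (hj' : j' ≤ h) :
    (Λ.pos (4 * i, 0)).1 ≤ (Λ.pos (4 * i', 4 * j')).1 ∨
      ∃ n ≤ 4 * h, (Λ.pos (4 * i, n)).1 ≤ (Λ.pos (4 * i', 4 * j')).1 ∧
        (Λ.pos (4 * i, n)).2 ≤ (Λ.pos (4 * i', 4 * j')).2 := by
  induction i', hi using Nat.le_induction generalizing j' with
  | base => exact Or.inr ⟨4 * j', by omega, le_rfl, le_rfl⟩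
  | succ m hm ih =>
    rcases Nat.eq_zero_or_pos j' with rfl | hj
    · exact Or.inl (row_le (Λ := Λ) (Nat.zero_le _) (by omega) (by omega)).1
    · have h0 := own_gt (Λ := Λ) (i := m) (j := j' - 1) (a := .v0) (by omega) (by omega)
        (Finset.mem_filter.2 ⟨Λ.mem_present _ _ _ (by decide) (by decide), by decide⟩)
      have e : cellIndex m (j' - 1) .v0 = (4 * (m + 1), 4 * j') := by
        ext <;> simp [cellIndex, CellVertex.offset] <;> omega
      rw [e] at h0
      rcases ih (by omega) (j' := j' - 1) (by omega) with h1 | ⟨n, hn, h1, h2⟩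
      · exact Or.inl (h1.trans h0.1.le)
      · exact Or.inr ⟨n, hn, h1.trans h0.1.le, h2.trans h0.2.le⟩

/-- A vertex with a larger column index is east of the end of the path or north-east of one of its
vertices. In the latter case it lies above the line of an edge of the path, which the hull condition
forbids for vertices not east of the end. Conversely, `v4` is the eastmost vertex of a cell, and the
x-coordinate grows down the paths and along the bottom row. -/
theorem Used.fst_le_iff {k : ℕ × ℕ} (hk : Λ.Used k) {i : ℕ} (hi : i ≤ w) :
    (Λ.pos k).1 ≤ (Λ.pos (4 * i, 0)).1 ↔ k.1 ≤ 4 * i := by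
  constructor
  · intro hle
    by_contra! hlt
    rcases hk.cases with ⟨h0, -⟩ | ⟨h0, -, hw⟩ | ⟨i', hi', j', hj', a, ha, rfl⟩
    · omega
    · have := (row_lt (Λ := Λ) (Nat.zero_le _) hlt hw).1
      rw [show k = (k.1, 4 * 0) from Prod.ext rfl h0] at hle
      exact absurd hle (not_le.2 this)
    · have b1 := a.offset_fst_le
      simp only [cellIndex] at hlt
      have hg := own_gt hi' hj' ha
      rcases corner_northEast (Λ := Λ) (i := i) (i' := i') (j' := j') (by omega) hi'.le hj'.le with
        h1 | ⟨n, hn, h1, h2⟩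
      · linarith [hg.1]
      · have hh := Λ.h_pos
        have hne := And.intro (h1.trans_lt hg.1) (h2.trans_lt hg.2)
        rcases eq_or_lt_of_le hn with rfl | hn
        · have e : 4 * h - 1 + 1 = 4 * h := by omega
          have hs := path_step (Λ := Λ) hi (n := 4 * h - 1) (by omega)
          have hv := vertical_le (Λ := Λ) hi (n := 4 * h - 1) (by omega) hk.mem hle
          rw [e] at hs hv
          exact absurd hv (not_le.2 (lineAt_lt_of_northEast hs.1 hs.2 (Or.inl hne)))
        · have hs := path_step (Λ := Λ) hi hn
          exact absurd (vertical_le hi hn hk.mem hle)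
            (not_le.2 (lineAt_lt_of_northEast hs.1 hs.2 (Or.inr hne)))
  · intro hle
    have hk' := hk
    obtain ⟨i', hi', j', hj', a, ha, rfl⟩ := hk'
    have b1 := a.offset_fst_le
    have b2 := a.offset_snd_le
    simp only [cellIndex] at hle
    rcases Nat.lt_or_ge i' i with hlt | hge
    · have key : ∀ a : CellVertex, a = .v4 ∨ CellVertex.Toward .east a .v4 := by decide
      have h4 := Λ.mem_present i' j' .v4 (by decide) (by decide)
      have h1 : (Λ.pos (cellIndex i' j' a)).1 ≤ (Λ.pos (4 * (i' + 1), 4 * j')).1 := by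
        rcases key a with rfl | ht
        · exact le_rfl
        · exact (Λ.x_order i' hi' j' hj' a ha _ h4 ht).le
      exact h1.trans ((path_le (Λ := Λ) (i := i' + 1) (by omega) (Nat.zero_le (4 * j')) (by omega)).1.trans
        (row_le (Λ := Λ) (Nat.zero_le _) (by omega) (by omega)).1)
    · obtain rfl : i' = i := by omega
      have : cellIndex i' j' a = (4 * i', 4 * j' + a.offset.2) := by
        simp only [cellIndex]; ext <;> dsimp only; omega
      rw [this]
      exact (path_le hi (Nat.zero_le _) (by omega)).1

theorem Used.snd_le_iff {k : ℕ × ℕ} (hk : Λ.Used k) {j : ℕ} (hj : j ≤ h) :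
    (Λ.pos k).2 ≤ (Λ.pos (0, 4 * j)).2 ↔ k.2 ≤ 4 * j :=
  Used.fst_le_iff (Λ := Λ.transpose) (k := k.swap) (used_transpose.2 hk) hj

theorem pos_cell_injective {i j : ℕ} (hi : i < w) (hj : j < h) {a b : CellVertex}
    (ha : a ∈ Λ.present i j) (hb : b ∈ Λ.present i j)
    (hab : Λ.pos (cellIndex i j a) = Λ.pos (cellIndex i j b)) : a = b := by
  have key : ∀ a b : CellVertex, a = b ∨ CellVertex.Toward .east a b ∨ CellVertex.Toward .east b a := by
    decide
  rcases key a b with h | h | h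
  · exact h
  · exact absurd (congrArg Prod.fst hab) (Λ.x_order i hi j hj a ha b hb h).ne
  · exact absurd (congrArg Prod.fst hab) (Λ.x_order i hi j hj b hb a ha h).ne'

/-- By `Used.fst_le_iff` and `Used.snd_le_iff`, the position decides which path indices bound the
vertex index in each coordinate. So both indices belong to a common cell, where the x-order
separates vertices. -/
theorem pos_injOn {k k' : ℕ × ℕ} (hk : Λ.Used k) (hk' : Λ.Used k') (he : Λ.pos k = Λ.pos k') :
    k = k' := by
  have hc : ∀ i ≤ w, k.1 ≤ 4 * i ↔ k'.1 ≤ 4 * i := fun i hi => by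
    rw [← hk.fst_le_iff hi, ← hk'.fst_le_iff hi, he]
  have hr : ∀ j ≤ h, k.2 ≤ 4 * j ↔ k'.2 ≤ 4 * j := fun j hj => by
    rw [← hk.snd_le_iff hj, ← hk'.snd_le_iff hj, he]
  have hbd : k.1 ≤ 4 * w ∧ k.2 ≤ 4 * h := by
    obtain ⟨i, hi, j, hj, a, ha, rfl⟩ := hk
    have b1 := a.offset_fst_le
    have b2 := a.offset_snd_le
    simp only [cellIndex]; omega
  have hw := Λ.w_pos
  have hh := Λ.h_pos
  have c0 := hc 0 (by omega)
  have r0 := hr 0 (by omega)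
  have hcell : ∀ i j, i < w → j < h → 4 * i ≤ k.1 → k.1 ≤ 4 * i + 4 → 4 * j ≤ k.2 →
      k.2 ≤ 4 * j + 4 → 4 * i ≤ k'.1 → k'.1 ≤ 4 * i + 4 → 4 * j ≤ k'.2 →
      k'.2 ≤ 4 * j + 4 → k = k' := by
    intro i j hi hj h1 h2 h3 h4 h5 h6 h7 h8
    obtain ⟨a, ha, rfl⟩ := hk.exists_cell h1 h2 h3 h4
    obtain ⟨b, hb, rfl⟩ := hk'.exists_cell h5 h6 h7 h8
    rw [pos_cell_injective hi hj ha hb he]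
  have c1 := hc ((k.1 - 1) / 4) (by omega)
  have c2 := hc ((k.1 - 1) / 4 + 1)
  have r1 := hr ((k.2 - 1) / 4) (by omega)
  have r2 := hr ((k.2 - 1) / 4 + 1)
  exact hcell ((k.1 - 1) / 4) ((k.2 - 1) / 4) (by omega) (by omega) (by omega) (by omega) (by omega)
    (by omega) (by omega) (by omega) (by omega) (by omega)

theorem Used.le {k : ℕ × ℕ} (hk : Λ.Used k) : k.1 ≤ 4 * w ∧ k.2 ≤ 4 * h := by
  obtain ⟨i, hi, j, hj, a, ha, rfl⟩ := hk
  have b1 := a.offset_fst_le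
  have b2 := a.offset_snd_le
  simp only [cellIndex]; omega

theorem pos_ne_cone {k : ℕ × ℕ} (hk : Λ.Used k) : Λ.pos k ≠ Λ.cone := fun e =>
  (cone_lt hk).1.ne' (congrArg Prod.fst e)

theorem vertical_lt {i n : ℕ} (hi : i ≤ w) (hn : n < 4 * h) {z : Plane} (hz : z ∈ Λ.verts)
    (hx : z.1 ≤ (Λ.pos (4 * i, 0)).1) (h1 : z ≠ Λ.pos (4 * i, n)) (h2 : z ≠ Λ.pos (4 * i, n + 1)) :
    z.2 < lineAt (Λ.pos (4 * i, n + 1)) (Λ.pos (4 * i, n)) z.1 := by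
  have hs := path_step (Λ := Λ) hi hn
  refine (orient_neg_iff hs.1 z).1 (lt_of_le_of_ne (vertical_orient hi hn hz hx) ?_)
  exact Λ.orient_ne_zero _ (used_path hi (by omega)).mem _ (used_path hi hn.le).mem z hz
    (fun e => hs.1.ne (congrArg Prod.fst e)) h1.symm h2.symm

end Layout

/-! ### Graphs with the maximal number of edges contain the upper hull -/

/-- The subgraph of the edges between vertices of `W`. -/
def restrictTo (G : SimpleGraph Plane) (W : Finset Plane) : SimpleGraph Plane where
  Adj x y := G.Adj x y ∧ x ∈ W ∧ y ∈ W
  symm := ⟨fun _ _ h => ⟨h.1.symm, h.2.2, h.2.1⟩⟩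
  loopless := ⟨fun _ h => h.1.ne rfl⟩

theorem IsPSLGraph.restrictTo {V W : Finset Plane} {G : SimpleGraph Plane} (hG : IsPSLGraph V G)
    (hW : W ⊆ V) : IsPSLGraph W (restrictTo G W) where
  mem _ _ h := h.2
  crossingFree a b c d h1 h2 := hG.crossingFree a b c d h1.1 h2.1
  not_mem_edge a b h v hv := hG.not_mem_edge a b h.1 v (hW hv)

theorem lineAt_combo (a b : Plane) {s t : ℝ} (hst : s + t = 1) (x y : ℝ) :
    lineAt a b (s * x + t * y) = s * lineAt a b x + t * lineAt a b y := by
  obtain rfl : s = 1 - t := by linarith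
  unfold lineAt; ring

theorem sum_cardinalDegree_east_eq_west {V : Finset Plane} {G : SimpleGraph Plane}
    (hG : ∀ a b, G.Adj a b → a ∈ V ∧ b ∈ V) :
    ∑ v ∈ V, cardinalDegree G .east v = ∑ v ∈ V, cardinalDegree G .west v := by
  classical
  simp only [cardinalDegree_eq_card_filter hG]
  have := Finset.sum_card_bipartiteAbove_eq_sum_card_bipartiteBelow (s := V) (t := V)
    (fun v u : Plane => G.Adj v u ∧ v.1 < u.1)
  simp only [Finset.bipartiteAbove, Finset.bipartiteBelow] at this
  simp only [Toward, G.adj_comm] at this ⊢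
  exact this

theorem cardinalDegree_mono {V : Finset Plane} {G H : SimpleGraph Plane}
    (hH : ∀ a b, H.Adj a b → a ∈ V ∧ b ∈ V) (hle : G ≤ H) (d : Dir) (v : Plane) :
    cardinalDegree G d v ≤ cardinalDegree H d v := by
  refine Set.ncard_le_ncard (fun u hu => ⟨hle hu.1, hu.2⟩) (V.finite_toSet.subset ?_)
  exact fun u hu => (hH _ _ hu.1).2

/-- All vertices are on or below the line, and only the two ends are on it. So an interior point of
an edge reaches the line only if both ends of this edge do. -/
theorem IsPSLGraph.sup_edge {W : Finset Plane} {G : SimpleGraph Plane} (hG : IsPSLGraph W G)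
    {a b : Plane} (ha : a ∈ W) (hb : b ∈ W) (hab : a.1 < b.1)
    (hbelow : ∀ z ∈ W, z ≠ a → z ≠ b → z.2 < lineAt a b z.1) :
    IsPSLGraph W (G ⊔ SimpleGraph.edge a b) := by
  have hle : ∀ z ∈ W, z.2 ≤ lineAt a b z.1 := by
    intro z hz
    by_cases h1 : z = a
    · rw [h1, lineAt_left]
    by_cases h2 : z = b
    · rw [h2, lineAt_right hab]
    exact (hbelow z hz h1 h2).le
  have hcross : ∀ c d, G.Adj c d → s(c, d) ≠ s(a, b) →
      Disjoint (openSegment ℝ c d) (openSegment ℝ a b) := by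
    intro c d hcd hne
    refine Set.disjoint_left.2 fun z hz hz' => ?_
    have hc := (hG.mem c d hcd).1
    have hd := (hG.mem c d hcd).2
    have e := ((mem_openSegment_iff_lineAt hab z).1 hz').2.2
    obtain ⟨s, t, hs, ht, hst, rfl⟩ := hz
    simp only [Prod.fst_add, Prod.snd_add, Prod.smul_fst, Prod.smul_snd, smul_eq_mul] at e
    rw [lineAt_combo a b hst] at e
    have h1 := hle c hc
    have h2 := hle d hd
    have hcd' : ¬ (c.2 < lineAt a b c.1 ∨ d.2 < lineAt a b d.1) := by
      rintro (h | h)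
      · nlinarith [mul_lt_mul_of_pos_left h hs, mul_le_mul_of_nonneg_left h2 ht.le]
      · nlinarith [mul_lt_mul_of_pos_left h ht, mul_le_mul_of_nonneg_left h1 hs.le]
    have hc' : c = a ∨ c = b := by
      by_contra h
      rw [not_or] at h
      exact hcd' (Or.inl (hbelow c hc h.1 h.2))
    have hd' : d = a ∨ d = b := by
      by_contra h
      rw [not_or] at h
      exact hcd' (Or.inr (hbelow d hd h.1 h.2))
    have := hcd.ne
    rcases hc' with rfl | rfl <;> rcases hd' with rfl | rfl
    · exact this rfl
    · exact hne rfl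
    · exact hne Sym2.eq_swap
    · exact this rfl
  have hedge : ∀ c d, (SimpleGraph.edge a b).Adj c d → s(c, d) = s(a, b) := by
    intro c d h
    rcases ((SimpleGraph.edge_adj _ _ _ _).1 h).1 with ⟨rfl, rfl⟩ | ⟨rfl, rfl⟩
    · rfl
    · exact Sym2.eq_swap
  have hseg : ∀ c d, s(c, d) = s(a, b) → openSegment ℝ c d = openSegment ℝ a b := by
    intro c d h
    rcases Sym2.eq_iff.1 h with ⟨rfl, rfl⟩ | ⟨rfl, rfl⟩
    · rfl
    · exact openSegment_symm ℝ _ _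
  refine ⟨?_, ?_, ?_⟩
  · rintro c d (h | h)
    · exact hG.mem c d h
    · rcases Sym2.eq_iff.1 (hedge c d h) with ⟨rfl, rfl⟩ | ⟨rfl, rfl⟩
      · exact ⟨ha, hb⟩
      · exact ⟨hb, ha⟩
  · rintro c d c' d' (h | h) (h' | h') hne
    · exact hG.crossingFree c d c' d' h h' hne
    · rw [hseg c' d' (hedge _ _ h')]
      exact hcross c d h (hedge _ _ h' ▸ hne)
    · rw [hseg c d (hedge _ _ h)]
      exact (hcross c' d' h' (hedge _ _ h ▸ hne.symm)).symm
    · exact absurd ((hedge _ _ h).trans (hedge _ _ h').symm) hne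
  · rintro c d (h | h) v hv hmem
    · exact hG.not_mem_edge c d h v hv hmem
    · rw [hseg c d (hedge _ _ h), mem_openSegment_iff_lineAt hab] at hmem
      exact (hbelow v hv (fun e => hmem.1.ne (e ▸ rfl)) (fun e => hmem.2.1.ne (e ▸ rfl))).ne
        hmem.2.2

/-- A plane straight-line graph with as many edges as possible contains every edge of the upper
hull of its vertices. -/
theorem IsPSLGraph.adj_of_card_le {W : Finset Plane} {G : SimpleGraph Plane}
    (hinj : Set.InjOn Prod.fst (W : Set Plane)) (hG : IsPSLGraph W G) {l r : Plane} (hl : l ∈ W)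
    (hr : r ∈ W) (hlr : l ≠ r) (hlmin : ∀ z ∈ W, l.1 ≤ z.1) (hrmax : ∀ z ∈ W, z.1 ≤ r.1)
    (U : Finset Plane) (hUW : U ⊆ W) (hlU : l ∉ U) (hrU : r ∉ U)
    (hU : ∀ u ∈ U, ∃ c d : Plane, lineAt c d u.1 = u.2 ∧ ∀ z ∈ W, z.2 ≤ lineAt c d z.1)
    (htight : 3 * W.card ≤ ∑ v ∈ W, cardinalDegree G .east v + U.card + 5)
    {a b : Plane} (ha : a ∈ W) (hb : b ∈ W) (hab : a.1 < b.1)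
    (hbelow : ∀ z ∈ W, z ≠ a → z ≠ b → z.2 < lineAt a b z.1) : G.Adj a b := by
  -- Adding the missing hull edge keeps the graph plane. Edges cannot pass above a vertex that has a
  -- supporting line above all of `W`, so the bound with the same `U` still applies, and it is
  -- exceeded by one edge.
  by_contra hnot
  have hG' := hG.sup_edge ha hb hab hbelow
  have hbound := hG'.edge_bound hinj hl hr hlr hlmin hrmax U ∅ hUW (Finset.empty_subset _) hlU hrU
    (Finset.notMem_empty _) (Finset.notMem_empty _) (by
      intro u hu p q hpq h1 h2
      obtain ⟨c, d, e, hcd⟩ := hU u hu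
      have hp := hcd p (hG'.mem p q hpq).1
      have hq := hcd q (hG'.mem p q hpq).2
      rw [← e, ← orient_nonneg_iff (z := (u.1, lineAt c d u.1)) (h1.trans h2)]
      have hpq : 0 < q.1 - p.1 := by linarith
      simp only [orient, lineAt] at hp hq ⊢
      nlinarith [mul_nonneg (sub_nonneg.2 hp) (sub_pos.2 h2).le,
        mul_nonneg (sub_nonneg.2 hq) (sub_pos.2 h1).le]) (by simp)
  have hlt : ∑ v ∈ W, cardinalDegree G .east v <
      ∑ v ∈ W, cardinalDegree (G ⊔ SimpleGraph.edge a b) .east v := by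
    refine Finset.sum_lt_sum (fun v _ => cardinalDegree_mono hG'.mem le_sup_left _ _) ⟨a, ha, ?_⟩
    refine Set.ncard_lt_ncard ?_ (W.finite_toSet.subset fun u hu => (hG'.mem _ _ hu.1).2)
    refine ⟨fun u hu => ⟨Or.inl hu.1, hu.2⟩, fun hsub => hnot (hsub (a := b) ⟨Or.inr ?_, hab⟩).1⟩
    exact (SimpleGraph.edge_adj _ _ _ _).2 ⟨Or.inl ⟨rfl, rfl⟩, fun e => hab.ne (e ▸ rfl)⟩
  simp only [Finset.card_empty] at hbound
  omega

namespace Layout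

variable {w h : ℕ} (Λ : Layout w h)

/-- The vertices that are not east of the southmost vertex of a vertical path. -/
noncomputable def westPart (i : ℕ) : Finset Plane :=
  Λ.verts.filter fun z => z.1 ≤ (Λ.pos (4 * i, 0)).1

variable {Λ}

/-- The summand `4 h + 4 i + 2` consists of the cone vertex, the `4 h + 1` vertices of the first
path and `4 i` further vertices of the bottom row. Only the upper estimate is needed, since the edge
bound grows with the number of vertices. -/
theorem card_westPart_le {i : ℕ} (hi : i ≤ w) : (Λ.westPart i).card ≤
    4 * h + 4 * i + 2 + ∑ i' ∈ Finset.range i, ∑ j ∈ Finset.range h, (Λ.own i' j).card := by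
  classical
  have hsub : Λ.westPart i ⊆ ({Λ.cone} ∪ (Finset.range (4 * h + 1)).image fun n => Λ.pos (0, n)) ∪
      ((Finset.range (4 * i)).image fun m => Λ.pos (m + 1, 0)) ∪
      (Finset.range i).biUnion fun i' => (Finset.range h).biUnion fun j =>
        (Λ.own i' j).image fun a => Λ.pos (cellIndex i' j a) := by
    intro z hz
    obtain ⟨hz, hx⟩ := Finset.mem_filter.1 hz
    simp only [Finset.mem_union, Finset.mem_singleton, Finset.mem_image, Finset.mem_range,
      Finset.mem_biUnion]
    rcases mem_verts_iff.1 hz with rfl | ⟨k, hk, rfl⟩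
    · simp
    · have hk1 := (hk.fst_le_iff hi).1 hx
      rcases hk.cases with ⟨h0, h1⟩ | ⟨h0, h1, h2⟩ | ⟨i', hi', j', hj', a, ha, rfl⟩
      · exact Or.inl (Or.inl (Or.inr ⟨k.2, by omega, by rw [← h0]⟩))
      · exact Or.inl (Or.inr ⟨k.1 - 1, by omega, by
          rw [show k.1 - 1 + 1 = k.1 by omega]; congr 1; exact Prod.ext rfl h0.symm⟩)
      · have := (Finset.mem_filter.1 ha).2.1
        simp only [cellIndex] at hk1
        exact Or.inr ⟨i', by omega, j', hj', a, ha, rfl⟩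
  refine (Finset.card_le_card hsub).trans ((Finset.card_union_le _ _).trans ?_)
  have h1 : (({Λ.cone} ∪ (Finset.range (4 * h + 1)).image fun n => Λ.pos (0, n)) ∪
      ((Finset.range (4 * i)).image fun m => Λ.pos (m + 1, 0))).card ≤ 4 * h + 4 * i + 2 := by
    refine (Finset.card_union_le _ _).trans ?_
    have e1 := Finset.card_union_le {Λ.cone} ((Finset.range (4 * h + 1)).image fun n => Λ.pos (0, n))
    have e2 := Finset.card_image_le (s := Finset.range (4 * h + 1)) (f := fun n => Λ.pos (0, n))
    have e3 := Finset.card_image_le (s := Finset.range (4 * i)) (f := fun m => Λ.pos (m + 1, 0))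
    simp only [Finset.card_singleton, Finset.card_range] at e1 e2 e3
    omega
  refine add_le_add h1 (Finset.card_biUnion_le.trans (Finset.sum_le_sum fun i' _ =>
    Finset.card_biUnion_le.trans (Finset.sum_le_sum fun j _ => Finset.card_image_le)))

/-- A plane straight-line graph whose total west degree in a west part is that of a triangulation
contains the vertical path. -/
theorem adj_path {T : SimpleGraph Plane} (hT : IsPSLGraph Λ.verts T) {i : ℕ} (hi : i ≤ w)
    (hcount : 8 * h + 8 * i + 1 +
      3 * ∑ i' ∈ Finset.range i, ∑ j ∈ Finset.range h, (Λ.own i' j).card ≤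
      ∑ v ∈ Λ.westPart i, cardinalDegree T .west v) {n : ℕ} (hn : n < 4 * h) :
    T.Adj (Λ.pos (4 * i, n + 1)) (Λ.pos (4 * i, n)) := by
  classical
  have hh := Λ.h_pos
  have hW : Λ.westPart i ⊆ Λ.verts := Finset.filter_subset _ _
  have hmem : ∀ k, Λ.Used k → k.1 ≤ 4 * i → Λ.pos k ∈ Λ.westPart i := fun k hk hle =>
    Finset.mem_filter.2 ⟨hk.mem, (hk.fst_le_iff hi).2 hle⟩
  have hup : ∀ m ≤ 4 * h, Λ.Used (4 * i, m) := fun m hm => used_path hi hm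
  have hrow : ∀ m ≤ 4 * w, Λ.Used (m, 4 * h) := fun m hm => used_row le_rfl hm
  have hG := hT.restrictTo hW
  -- These are the upper hull vertices between the cone vertex and the path end: the top row west of
  -- the path, and the path above its end. With `|U| = 4 h + 4 i` and at most `4 h + 4 i + 2 + N`
  -- vertices, `3 n - 5 - |U|` is at most `8 h + 8 i + 1 + 3 N`, which is the count in `hcount`.
  let U : Finset Plane := ((Finset.range (4 * h)).image fun m => Λ.pos (4 * i, m + 1)) ∪
    ((Finset.range (4 * i)).image fun m => Λ.pos (m, 4 * h))
  have hUcases : ∀ u ∈ U, ∃ k, Λ.Used k ∧ u = Λ.pos k ∧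
      ((∃ m < 4 * h, k = (4 * i, m + 1)) ∨ ∃ m < 4 * i, k = (m, 4 * h)) := by
    intro u hu
    rcases Finset.mem_union.1 hu with hu | hu
    · obtain ⟨m, hm, rfl⟩ := Finset.mem_image.1 hu
      rw [Finset.mem_range] at hm
      exact ⟨_, hup _ hm, rfl, Or.inl ⟨m, hm, rfl⟩⟩
    · obtain ⟨m, hm, rfl⟩ := Finset.mem_image.1 hu
      rw [Finset.mem_range] at hm
      exact ⟨_, hrow _ (by omega), rfl, Or.inr ⟨m, hm, rfl⟩⟩
  have hUcard : U.card = 4 * h + 4 * i := by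
    rw [Finset.card_union_of_disjoint, Finset.card_image_of_injOn, Finset.card_image_of_injOn,
      Finset.card_range, Finset.card_range]
    · intro m hm m' hm' e
      rw [Finset.mem_coe, Finset.mem_range] at hm hm'
      exact congrArg Prod.fst (pos_injOn (hrow m (by omega)) (hrow m' (by omega)) e)
    · intro m hm m' hm' e
      rw [Finset.mem_coe, Finset.mem_range] at hm hm'
      exact Nat.succ_injective (congrArg Prod.snd (pos_injOn (hup _ hm) (hup _ hm') e))
    · refine Finset.disjoint_left.2 fun z hz hz' => ?_
      obtain ⟨m, hm, rfl⟩ := Finset.mem_image.1 hz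
      obtain ⟨m', hm', e⟩ := Finset.mem_image.1 hz'
      rw [Finset.mem_range] at hm hm'
      have := congrArg Prod.fst (pos_injOn (hrow m' (by omega)) (hup _ hm) e)
      dsimp only at this
      omega
  have hs := path_step (Λ := Λ) hi hn
  have hadj : (restrictTo T (Λ.westPart i)).Adj (Λ.pos (4 * i, n + 1)) (Λ.pos (4 * i, n)) := by
    refine hG.adj_of_card_le (Λ.fst_injOn.mono (by exact_mod_cast hW)) (l := Λ.cone)
      (r := Λ.pos (4 * i, 0)) (Finset.mem_filter.2 ⟨cone_mem, (cone_lt (hup 0 (by omega))).1.le⟩)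
      (hmem _ (hup 0 (by omega)) le_rfl) (pos_ne_cone (hup 0 (by omega))).symm ?_
      (fun z hz => (Finset.mem_filter.1 hz).2) U ?_ ?_ ?_ ?_ ?_ (hmem _ (hup _ hn) le_rfl)
      (hmem _ (hup _ hn.le) le_rfl) hs.1 ?_
    · intro z hz
      by_cases hzc : z = Λ.cone
      · rw [hzc]
      · exact (Λ.cone_southWest z (hW hz) hzc).1.le
    · intro u hu
      obtain ⟨k, hk, rfl, ⟨m, hm, rfl⟩ | ⟨m, hm, rfl⟩⟩ := hUcases u hu
      · exact hmem _ hk le_rfl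
      · exact hmem _ hk hm.le
    · intro hu
      obtain ⟨k, hk, e, -⟩ := hUcases _ hu
      exact pos_ne_cone hk e.symm
    · intro hu
      obtain ⟨k, hk, e, hc⟩ := hUcases _ hu
      have := pos_injOn (hup 0 (by omega)) hk e
      subst this
      rcases hc with ⟨m, hm, e⟩ | ⟨m, hm, e⟩
      · exact absurd (congrArg Prod.snd e) (by simp)
      · exact absurd (congrArg Prod.fst e) (by dsimp only; omega)
    · intro u hu
      obtain ⟨k, hk, rfl, ⟨m, hm, rfl⟩ | ⟨m, hm, rfl⟩⟩ := hUcases u hu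
      · exact ⟨_, _, lineAt_left _ _, fun z hz =>
          vertical_le hi hm (hW hz) (Finset.mem_filter.1 hz).2⟩
      -- No vertex is north of the westmost vertex of the top row, so the hull condition for `j = h`
      -- concerns all vertices.
      · refine ⟨_, _, lineAt_left _ _, fun z hz =>
          horizontal_le (m := m) le_rfl (by omega) (hW hz) ?_⟩
        rcases mem_verts_iff.1 (hW hz) with rfl | ⟨k', hk', rfl⟩
        · exact (cone_lt (hrow 0 (by omega))).2.le
        · exact (hk'.snd_le_iff le_rfl).2 hk'.le.2
    -- Western neighbors of vertices of the west part stay in the west part. Hence the prescribed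
    -- west degrees already count the edges within it.
    · have hdeg : ∑ v ∈ Λ.westPart i, cardinalDegree (restrictTo T (Λ.westPart i)) .east v =
          ∑ v ∈ Λ.westPart i, cardinalDegree T .west v := by
        rw [sum_cardinalDegree_east_eq_west hG.mem]
        refine Finset.sum_congr rfl fun v hv => congrArg Set.ncard (Set.ext fun u => ?_)
        refine ⟨fun hu => ⟨hu.1.1, hu.2⟩, fun hu => ⟨⟨hu.1, hv, ?_⟩, hu.2⟩⟩
        exact Finset.mem_filter.2 ⟨(hT.mem _ _ hu.1).2,
          (le_of_lt hu.2).trans (Finset.mem_filter.1 hv).2⟩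
      have := card_westPart_le (Λ := Λ) hi
      rw [hUcard, hdeg]
      omega
    · intro z hz h1 h2
      exact vertical_lt hi hn (hW hz) (Finset.mem_filter.1 hz).2 h2 h1
  exact hadj.1

end Layout

/-! ### Reflecting graphs -/

/-- The reflection of a graph in the diagonal of the plane. -/
def swapGraph (G : SimpleGraph Plane) : SimpleGraph Plane := G.comap Prod.swap

theorem mem_segment_swap {a b z : Plane} :
    z.swap ∈ segment ℝ a.swap b.swap ↔ z ∈ segment ℝ a b := by
  have key : ∀ {a b z : Plane}, z ∈ segment ℝ a b → z.swap ∈ segment ℝ a.swap b.swap := by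
    rintro a b _ ⟨s, t, hs, ht, hst, rfl⟩
    exact ⟨s, t, hs, ht, hst, rfl⟩
  exact ⟨fun h => by simpa using key h, key⟩

theorem mem_openSegment_swap {a b z : Plane} :
    z.swap ∈ openSegment ℝ a.swap b.swap ↔ z ∈ openSegment ℝ a b := by
  have key : ∀ {a b z : Plane}, z ∈ openSegment ℝ a b → z.swap ∈ openSegment ℝ a.swap b.swap := by
    rintro a b _ ⟨s, t, hs, ht, hst, rfl⟩
    exact ⟨s, t, hs, ht, hst, rfl⟩
  exact ⟨fun h => by simpa using key h, key⟩

theorem IsPSLGraph.swap {V : Finset Plane} {G : SimpleGraph Plane} (hG : IsPSLGraph V G) :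
    IsPSLGraph (V.image Prod.swap) (swapGraph G) where
  mem a b h := ⟨Finset.mem_image.2 ⟨_, (hG.mem _ _ h).1, Prod.swap_swap a⟩,
    Finset.mem_image.2 ⟨_, (hG.mem _ _ h).2, Prod.swap_swap b⟩⟩
  crossingFree a b c d h1 h2 hne := by
    refine Set.disjoint_left.2 fun z hz hz' => ?_
    refine Set.disjoint_left.1 (hG.crossingFree _ _ _ _ h1 h2 ?_) (mem_openSegment_swap.2 hz)
      (mem_openSegment_swap.2 hz')
    intro e
    apply hne
    have := congrArg (Sym2.map Prod.swap) e
    simpa using this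
  not_mem_edge a b h v hv hmem := by
    obtain ⟨v, hv', rfl⟩ := Finset.mem_image.1 hv
    exact hG.not_mem_edge _ _ h v hv' (by simpa using mem_openSegment_swap.2 hmem)

/-! ### The cone edges, and edges across the frame -/

theorem lineAt_lt_of_apex {c p z : Plane} (h1 : c.1 < p.1) (h2 : c.2 < p.2) (h3 : z.1 ≤ p.1)
    (h4 : p.2 < z.2) : lineAt c p z.1 < z.2 := by
  rw [← orient_pos_iff h1]
  unfold orient
  nlinarith [mul_pos (sub_pos.2 h1) (sub_pos.2 h4), mul_nonneg (sub_pos.2 h2).le (sub_nonneg.2 h3)]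

theorem lineAt_le_lineAt {a b c d : Plane} {x : ℝ} (hcd : c.1 < d.1) (h1 : c.1 ≤ x) (h2 : x ≤ d.1)
    (hc : c.2 ≤ lineAt a b c.1) (hd : d.2 ≤ lineAt a b d.1) : lineAt c d x ≤ lineAt a b x := by
  rw [← orient_nonneg_iff (z := (x, lineAt a b x)) hcd]
  simp only [orient, lineAt] at hc hd ⊢
  nlinarith [mul_nonneg (sub_nonneg.2 hc) (sub_nonneg.2 h2),
    mul_nonneg (sub_nonneg.2 hd) (sub_nonneg.2 h1)]

theorem exists_lt_between {f : ℕ → ℝ} {x : ℝ} {N : ℕ} (hN : 0 < N) (h0 : f 0 ≤ x) (h1 : x ≤ f N) :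
    ∃ n < N, f n ≤ x ∧ x ≤ f (n + 1) := by
  induction N, hN using Nat.le_induction with
  | base => exact ⟨0, Nat.zero_lt_one, h0, h1⟩
  | succ m hm ih =>
    rcases le_total x (f m) with h | h
    · obtain ⟨n, hn, h⟩ := ih h
      exact ⟨n, by omega, h⟩
    · exact ⟨m, by omega, h, h1⟩

theorem exists_lt_between' {f : ℕ → ℝ} {x : ℝ} {N : ℕ} (hN : 0 < N) (h0 : x ≤ f 0) (h1 : f N ≤ x) :
    ∃ n < N, f (n + 1) ≤ x ∧ x ≤ f n := by
  obtain ⟨n, hn, h2, h3⟩ := exists_lt_between (f := fun n => -f n) hN (neg_le_neg h0) (neg_le_neg h1)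
  exact ⟨n, hn, neg_le_neg_iff.1 h3, neg_le_neg_iff.1 h2⟩

namespace Layout

variable {w h : ℕ} {Λ : Layout w h} {T : SimpleGraph Plane}

/-- An edge of the cone vertex prevents chords of the first vertical path. -/
theorem not_adj_of_adj_cone (hT : IsPSLGraph Λ.verts T) {n m : ℕ}
    (hcone : T.Adj Λ.cone (Λ.pos (0, n + 1))) (hnm : n + 1 < m) (hm : m ≤ 4 * h) :
    ¬ T.Adj (Λ.pos (0, m)) (Λ.pos (0, n)) := by
  intro hadj
  have hup : ∀ m ≤ 4 * h, Λ.Used (0, m) := fun m hm => used_path (i := 0) (Nat.zero_le _) hm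
  have hn : n < 4 * h := by omega
  have hpb := path_step (Λ := Λ) (i := 0) (Nat.zero_le _) hn
  have hap := path_lt (Λ := Λ) (i := 0) (Nat.zero_le _) hnm hm
  have hc := cone_lt (hup (n + 1) hn)
  have hab : (Λ.pos (0, m)).1 < (Λ.pos (0, n)).1 := hap.1.trans hpb.1
  have hlow := vertical_lt (Λ := Λ) (i := 0) (Nat.zero_le _) hn (hup m hm).mem
    (path_le (Λ := Λ) (i := 0) (Nat.zero_le _) (Nat.zero_le m) hm).1
    (fun e => hab.ne (congrArg Prod.fst e)) (fun e => hap.1.ne (congrArg Prod.fst e))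
  -- By convexity of the path, the chord passes below the skipped vertex, the end of a cone edge. At
  -- its northern end the chord is above this cone edge, so the two would cross.
  have habove : lineAt (Λ.pos (0, m)) (Λ.pos (0, n)) (Λ.pos (0, n + 1)).1 <
      (Λ.pos (0, n + 1)).2 := by
    rw [← orient_pos_iff hab]
    rw [← orient_neg_iff hpb.1] at hlow
    unfold orient at hlow ⊢
    linarith
  have := hT.crossingFree.lineAt_le hadj hcone hab hc.1 (x₀ := (Λ.pos (0, n + 1)).1)
    (x₁ := (Λ.pos (0, m)).1) (by rwa [lineAt_right hc.1]) hap.1.le hpb.1.le hc.1.le le_rfl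
    le_rfl hab.le (cone_lt (hup m hm)).1.le hap.1.le
  rw [lineAt_left] at this
  exact absurd this (not_le.2 (lineAt_lt_of_apex hc.1 hc.2 hap.1.le hap.2))

/-- If the vertices of the first vertical path have sufficiently many neighbors to the west, then
they are adjacent to the cone vertex. -/
theorem adj_cone (hT : IsPSLGraph Λ.verts T)
    (hdeg : ∀ n < 4 * h, 2 ≤ cardinalDegree T .west (Λ.pos (0, n)))
    (hlast : 1 ≤ cardinalDegree T .west (Λ.pos (0, 4 * h))) {n : ℕ} (hn : n ≤ 4 * h) :
    T.Adj Λ.cone (Λ.pos (0, n)) := by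
  have hup : ∀ m ≤ 4 * h, Λ.Used (0, m) := fun m hm => used_path (i := 0) (Nat.zero_le _) hm
  have hwest : ∀ m ≤ 4 * h, ∀ u, T.Adj (Λ.pos (0, m)) u → u.1 < (Λ.pos (0, m)).1 →
      u = Λ.cone ∨ ∃ m' ≤ 4 * h, m < m' ∧ u = Λ.pos (0, m') := by
    intro m hm u hu hlt
    rcases mem_verts_iff.1 (hT.mem _ _ hu).2 with rfl | ⟨k, hk, rfl⟩
    · exact Or.inl rfl
    · have h0 := (path_le (Λ := Λ) (i := 0) (Nat.zero_le _) (Nat.zero_le m) hm).1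
      have hk0 := (hk.fst_le_iff (i := 0) (Nat.zero_le _)).1 (hlt.le.trans h0)
      have ek : k = (0, k.2) := Prod.ext (by dsimp only; omega) rfl
      refine Or.inr ⟨k.2, hk.le.2, ?_, by rw [← ek]⟩
      by_contra! hle
      have := (path_le (Λ := Λ) (i := 0) (Nat.zero_le _) hle hm).1
      rw [ek] at hlt
      exact absurd hlt (not_lt.2 this)
  -- The induction descends from the top of the path, whose only possible western neighbor is the
  -- cone vertex. A lower vertex has a western neighbor other than the next path vertex, and a chord
  -- of the path is excluded by the cone edge already found at that next vertex.
  induction hn using Nat.decreasingInduction with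
  | self =>
    obtain ⟨u, hu⟩ := Set.nonempty_of_ncard_ne_zero (s := {u | T.Adj (Λ.pos (0, 4 * h)) u ∧
      Toward .west (Λ.pos (0, 4 * h)) u}) (by unfold cardinalDegree at hlast; omega)
    rcases hwest _ le_rfl u hu.1 hu.2 with rfl | ⟨m', hm', hlt, -⟩
    · exact hu.1.symm
    · omega
  | of_succ n hn ih =>
    obtain ⟨u, hu, hne⟩ := Set.exists_ne_of_one_lt_ncard (hdeg n hn) (Λ.pos (0, n + 1))
    rcases hwest _ hn.le u hu.1 hu.2 with rfl | ⟨m, hm, hlt, rfl⟩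
    · exact hu.1.symm
    · exact absurd hu.1.symm (not_adj_of_adj_cone hT ih
        (lt_of_le_of_ne hlt fun e => hne (e ▸ rfl)) hm)

/-- A plane straight-line graph that contains the grid paths and the edges of the cone vertex. -/
structure IsFramed (Λ : Layout w h) (T : SimpleGraph Plane) : Prop where
  psl : IsPSLGraph Λ.verts T
  path : ∀ i ≤ w, ∀ n < 4 * h, T.Adj (Λ.pos (4 * i, n + 1)) (Λ.pos (4 * i, n))
  row : ∀ j ≤ h, ∀ m < 4 * w, T.Adj (Λ.pos (m + 1, 4 * j)) (Λ.pos (m, 4 * j))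
  cone_path : ∀ n ≤ 4 * h, T.Adj Λ.cone (Λ.pos (0, n))
  cone_row : ∀ m ≤ 4 * w, T.Adj Λ.cone (Λ.pos (m, 0))

theorem IsFramed.transpose (hT : Λ.IsFramed T) : Λ.transpose.IsFramed (swapGraph T) where
  psl := hT.psl.swap
  path := hT.row
  row := hT.path
  cone_path := hT.cone_row
  cone_row := hT.cone_path

theorem Used.path_end_le {k : ℕ × ℕ} (hk : Λ.Used k) {i : ℕ} (hi : i ≤ w) (hle : k.1 ≤ 4 * i) :
    (Λ.pos (4 * i, 0)).2 ≤ (Λ.pos k).2 := by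
  obtain ⟨i', hi', j', hj', a, ha, rfl⟩ := hk
  have b1 := a.offset_fst_le
  have b2 := a.offset_snd_le
  simp only [cellIndex] at hle
  rcases Nat.lt_or_ge i' i with hlt | hge
  · have key : ∀ a : CellVertex, a = .v4 ∨ CellVertex.Toward .north .v4 a := by decide
    have h4 := Λ.mem_present i' j' .v4 (by decide) (by decide)
    have h1 : (Λ.pos (4 * (i' + 1), 4 * j')).2 ≤ (Λ.pos (cellIndex i' j' a)).2 := by
      rcases key a with rfl | ht
      · exact le_rfl
      · exact (Λ.y_order i' hi' j' hj' _ h4 a ha ht).le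
    refine le_trans ?_ h1
    exact (row_le (Λ := Λ) (j := 0) (Nat.zero_le _) (m := 4 * (i' + 1)) (by omega) (by omega)).2.trans
      (path_le (Λ := Λ) (i := i' + 1) (by omega) (Nat.zero_le (4 * j')) (by omega)).2
  · obtain rfl : i' = i := by omega
    have : cellIndex i' j' a = (4 * i', 4 * j' + a.offset.2) := by
      simp only [cellIndex]; ext <;> dsimp only; omega
    rw [this]
    exact (path_le hi (Nat.zero_le _) (by omega)).2

/-- An edge across a vertical path passes above the vertices of the path in its range. -/
theorem IsFramed.path_lt_lineAt (hT : Λ.IsFramed T) {i : ℕ} (hi : i ≤ w) {k k' : ℕ × ℕ}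
    (hk : Λ.Used k) (hk' : Λ.Used k') (hadj : T.Adj (Λ.pos k) (Λ.pos k')) (hle : k.1 ≤ 4 * i)
    (hlt : 4 * i < k'.1) {n : ℕ} (hn : n ≤ 4 * h) (hkn : (Λ.pos k).1 < (Λ.pos (4 * i, n)).1) :
    (Λ.pos (4 * i, n)).2 < lineAt (Λ.pos k) (Λ.pos k') (Λ.pos (4 * i, n)).1 := by
  have hend : (Λ.pos (4 * i, 0)).1 < (Λ.pos k').1 := by
    by_contra! hc
    exact absurd ((hk'.fst_le_iff hi).1 hc) (not_le.2 hlt)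
  -- At the southern end of the path, passing below would mean crossing the cone edge to this end.
  -- Going up, the order cannot change because the edges of the path are not crossed.
  induction n with
  | zero =>
    have hu := used_path (Λ := Λ) hi (Nat.zero_le (4 * h))
    have hne := hT.psl.ne_lineAt hadj hu.mem hkn hend
    refine lt_of_le_of_ne (not_lt.1 fun hgt => ?_) hne
    have hc := cone_lt hu
    have hcadj : T.Adj Λ.cone (Λ.pos (4 * i, 0)) := hT.cone_row _ (by omega)
    have := hT.psl.crossingFree.lineAt_le hadj hcadj (hkn.trans hend) hc.1
      (x₀ := (Λ.pos (4 * i, 0)).1) (x₁ := (Λ.pos k).1) (by rwa [lineAt_right hc.1]) hkn.le hend.le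
      hc.1.le le_rfl le_rfl (hkn.trans hend).le (cone_lt hk).1.le hkn.le
    rw [lineAt_left] at this
    refine absurd this (not_le.2 (lineAt_lt_of_apex hc.1 hc.2 hkn.le ?_))
    refine lt_of_le_of_ne (hk.path_end_le hi hle) fun e => hkn.ne ?_
    exact congrArg Prod.fst (Λ.snd_injOn hk.mem hu.mem e.symm)
  | succ n ih =>
    have hs := path_step (Λ := Λ) hi (n := n) (by omega)
    have hb : (Λ.pos (4 * i, n)).1 < (Λ.pos k').1 :=
      (path_le (Λ := Λ) hi (Nat.zero_le n) (by omega)).1.trans_lt hend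
    have h0 := ih (by omega) (hkn.trans hs.1)
    have := hT.psl.crossingFree.lineAt_le (hT.path i hi n (by omega)) hadj hs.1
      ((hkn.trans hs.1).trans hb) (x₀ := (Λ.pos (4 * i, n)).1) (x₁ := (Λ.pos (4 * i, n + 1)).1)
      (by rwa [lineAt_right hs.1]) hs.1.le le_rfl (hkn.trans hs.1).le hb.le le_rfl hs.1.le hkn.le
      (hs.1.trans hb).le
    rw [lineAt_left] at this
    exact lt_of_le_of_ne this (hT.psl.ne_lineAt hadj (used_path hi hn).mem hkn (hs.1.trans hb))

/-- No edge crosses a vertical path. -/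
theorem IsFramed.not_across (hT : Λ.IsFramed T) {i : ℕ} (hi : i ≤ w) {k k' : ℕ × ℕ}
    (hk : Λ.Used k) (hk' : Λ.Used k') (hadj : T.Adj (Λ.pos k) (Λ.pos k')) (hlt : k.1 < 4 * i) :
    k'.1 ≤ 4 * i := by
  by_contra! hlt'
  have hh := Λ.h_pos
  have hend : (Λ.pos (4 * i, 0)).1 < (Λ.pos k').1 := by
    by_contra! hc
    exact absurd ((hk'.fst_le_iff hi).1 hc) (not_le.2 hlt')
  have hkx := (hk.fst_le_iff hi).2 hlt.le
  have hne : ∀ n ≤ 4 * h, (Λ.pos k).1 ≠ (Λ.pos (4 * i, n)).1 := by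
    intro n hn e
    have := pos_injOn hk (used_path hi hn) (Λ.fst_injOn hk.mem (used_path hi hn).mem e)
    rw [this] at hlt
    exact lt_irrefl _ hlt
  -- If the edge starts west of the whole path, it passes above the top vertex, which lies on the
  -- upper hull of all vertices. Otherwise it starts below some edge of the path, by the hull
  -- condition, but passes above the eastern end of that edge.
  rcases lt_or_ge (Λ.pos k).1 (Λ.pos (4 * i, 4 * h)).1 with hx | hx
  · have h1 := hT.path_lt_lineAt hi hk hk' hadj hlt.le hlt' le_rfl hx
    have hw := hk'.le.1
    have hr : ∀ k, Λ.Used k →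
        (Λ.pos k).2 ≤ lineAt (Λ.pos (4 * i, 4 * h)) (Λ.pos (4 * i + 1, 4 * h)) (Λ.pos k).1 :=
      fun k hk => horizontal_le le_rfl (by omega) hk.mem ((hk.snd_le_iff le_rfl).2 hk.le.2)
    have hb : (Λ.pos (4 * i, 4 * h)).1 < (Λ.pos k').1 :=
      (path_le (Λ := Λ) hi (Nat.zero_le _) le_rfl).1.trans_lt hend
    have := lineAt_le_lineAt (hx.trans hb) hx.le hb.le (hr k hk) (hr k' hk')
    rw [lineAt_left] at this
    exact absurd this (not_le.2 h1)
  · obtain ⟨n, hn, h1, h2⟩ := exists_lt_between' (f := fun n => (Λ.pos (4 * i, n)).1)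
      (N := 4 * h) (by omega) hkx hx
    have h1 : (Λ.pos (4 * i, n + 1)).1 < (Λ.pos k).1 := lt_of_le_of_ne h1 (hne _ hn).symm
    have h2 : (Λ.pos k).1 < (Λ.pos (4 * i, n)).1 := lt_of_le_of_ne h2 (hne _ hn.le)
    have h3 := hT.path_lt_lineAt hi hk hk' hadj hlt.le hlt' hn.le h2
    have h4 := vertical_lt hi hn hk.mem hkx (fun e => h2.ne (congrArg Prod.fst e))
      (fun e => h1.ne' (congrArg Prod.fst e))
    have hb : (Λ.pos (4 * i, n)).1 < (Λ.pos k').1 :=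
      (path_le (Λ := Λ) hi (Nat.zero_le n) hn.le).1.trans_lt hend
    have := hT.psl.crossingFree.lineAt_le hadj (hT.path i hi n hn) (h2.trans hb) (h1.trans h2)
      (x₀ := (Λ.pos k).1) (x₁ := (Λ.pos (4 * i, n)).1) (by rwa [lineAt_left]) le_rfl
      (h2.trans hb).le h1.le h2.le h2.le hb.le (h1.trans h2).le le_rfl
    rw [lineAt_right (h1.trans h2)] at this
    exact absurd this (not_le.2 h3)

theorem IsFramed.exists_col (hT : Λ.IsFramed T) {k k' : ℕ × ℕ} (hk : Λ.Used k) (hk' : Λ.Used k')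
    (hadj : T.Adj (Λ.pos k) (Λ.pos k')) :
    ∃ i < w, 4 * i ≤ k.1 ∧ k.1 ≤ 4 * i + 4 ∧ 4 * i ≤ k'.1 ∧ k'.1 ≤ 4 * i + 4 := by
  have h1 := hk.le
  have h2 := hk'.le
  have hw := Λ.w_pos
  -- For a positive larger column index, this is the last path strictly before it, so the other end
  -- cannot lie west of that path.
  have h3 := hT.not_across (i := (max k.1 k'.1 - 1) / 4) (by omega) hk hk' hadj
  have h4 := hT.not_across (i := (max k.1 k'.1 - 1) / 4) (by omega) hk' hk hadj.symm
  exact ⟨(max k.1 k'.1 - 1) / 4, by omega, by omega, by omega, by omega, by omega⟩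

/-- Adjacent vertices other than the cone vertex lie in a common cell. -/
theorem IsFramed.exists_cell (hT : Λ.IsFramed T) {k k' : ℕ × ℕ} (hk : Λ.Used k) (hk' : Λ.Used k')
    (hadj : T.Adj (Λ.pos k) (Λ.pos k')) :
    ∃ i < w, ∃ j < h, ∃ a ∈ Λ.present i j, ∃ b ∈ Λ.present i j,
      k = cellIndex i j a ∧ k' = cellIndex i j b := by
  obtain ⟨i, hi, h1, h2, h3, h4⟩ := hT.exists_col hk hk' hadj
  obtain ⟨j, hj, h5, h6, h7, h8⟩ := hT.transpose.exists_col (k := k.swap) (k' := k'.swap)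
    (used_transpose.2 hk) (used_transpose.2 hk') hadj
  obtain ⟨a, ha, e⟩ := hk.exists_cell h1 h2 h5 h6
  obtain ⟨b, hb, e'⟩ := hk'.exists_cell h3 h4 h7 h8
  exact ⟨i, hi, j, hj, a, ha, b, hb, e, e'⟩

end Layout

/-! ### Edges within the region of a cell -/

theorem le_lineAt_of_ends {a b : Plane} {x₀ x₁ x y : ℝ} (h0 : x₀ ≤ x) (h1 : x ≤ x₁)
    (hy0 : y ≤ lineAt a b x₀) (hy1 : y ≤ lineAt a b x₁) : y ≤ lineAt a b x := by
  unfold lineAt at *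
  rcases le_total 0 ((b.2 - a.2) / (b.1 - a.1)) with hs | hs
  · nlinarith [mul_le_mul_of_nonneg_left h0 hs]
  · nlinarith [mul_le_mul_of_nonpos_left h1 hs]

theorem lineAt_antitone {a b : Plane} (h1 : a.1 < b.1) (h2 : b.2 < a.2) {x y : ℝ} (hxy : x ≤ y) :
    lineAt a b y ≤ lineAt a b x := by
  have hs : (b.2 - a.2) / (b.1 - a.1) ≤ 0 :=
    div_nonpos_of_nonpos_of_nonneg (by linarith) (by linarith)
  unfold lineAt
  nlinarith [mul_le_mul_of_nonpos_left hxy hs]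

namespace Layout

variable {w h : ℕ} {Λ : Layout w h} {T : SimpleGraph Plane}

/-- The point lies on the west or on the south side of a cell. -/
def OnSouthWest (Λ : Layout w h) (i j : ℕ) (s : Plane) : Prop :=
  (∃ t < 4, s ∈ segment ℝ (Λ.pos (4 * i, 4 * j + t + 1)) (Λ.pos (4 * i, 4 * j + t))) ∨
  (∃ t < 4, s ∈ segment ℝ (Λ.pos (4 * i + t + 1, 4 * j)) (Λ.pos (4 * i + t, 4 * j)))

theorem onSouthWest_swap {i j : ℕ} {s : Plane} :
    Λ.transpose.OnSouthWest j i s.swap ↔ Λ.OnSouthWest i j s := by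
  have h1 : ∀ t, s.swap ∈ segment ℝ (Λ.transpose.pos (4 * j, 4 * i + t + 1))
      (Λ.transpose.pos (4 * j, 4 * i + t)) ↔
      s ∈ segment ℝ (Λ.pos (4 * i + t + 1, 4 * j)) (Λ.pos (4 * i + t, 4 * j)) :=
    fun t => mem_segment_swap
  have h2 : ∀ t, s.swap ∈ segment ℝ (Λ.transpose.pos (4 * j + t + 1, 4 * i))
      (Λ.transpose.pos (4 * j + t, 4 * i)) ↔
      s ∈ segment ℝ (Λ.pos (4 * i, 4 * j + t + 1)) (Λ.pos (4 * i, 4 * j + t)) :=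
    fun t => mem_segment_swap
  unfold OnSouthWest
  simp only [h1, h2]
  exact Or.comm

theorem mem_pathOf_southWest {i j : ℕ} {s : Plane} :
    s ∈ pathOf (cellAt Λ.pos i j) CellVertex.southWestEdges ↔ Λ.OnSouthWest i j s := by
  constructor
  · rintro ⟨e, he, hz⟩
    simp only [CellVertex.southWestEdges, List.mem_cons, List.not_mem_nil, or_false] at he
    rcases he with rfl | rfl | rfl | rfl | rfl | rfl | rfl | rfl
    · exact Or.inl ⟨3, by omega, hz⟩
    · exact Or.inl ⟨2, by omega, hz⟩
    · exact Or.inl ⟨1, by omega, hz⟩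
    · exact Or.inl ⟨0, by omega, hz⟩
    · rw [segment_symm] at hz
      exact Or.inr ⟨0, by omega, hz⟩
    · rw [segment_symm] at hz
      exact Or.inr ⟨1, by omega, hz⟩
    · rw [segment_symm] at hz
      exact Or.inr ⟨2, by omega, hz⟩
    · rw [segment_symm] at hz
      exact Or.inr ⟨3, by omega, hz⟩
  · rintro (⟨t, ht, hz⟩ | ⟨t, ht, hz⟩)
    · interval_cases t
      · exact ⟨(.b7, .v8), by decide, hz⟩
      · exact ⟨(.b6, .b7), by decide, hz⟩
      · exact ⟨(.b5, .b6), by decide, hz⟩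
      · exact ⟨(.b4, .b5), by decide, hz⟩
    · rw [segment_symm] at hz
      interval_cases t
      · exact ⟨(.v8, .v7), by decide, hz⟩
      · exact ⟨(.v7, .v6), by decide, hz⟩
      · exact ⟨(.v6, .v5), by decide, hz⟩
      · exact ⟨(.v5, .v4), by decide, hz⟩

/-- An edge leaving the west side eastward stays above all lower vertices of this side by
`path_lt_lineAt`. So west of the corner `v8` it is above the side. East of `v8` it stays above the
height of `v8` if its other end is also above it, because an affine function is at least the smaller
of its end values. -/
theorem IsFramed.southWest_aux (hT : Λ.IsFramed T) {i j : ℕ} (hi : i < w) (hj : j < h) {y : ℕ}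
    (hy0 : 0 < y) (hy : y ≤ 4) {k : ℕ × ℕ} (hk : Λ.Used k) (hlt : 4 * i < k.1)
    (hadj : T.Adj (Λ.pos (4 * i, 4 * j + y)) (Λ.pos k)) {z : Plane}
    (hz : z ∈ segment ℝ (Λ.pos (4 * i, 4 * j + y)) (Λ.pos k)) :
    (z.1 ≤ (Λ.pos (4 * i, 4 * j)).1 → ∃ s, Λ.OnSouthWest i j s ∧ s ≤ z) ∧
    ((Λ.pos (4 * i, 4 * j)).2 ≤ (Λ.pos k).2 → (Λ.pos (4 * i, 4 * j)).1 ≤ z.1 →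
      (Λ.pos (4 * i, 4 * j)).2 ≤ z.2) := by
  have hu := used_path (Λ := Λ) hi.le (n := 4 * j + y) (by omega)
  have hend : (Λ.pos (4 * i, 0)).1 < (Λ.pos k).1 := by
    by_contra! hc
    exact absurd ((hk.fst_le_iff hi.le).1 hc) (not_le.2 hlt)
  have hbx : ∀ n ≤ 4 * h, (Λ.pos (4 * i, n)).1 < (Λ.pos k).1 := fun n hn =>
    (path_le (Λ := Λ) hi.le (Nat.zero_le n) hn).1.trans_lt hend
  obtain ⟨hz1, hz2, hz3⟩ := (mem_segment_iff_lineAt (hbx _ (by omega)) z).1 hz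
  have hP : ∀ t ≤ y, (Λ.pos (4 * i, 4 * j + t)).2 ≤
      lineAt (Λ.pos (4 * i, 4 * j + y)) (Λ.pos k) (Λ.pos (4 * i, 4 * j + t)).1 := by
    intro t ht
    rcases eq_or_lt_of_le ht with rfl | ht
    · rw [lineAt_left]
    · exact (hT.path_lt_lineAt hi.le hu hk hadj le_rfl hlt (by omega)
        (path_lt (Λ := Λ) hi.le (by omega) (by omega)).1).le
  constructor
  · intro hzx
    obtain ⟨t, ht, h1, h2⟩ := exists_lt_between' (f := fun t => (Λ.pos (4 * i, 4 * j + t)).1)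
      (N := y) hy0 hzx hz1
    have hs := path_step (Λ := Λ) hi.le (n := 4 * j + t) (by omega)
    refine ⟨(z.1, lineAt (Λ.pos (4 * i, 4 * j + t + 1)) (Λ.pos (4 * i, 4 * j + t)) z.1),
      Or.inl ⟨t, by omega, (mem_segment_iff_lineAt hs.1 _).2 ⟨h1, h2, rfl⟩⟩, ⟨le_rfl, ?_⟩⟩
    change lineAt _ _ _ ≤ z.2
    rw [hz3]
    exact lineAt_le_lineAt hs.1 h1 h2 (hP (t + 1) ht) (hP t ht.le)
  · intro hky hzx
    rw [hz3]
    exact le_lineAt_of_ends hzx hz2 (hP 0 (by omega))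
      (by rwa [lineAt_right (hbx _ (by omega))])

/-- The points of an edge within a cell that is not a chord of its west or south side are weakly
north-east of these sides. -/
theorem IsFramed.exists_onSouthWest_le (hT : Λ.IsFramed T) {i j : ℕ} (hi : i < w) (hj : j < h)
    {a b : CellVertex} (ha : a ∈ Λ.present i j) (hb : b ∈ Λ.present i j)
    (hadj : T.Adj (Λ.pos (cellIndex i j a)) (Λ.pos (cellIndex i j b)))
    (hwest : 0 < a.offset.1 ∨ 0 < b.offset.1) (hsouth : 0 < a.offset.2 ∨ 0 < b.offset.2)
    {z : Plane} (hz : z ∈ segment ℝ (Λ.pos (cellIndex i j a)) (Λ.pos (cellIndex i j b))) :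
    ∃ s, Λ.OnSouthWest i j s ∧ s ≤ z := by
  -- The corner `v8` lies on both sides, so points north-east of it need no further argument. The
  -- work concerns the points west or south of it.
  have h8 : ((Λ.pos (4 * i, 4 * j)).1 ≤ z.1 ∧ (Λ.pos (4 * i, 4 * j)).2 ≤ z.2) →
      ∃ s, Λ.OnSouthWest i j s ∧ s ≤ z := fun hle =>
    ⟨Λ.pos (4 * i, 4 * j), Or.inl ⟨0, by omega, right_mem_segment ℝ _ _⟩, hle⟩
  -- an edge with an end on the west side
  have hW : ∀ a b, a ∈ Λ.present i j → b ∈ Λ.present i j →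
      T.Adj (Λ.pos (cellIndex i j a)) (Λ.pos (cellIndex i j b)) → a.offset.1 = 0 →
      0 < a.offset.2 → 0 < b.offset.1 →
      z ∈ segment ℝ (Λ.pos (cellIndex i j a)) (Λ.pos (cellIndex i j b)) →
      (z.1 ≤ (Λ.pos (4 * i, 4 * j)).1 → ∃ s, Λ.OnSouthWest i j s ∧ s ≤ z) ∧
      ((Λ.pos (4 * i, 4 * j)).2 ≤ (Λ.pos (cellIndex i j b)).2 →
        (Λ.pos (4 * i, 4 * j)).1 ≤ z.1 → (Λ.pos (4 * i, 4 * j)).2 ≤ z.2) := by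
    intro a b _ hb hadj h0 h1 h2 hz
    have e : cellIndex i j a = (4 * i, 4 * j + a.offset.2) := by simp [cellIndex, h0]
    rw [e] at hadj hz
    exact hT.southWest_aux hi hj h1 a.offset_snd_le (used_of_cell hi hj hb)
      (by simp only [cellIndex]; omega) hadj hz
  -- an edge with an end on the south side
  have hS : ∀ a b, a ∈ Λ.present i j → b ∈ Λ.present i j →
      T.Adj (Λ.pos (cellIndex i j a)) (Λ.pos (cellIndex i j b)) → a.offset.2 = 0 →
      0 < a.offset.1 → 0 < b.offset.2 →
      z ∈ segment ℝ (Λ.pos (cellIndex i j a)) (Λ.pos (cellIndex i j b)) →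
      (z.2 ≤ (Λ.pos (4 * i, 4 * j)).2 → ∃ s, Λ.OnSouthWest i j s ∧ s ≤ z) ∧
      ((Λ.pos (4 * i, 4 * j)).1 ≤ (Λ.pos (cellIndex i j b)).1 →
        (Λ.pos (4 * i, 4 * j)).2 ≤ z.2 → (Λ.pos (4 * i, 4 * j)).1 ≤ z.1) := by
    intro a b _ hb hadj h0 h1 h2 hz
    have e : cellIndex i j a = (4 * i + a.offset.1, 4 * j) := by simp [cellIndex, h0]
    rw [e] at hadj hz
    have := hT.transpose.southWest_aux hj hi h1 a.offset_fst_le (k := (cellIndex i j b).swap)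
      (used_transpose.2 (used_of_cell hi hj hb)) (by simp only [cellIndex, Prod.fst_swap]; omega) hadj
      (z := z.swap) (mem_segment_swap.2 hz)
    refine ⟨fun hzy => ?_, this.2⟩
    obtain ⟨s, hs, hsz⟩ := this.1 hzy
    refine ⟨s.swap, ?_, ⟨hsz.2, hsz.1⟩⟩
    rw [← onSouthWest_swap, Prod.swap_swap]
    exact hs
  have hge : ∀ a ∈ Λ.present i j, 0 < a.offset.1 → 0 < a.offset.2 →
      (Λ.pos (4 * i, 4 * j)).1 ≤ (Λ.pos (cellIndex i j a)).1 ∧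
      (Λ.pos (4 * i, 4 * j)).2 ≤ (Λ.pos (cellIndex i j a)).2 := fun a ha h1 h2 =>
    let h := own_gt (Λ := Λ) hi hj (Finset.mem_filter.2 ⟨ha, h1, h2⟩)
    ⟨h.1.le, h.2.le⟩
  have hcorner : ∀ a : CellVertex, a.offset.1 = 0 → a.offset.2 = 0 →
      Λ.pos (cellIndex i j a) = Λ.pos (4 * i, 4 * j) := fun a h1 h2 => by simp [cellIndex, h1, h2]
  have hconv : ∀ p q : Plane, z ∈ segment ℝ p q → Λ.pos (4 * i, 4 * j) ≤ p →
      Λ.pos (4 * i, 4 * j) ≤ q → ∃ s, Λ.OnSouthWest i j s ∧ s ≤ z := by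
    intro p q hz hp hq
    exact h8 ((convex_Ici (𝕜 := ℝ) (Λ.pos (4 * i, 4 * j))).segment_subset hp hq hz)
  -- the cases, up to the order of the ends
  have main : ∀ a b, a ∈ Λ.present i j → b ∈ Λ.present i j →
      T.Adj (Λ.pos (cellIndex i j a)) (Λ.pos (cellIndex i j b)) →
      z ∈ segment ℝ (Λ.pos (cellIndex i j a)) (Λ.pos (cellIndex i j b)) →
      (0 < a.offset.1 ∨ 0 < b.offset.1) → (0 < a.offset.2 ∨ 0 < b.offset.2) →
      0 < b.offset.1 → (a.offset.1 = 0 ∨ 0 < b.offset.2) →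
      ∃ s, Λ.OnSouthWest i j s ∧ s ≤ z := by
    intro a b ha hb hadj hz _ h2 h3 h4
    rcases Nat.eq_zero_or_pos a.offset.1 with a1 | a1 <;>
      rcases Nat.eq_zero_or_pos a.offset.2 with a2 | a2
    · have hb2 : 0 < b.offset.2 := by omega
      exact hconv _ _ hz (hcorner a a1 a2).ge (hge b hb h3 hb2)
    · obtain ⟨w1, w2⟩ := hW a b ha hb hadj a1 a2 h3 hz
      rcases le_total z.1 (Λ.pos (4 * i, 4 * j)).1 with hx | hx
      · exact w1 hx
      rcases Nat.eq_zero_or_pos b.offset.2 with b2 | b2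
      · have hz' := hz
        rw [segment_symm] at hz'
        obtain ⟨s1, -⟩ := hS b a hb ha hadj.symm b2 h3 a2 hz'
        rcases le_total z.2 (Λ.pos (4 * i, 4 * j)).2 with hy | hy
        · exact s1 hy
        · exact h8 ⟨hx, hy⟩
      · exact h8 ⟨hx, w2 (hge b hb h3 b2).2 hx⟩
    · have hb2 : 0 < b.offset.2 := by omega
      obtain ⟨s1, s2⟩ := hS a b ha hb hadj a2 a1 hb2 hz
      rcases le_total z.2 (Λ.pos (4 * i, 4 * j)).2 with hy | hy
      · exact s1 hy
      · exact h8 ⟨s2 (hge b hb h3 hb2).1 hy, hy⟩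
    · have hb2 : 0 < b.offset.2 := by omega
      exact hconv _ _ hz (hge a ha a1 a2) (hge b hb h3 hb2)
  by_cases hc : 0 < b.offset.1 ∧ (a.offset.1 = 0 ∨ 0 < b.offset.2)
  · exact main a b ha hb hadj hz hwest hsouth hc.1 hc.2
  · rw [segment_symm] at hz
    exact main b a hb ha hadj.symm hz hwest.symm hsouth.symm (by omega) (by omega)

/-- The points of a segment between vertices of a cell are weakly south-west of its north and east
sides. -/
theorem exists_northEast_ge {i j : ℕ} (hi : i < w) (hj : j < h) {a b : CellVertex}
    (ha : a ∈ Λ.present i j) (hb : b ∈ Λ.present i j) {z : Plane}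
    (hz : z ∈ segment ℝ (Λ.pos (cellIndex i j a)) (Λ.pos (cellIndex i j b))) :
    ∃ s ∈ pathOf (cellAt Λ.pos i j) CellVertex.northEastEdges, z ≤ s := by
  have hb4 := Λ.mem_present i j .b4 (by decide) (by decide)
  have hv4 := Λ.mem_present i j .v4 (by decide) (by decide)
  have key : ∀ c : CellVertex, (c = .b4 ∨ CellVertex.Toward .east .b4 c) ∧
      (c = .v4 ∨ CellVertex.Toward .east c .v4) := by decide
  have hx : ∀ c ∈ Λ.present i j, (Λ.pos (4 * i, 4 * j + 4)).1 ≤ (Λ.pos (cellIndex i j c)).1 ∧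
      (Λ.pos (cellIndex i j c)).1 ≤ (Λ.pos (4 * i + 4, 4 * j)).1 := by
    intro c hc
    constructor
    · rcases (key c).1 with rfl | ht
      · exact le_rfl
      · exact (Λ.x_order i hi j hj _ hb4 c hc ht).le
    · rcases (key c).2 with rfl | ht
      · exact le_rfl
      · exact (Λ.x_order i hi j hj c hc _ hv4 ht).le
  -- a line above the ends of the segment is above the segment
  have hbelow : ∀ p q : Plane, p.1 < q.1 → (∀ c ∈ Λ.present i j,
      orient p q (Λ.pos (cellIndex i j c)) ≤ 0) → z.2 ≤ lineAt p q z.1 := by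
    intro p q hpq H
    have h1 := (orient_nonpos_iff hpq _).1 (H a ha)
    have h2 := (orient_nonpos_iff hpq _).1 (H b hb)
    obtain ⟨s, t, hs, ht, hst, rfl⟩ := hz
    simp only [Prod.fst_add, Prod.snd_add, Prod.smul_fst, Prod.smul_snd, smul_eq_mul]
    rw [lineAt_combo p q hst]
    nlinarith [mul_le_mul_of_nonneg_left h1 hs, mul_le_mul_of_nonneg_left h2 ht]
  have hzx : (Λ.pos (4 * i, 4 * j + 4)).1 ≤ z.1 ∧ z.1 ≤ (Λ.pos (4 * i + 4, 4 * j)).1 := by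
    obtain ⟨s, t, hs, ht, hst, rfl⟩ := hz
    obtain rfl : s = 1 - t := by linarith
    simp only [Prod.fst_add, Prod.smul_fst, smul_eq_mul]
    constructor
    · nlinarith [mul_le_mul_of_nonneg_left (hx a ha).1 hs, mul_le_mul_of_nonneg_left (hx b hb).1 ht]
    · nlinarith [mul_le_mul_of_nonneg_left (hx a ha).2 hs, mul_le_mul_of_nonneg_left (hx b hb).2 ht]
  have finish : ∀ p q : Plane, p.1 < q.1 → p.1 ≤ z.1 → z.1 ≤ q.1 → z.2 ≤ lineAt p q z.1 →
      (∃ e ∈ CellVertex.northEastEdges, (cellAt Λ.pos i j e.1 = p ∧ cellAt Λ.pos i j e.2 = q) ∨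
        (cellAt Λ.pos i j e.1 = q ∧ cellAt Λ.pos i j e.2 = p)) →
      ∃ s ∈ pathOf (cellAt Λ.pos i j) CellVertex.northEastEdges, z ≤ s := by
    rintro p q hpq h1 h2 h3 ⟨e, he, h4⟩
    refine ⟨(z.1, lineAt p q z.1), ⟨e, he, ?_⟩, ⟨le_rfl, h3⟩⟩
    have hm : (z.1, lineAt p q z.1) ∈ segment ℝ p q :=
      (mem_segment_iff_lineAt hpq _).2 ⟨h1, h2, rfl⟩
    rcases h4 with ⟨h4, h5⟩ | ⟨h4, h5⟩
    · rwa [h4, h5]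
    · rwa [h4, h5, segment_symm]
  have hused : ∀ c ∈ Λ.present i j, (Λ.pos (cellIndex i j c)).1 ≤ (Λ.pos (4 * (i + 1), 0)).1 ∧
      (Λ.pos (cellIndex i j c)).2 ≤ (Λ.pos (0, 4 * (j + 1))).2 := by
    intro c hc
    have := c.offset_fst_le
    have := c.offset_snd_le
    have hu := used_of_cell (Λ := Λ) hi hj hc
    exact ⟨(hu.fst_le_iff hi).2 (by simp only [cellIndex]; omega),
      (hu.snd_le_iff hj).2 (by simp only [cellIndex]; omega)⟩
  -- West of the corner `v0` the north side is above `z`, and east of it the east side is. Both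
  -- sides are hull edges for a set that contains all vertices of the cell.
  rcases le_total z.1 (Λ.pos (4 * i + 4, 4 * j + 4)).1 with hzc | hzc
  · obtain ⟨m, hm, h1, h2⟩ := exists_lt_between (f := fun m => (Λ.pos (4 * i + m, 4 * j + 4)).1)
      (N := 4) (by omega) hzx.1 hzc
    have hr := row_lt (Λ := Λ) (j := j + 1) hj (Nat.lt_succ_self (4 * i + m)) (by omega)
    refine finish _ _ hr.1 h1 h2 (hbelow _ _ hr.1 fun c hc =>
      horizontal_orient (Λ := Λ) (j := j + 1) (m := 4 * i + m) hj (by omega)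
        (used_of_cell hi hj hc).mem (hused c hc).2) ?_
    interval_cases m
    · exact ⟨(.b3, .b4), by decide, Or.inr ⟨rfl, rfl⟩⟩
    · exact ⟨(.b2, .b3), by decide, Or.inr ⟨rfl, rfl⟩⟩
    · exact ⟨(.b1, .b2), by decide, Or.inr ⟨rfl, rfl⟩⟩
    · exact ⟨(.v0, .b1), by decide, Or.inr ⟨rfl, rfl⟩⟩
  · obtain ⟨n, hn, h1, h2⟩ := exists_lt_between' (f := fun n => (Λ.pos (4 * i + 4, 4 * j + n)).1)
      (N := 4) (by omega) hzx.2 hzc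
    have hr := path_step (Λ := Λ) (i := i + 1) (n := 4 * j + n) hi (by omega)
    refine finish _ _ hr.1 h1 h2 (hbelow _ _ hr.1 fun c hc =>
      vertical_orient (Λ := Λ) (i := i + 1) (n := 4 * j + n) hi (by omega)
        (used_of_cell hi hj hc).mem (hused c hc).1) ?_
    interval_cases n
    · exact ⟨(.v4, .v3), by decide, Or.inr ⟨rfl, rfl⟩⟩
    · exact ⟨(.v3, .v2), by decide, Or.inr ⟨rfl, rfl⟩⟩
    · exact ⟨(.v2, .v1), by decide, Or.inr ⟨rfl, rfl⟩⟩
    · exact ⟨(.v1, .v0), by decide, Or.inr ⟨rfl, rfl⟩⟩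

/-- A segment between vertices of a vertical path is weakly north-east of the west and south sides
of a cell to the east only if these vertices are consecutive. -/
theorem consecutive_of_onSouthWest {i j : ℕ} (hi : i < w) (hj : j < h) {y y' : ℕ} (hy : y < y')
    (hy' : y' ≤ 4) (hreg : ∀ z ∈ segment ℝ (Λ.pos (4 * i, 4 * j + y)) (Λ.pos (4 * i, 4 * j + y')),
      ∃ s, Λ.OnSouthWest i j s ∧ s ≤ z) : y' = y + 1 := by
  by_contra hne
  have hab := path_lt (Λ := Λ) hi.le (n := 4 * j + y) (n' := 4 * j + y') (by omega) (by omega)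
  have hva := (used_path (Λ := Λ) hi.le (n := 4 * j + y) (by omega)).mem
  have hvb := (used_path (Λ := Λ) hi.le (n := 4 * j + y') (by omega)).mem
  have hax := (path_le (Λ := Λ) hi.le (Nat.zero_le (4 * j + y)) (by omega)).1
  have hbx := (path_le (Λ := Λ) hi.le (Nat.zero_le (4 * j + y')) (by omega)).1
  have h8 := (path_le (Λ := Λ) hi.le (show 4 * j ≤ 4 * j + y by omega) (by omega)).1
  -- The midpoint of a chord is a counterexample. For every edge of the west side, at least one end
  -- of the chord is strictly below its line, so the midpoint is strictly below all these lines,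
  -- which descend eastward. It also lies strictly west of the south side.
  obtain ⟨z, hz, hzb⟩ : ∃ z ∈ segment ℝ (Λ.pos (4 * i, 4 * j + y)) (Λ.pos (4 * i, 4 * j + y')),
      z = (1 / 2 : ℝ) • Λ.pos (4 * i, 4 * j + y) + (1 / 2 : ℝ) • Λ.pos (4 * i, 4 * j + y') :=
    ⟨_, ⟨1 / 2, 1 / 2, by norm_num, by norm_num, by norm_num, rfl⟩, rfl⟩
  have hz1 : z.1 = 1 / 2 * (Λ.pos (4 * i, 4 * j + y)).1 + 1 / 2 * (Λ.pos (4 * i, 4 * j + y')).1 := by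
    rw [hzb]; simp
  have hz2 : z.2 = 1 / 2 * (Λ.pos (4 * i, 4 * j + y)).2 + 1 / 2 * (Λ.pos (4 * i, 4 * j + y')).2 := by
    rw [hzb]; simp
  obtain ⟨s, ⟨t, ht, hs⟩ | ⟨t, ht, hs⟩, hsz⟩ := hreg z hz
  · have hst := path_step (Λ := Λ) hi.le (n := 4 * j + t) (by omega)
    obtain ⟨-, -, hs3⟩ := (mem_segment_iff_lineAt hst.1 s).1 hs
    have l1 := vertical_le (Λ := Λ) hi.le (n := 4 * j + t) (by omega) hva hax
    have l2 := vertical_le (Λ := Λ) hi.le (n := 4 * j + t) (by omega) hvb hbx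
    have hneq : ∀ m n, m ≤ 4 * h → n ≤ 4 * h → m ≠ n → Λ.pos (4 * i, m) ≠ Λ.pos (4 * i, n) :=
      fun m n hm hn hmn e => hmn (congrArg Prod.snd
        (pos_injOn (used_path hi.le hm) (used_path hi.le hn) e))
    have hlt : z.2 < lineAt (Λ.pos (4 * i, 4 * j + t + 1)) (Λ.pos (4 * i, 4 * j + t)) z.1 := by
      rw [hz1, hz2, lineAt_combo _ _ (by norm_num)]
      by_cases hyt : y = t ∨ y = t + 1
      · have := vertical_lt (Λ := Λ) hi.le (n := 4 * j + t) (by omega) hvb hbx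
          (hneq _ _ (by omega) (by omega) (by omega)) (hneq _ _ (by omega) (by omega) (by omega))
        linarith
      · have := vertical_lt (Λ := Λ) hi.le (n := 4 * j + t) (by omega) hva hax
          (hneq _ _ (by omega) (by omega) (by omega)) (hneq _ _ (by omega) (by omega) (by omega))
        linarith
    have := lineAt_antitone hst.1 hst.2 hsz.1
    have h2 : s.2 ≤ z.2 := hsz.2
    linarith
  · have hst := row_lt (Λ := Λ) hj.le (Nat.lt_succ_self (4 * i + t)) (by omega)
    rw [segment_symm, mem_segment_iff_lineAt hst.1] at hs
    have h1 := (row_le (Λ := Λ) hj.le (show 4 * i ≤ 4 * i + t by omega) (by omega)).1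
    have h2 : s.1 ≤ z.1 := hsz.1
    have h3 := hs.1
    linarith [hab.1]

end Layout

/-! ### Families of graphs in the cells of a layout -/

/-- The west and south sides of a cell, as a graph on points. -/
def southWestGraph (f : CellVertex → Plane) : SimpleGraph Plane :=
  SimpleGraph.fromRel fun x y => ∃ e ∈ CellVertex.southWestEdges, f e.1 = x ∧ f e.2 = y

namespace CellVertex

set_option maxRecDepth 10000 in
theorem southWestEdges_same_side : ∀ e ∈ southWestEdges, e.1 ≠ .p ∧ e.1 ≠ .q ∧ e.2 ≠ .p ∧ e.2 ≠ .q ∧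
    e.1 ≠ e.2 ∧ ((e.1.offset.1 = 0 ∧ e.2.offset.1 = 0) ∨ (e.1.offset.2 = 0 ∧ e.2.offset.2 = 0)) := by
  decide

set_option maxRecDepth 10000 in
theorem mem_southWestEdges_of_west : ∀ a b : CellVertex, a.offset.1 = 0 → b.offset.1 = 0 →
    b.offset.2 = a.offset.2 + 1 → (b, a) ∈ southWestEdges := by decide

set_option maxRecDepth 10000 in
theorem mem_southWestEdges_of_south : ∀ a b : CellVertex, a.offset.2 = 0 → b.offset.2 = 0 →
    b.offset.1 = a.offset.1 + 1 → (a, b) ∈ southWestEdges := by decide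

set_option maxRecDepth 10000 in
theorem southWestEdges_cases : ∀ e ∈ southWestEdges,
    (e.1.offset.1 = 0 ∧ e.2.offset.1 = 0 ∧ e.1.offset.2 = e.2.offset.2 + 1 ∧
      ∃ e' ∈ northEastEdges, e'.2.offset = (4, e.1.offset.2) ∧ e'.1.offset = (4, e.2.offset.2)) ∨
    (e.1.offset.2 = 0 ∧ e.2.offset.2 = 0 ∧ e.2.offset.1 = e.1.offset.1 + 1 ∧
      ∃ e' ∈ northEastEdges, e'.2.offset = (e.1.offset.1, 4) ∧ e'.1.offset = (e.2.offset.1, 4)) := by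
  decide

set_option maxRecDepth 10000 in
theorem northEastEdges_spec : ∀ e ∈ northEastEdges, e.1 ≠ .p ∧ e.1 ≠ .q ∧ e.2 ≠ .p ∧ e.2 ≠ .q ∧
    e.1 ≠ e.2 := by decide

end CellVertex

theorem cardinalDegree_sdiff_add {V : Finset Plane} {G H : SimpleGraph Plane}
    (hG : ∀ a b, G.Adj a b → a ∈ V ∧ b ∈ V) (hle : H ≤ G) (d : Dir) (v : Plane) :
    cardinalDegree (G \ H) d v + cardinalDegree H d v = cardinalDegree G d v := by
  unfold cardinalDegree
  rw [← Set.ncard_union_eq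
    (Set.disjoint_left.2 fun u h1 h2 => h1.1.2 h2.1)
    (V.finite_toSet.subset fun u hu => (hG _ _ hu.1.1).2)
    (V.finite_toSet.subset fun u hu => (hG _ _ (hle hu.1)).2)]
  · congr 1
    ext u
    simp only [SimpleGraph.sdiff_adj, Set.mem_union, Set.mem_ofPred_eq]
    constructor
    · rintro (h | h)
      · exact ⟨h.1.1, h.2⟩
      · exact ⟨hle h.1, h.2⟩
    · intro h
      by_cases hH : H.Adj v u
      · exact Or.inr ⟨hH, h.2⟩
      · exact Or.inl ⟨⟨h.1, hH⟩, h.2⟩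

/-- The cardinal degrees of an edge-disjoint union add up. -/
theorem cardinalDegree_eq_add_sum {ι : Type*} [Fintype ι] {V : Finset Plane}
    {G K : SimpleGraph Plane} {H : ι → SimpleGraph Plane} (hG : ∀ a b, G.Adj a b → a ∈ V ∧ b ∈ V)
    {v : Plane} (hadj : ∀ u, G.Adj v u ↔ K.Adj v u ∨ ∃ c, (H c).Adj v u)
    (hK : ∀ u c, K.Adj v u → ¬ (H c).Adj v u)
    (hH : ∀ u c c', (H c).Adj v u → (H c').Adj v u → c = c') (d : Dir) :
    cardinalDegree G d v = cardinalDegree K d v + ∑ c, cardinalDegree (H c) d v := by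
  classical
  let B : SimpleGraph Plane → Finset Plane := fun G => V.filter fun u => G.Adj v u ∧ Toward d v u
  have hB : ∀ G' : SimpleGraph Plane, (∀ u, G'.Adj v u → u ∈ V) →
      cardinalDegree G' d v = (B G').card := by
    intro G' hG'
    rw [cardinalDegree, ← Set.ncard_coe_finset]
    congr 1
    ext u
    simp only [B, Finset.coe_filter, Set.mem_ofPred_eq]
    exact ⟨fun h => ⟨hG' u h.1, h⟩, fun h => h.2⟩
  have hGV : ∀ u, G.Adj v u → u ∈ V := fun u hu => (hG v u hu).2
  rw [hB G hGV, hB K fun u hu => hGV u ((hadj u).2 (Or.inl hu)),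
    Finset.sum_congr rfl fun c _ => hB (H c) fun u hu => hGV u ((hadj u).2 (Or.inr ⟨c, hu⟩))]
  have e : B G = B K ∪ Finset.univ.biUnion fun c => B (H c) := by
    ext u
    simp only [B, Finset.mem_filter, Finset.mem_union, Finset.mem_biUnion, Finset.mem_univ,
      true_and, hadj]
    constructor
    · rintro ⟨h1, h2 | ⟨c, h2⟩, h3⟩
      · exact Or.inl ⟨h1, h2, h3⟩
      · exact Or.inr ⟨c, h1, h2, h3⟩
    · rintro (⟨h1, h2, h3⟩ | ⟨c, h1, h2, h3⟩)
      · exact ⟨h1, Or.inl h2, h3⟩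
      · exact ⟨h1, Or.inr ⟨c, h2⟩, h3⟩
  rw [e, Finset.card_union_of_disjoint, Finset.card_biUnion]
  · intro c _ c' _ hne
    refine Finset.disjoint_left.2 fun u hu hu' => hne ?_
    exact hH u c c' (Finset.mem_filter.1 hu).2.1 (Finset.mem_filter.1 hu').2.1
  · refine Finset.disjoint_left.2 fun u hu hu' => ?_
    obtain ⟨c, -, hc⟩ := Finset.mem_biUnion.1 hu'
    exact hK u c (Finset.mem_filter.1 hu).2.1 (Finset.mem_filter.1 hc).2.1

namespace Layout

variable {w h : ℕ} {Λ : Layout w h} {T : SimpleGraph Plane}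

/-- The edges of the cone vertex and of the first vertical and the first horizontal path. -/
def baseGraph (Λ : Layout w h) : SimpleGraph Plane :=
  SimpleGraph.fromRel fun x y =>
    (x = Λ.cone ∧ ((∃ n ≤ 4 * h, y = Λ.pos (0, n)) ∨ ∃ m ≤ 4 * w, y = Λ.pos (m, 0))) ∨
    (∃ n < 4 * h, x = Λ.pos (0, n + 1) ∧ y = Λ.pos (0, n)) ∨
    (∃ m < 4 * w, x = Λ.pos (m + 1, 0) ∧ y = Λ.pos (m, 0))

theorem baseGraph_transpose : Λ.transpose.baseGraph = swapGraph Λ.baseGraph := by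
  have key : ∀ x y : Plane, ∀ k, x = Λ.transpose.pos k ↔ x.swap = Λ.pos k.swap := fun x y k =>
    ⟨fun e => by rw [e]; exact Prod.swap_swap _, fun e => by rw [← Prod.swap_swap x, e]; rfl⟩
  have key' : ∀ x : Plane, x = Λ.transpose.cone ↔ x.swap = Λ.cone := fun x =>
    ⟨fun e => by rw [e]; exact Prod.swap_swap _, fun e => by rw [← Prod.swap_swap x, e]; rfl⟩
  ext x y
  simp only [baseGraph, swapGraph, SimpleGraph.fromRel_adj, SimpleGraph.comap_adj, key', key x x,
    key y y, Prod.swap_prod_mk, Prod.swap_injective.ne_iff]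
  simp only [or_comm (a := ∃ n ≤ 4 * w, _), or_comm (a := ∃ n < 4 * w, _)]

/-- A family of graphs in the cells without edges along west or south sides. -/
def IsOwnFamily (Λ : Layout w h) (G : Fin w × Fin h → SimpleGraph Plane) : Prop :=
  ∀ c x y, (G c).Adj x y → ∃ a ∈ Λ.present c.1 c.2, ∃ b ∈ Λ.present c.1 c.2,
    x = Λ.pos (cellIndex c.1 c.2 a) ∧ y = Λ.pos (cellIndex c.1 c.2 b) ∧
    (0 < a.offset.1 ∨ 0 < b.offset.1) ∧ (0 < a.offset.2 ∨ 0 < b.offset.2)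

/-- Different cells that share two vertices share them along a side, and this side is the west or
the south side of one of the cells. -/
theorem IsOwnFamily.eq_of_adj {G : Fin w × Fin h → SimpleGraph Plane} (hG : Λ.IsOwnFamily G)
    {c c' : Fin w × Fin h} {x y : Plane} (h1 : (G c).Adj x y) (h2 : (G c').Adj x y) : c = c' := by
  obtain ⟨a, ha, b, hb, rfl, rfl, h3, h4⟩ := hG c x y h1
  obtain ⟨a', ha', b', hb', e, e', h3', h4'⟩ := hG c' _ _ h2
  have e1 := pos_injOn (used_of_cell c.1.2 c.2.2 ha) (used_of_cell c'.1.2 c'.2.2 ha') e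
  have e2 := pos_injOn (used_of_cell c.1.2 c.2.2 hb) (used_of_cell c'.1.2 c'.2.2 hb') e'
  simp only [cellIndex, Prod.mk.injEq] at e1 e2
  have := a.offset_fst_le
  have := a.offset_snd_le
  have := b.offset_fst_le
  have := b.offset_snd_le
  have := a'.offset_fst_le
  have := a'.offset_snd_le
  have := b'.offset_fst_le
  have := b'.offset_snd_le
  exact Prod.ext (Fin.ext (by omega)) (Fin.ext (by omega))

theorem IsOwnFamily.not_adj_base {G : Fin w × Fin h → SimpleGraph Plane} (hG : Λ.IsOwnFamily G)
    {c : Fin w × Fin h} {x y : Plane} (h1 : Λ.baseGraph.Adj x y) : ¬ (G c).Adj x y := by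
  have key : ∀ x y, (G c).Adj x y →
      ¬ ((x = Λ.cone ∧ ((∃ n ≤ 4 * h, y = Λ.pos (0, n)) ∨ ∃ m ≤ 4 * w, y = Λ.pos (m, 0))) ∨
      (∃ n < 4 * h, x = Λ.pos (0, n + 1) ∧ y = Λ.pos (0, n)) ∨
      (∃ m < 4 * w, x = Λ.pos (m + 1, 0) ∧ y = Λ.pos (m, 0))) := by
    intro x y hxy
    obtain ⟨a, ha, b, hb, rfl, rfl, h3, h4⟩ := hG c x y hxy
    have ua := used_of_cell (Λ := Λ) c.1.2 c.2.2 ha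
    have ub := used_of_cell (Λ := Λ) c.1.2 c.2.2 hb
    rintro (⟨e, -⟩ | ⟨n, hn, e, e'⟩ | ⟨m, hm, e, e'⟩)
    · exact pos_ne_cone ua e
    · have e1 := pos_injOn ua (used_path (i := 0) (Nat.zero_le _) hn) e
      have e2 := pos_injOn ub (used_path (i := 0) (Nat.zero_le _) hn.le) e'
      simp only [cellIndex, Prod.mk.injEq] at e1 e2
      omega
    · have e1 := pos_injOn ua (used_row (j := 0) (Nat.zero_le _) hm) e
      have e2 := pos_injOn ub (used_row (j := 0) (Nat.zero_le _) hm.le) e'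
      simp only [cellIndex, Prod.mk.injEq] at e1 e2
      omega
  intro h2
  rcases h1.2 with h | h
  · exact key x y h2 h
  · exact key y x h2.symm h

/-- Adjacent vertices on the west and south sides of a cell. -/
theorem southWestGraph_adj {i j : ℕ} {x y : Plane}
    (hadj : (southWestGraph (cellAt Λ.pos i j)).Adj x y) :
    ∃ a b, a ≠ .p ∧ a ≠ .q ∧ b ≠ .p ∧ b ≠ .q ∧ x = Λ.pos (cellIndex i j a) ∧
      y = Λ.pos (cellIndex i j b) ∧ ((a, b) ∈ CellVertex.southWestEdges ∨
        (b, a) ∈ CellVertex.southWestEdges) := by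
  rcases hadj.2 with ⟨e, he, rfl, rfl⟩ | ⟨e, he, rfl, rfl⟩
  · obtain ⟨h1, h2, h3, h4, -, -⟩ := CellVertex.southWestEdges_same_side e he
    exact ⟨e.1, e.2, h1, h2, h3, h4, rfl, rfl, Or.inl he⟩
  · obtain ⟨h1, h2, h3, h4, -, -⟩ := CellVertex.southWestEdges_same_side e he
    exact ⟨e.2, e.1, h3, h4, h1, h2, rfl, rfl, Or.inr he⟩

theorem southWestGraph_adj_of_mem {i j : ℕ} (hi : i < w) (hj : j < h) {a b : CellVertex}
    (hab : (a, b) ∈ CellVertex.southWestEdges ∨ (b, a) ∈ CellVertex.southWestEdges) :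
    (southWestGraph (cellAt Λ.pos i j)).Adj (Λ.pos (cellIndex i j a)) (Λ.pos (cellIndex i j b)) := by
  have key : ∀ e ∈ CellVertex.southWestEdges,
      Λ.pos (cellIndex i j e.1) ≠ Λ.pos (cellIndex i j e.2) := fun e he heq => by
    obtain ⟨h1, h2, h3, h4, h5, -⟩ := CellVertex.southWestEdges_same_side e he
    exact h5 (pos_cell_injective hi hj (Λ.mem_present i j _ h1 h2) (Λ.mem_present i j _ h3 h4) heq)
  rcases hab with hab | hab
  · exact ⟨key _ hab, Or.inl ⟨_, hab, rfl, rfl⟩⟩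
  · exact ⟨(key _ hab).symm, Or.inr ⟨_, hab, rfl, rfl⟩⟩

/-- A segment in a cell between two vertices of its west side or of its south side is an edge of
this side. -/
theorem mem_southWestEdges_of_inside {i j : ℕ} (hi : i < w) (hj : j < h) {a b : CellVertex}
    (hne : a ≠ b)
    (hreg : segment ℝ (Λ.pos (cellIndex i j a)) (Λ.pos (cellIndex i j b)) ⊆
      cellRegion (cellAt Λ.pos i j))
    (hside : (a.offset.1 = 0 ∧ b.offset.1 = 0) ∨ (a.offset.2 = 0 ∧ b.offset.2 = 0)) :
    (a, b) ∈ CellVertex.southWestEdges ∨ (b, a) ∈ CellVertex.southWestEdges := by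
  have hreg' : ∀ z ∈ segment ℝ (Λ.pos (cellIndex i j a)) (Λ.pos (cellIndex i j b)),
      ∃ s, Λ.OnSouthWest i j s ∧ s ≤ z := fun z hz =>
    let ⟨s, hs, hsz⟩ := (hreg hz).1
    ⟨s, mem_pathOf_southWest.1 hs, hsz⟩
  have hoff : a.offset ≠ b.offset := fun e => hne (CellVertex.offset_injective e)
  have wst : ∀ a b : CellVertex, a.offset.1 = 0 → b.offset.1 = 0 → a.offset.2 < b.offset.2 →
      (∀ z ∈ segment ℝ (Λ.pos (cellIndex i j a)) (Λ.pos (cellIndex i j b)),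
      ∃ s, Λ.OnSouthWest i j s ∧ s ≤ z) → (b, a) ∈ CellVertex.southWestEdges := by
    intro a b ha hb hlt H
    refine CellVertex.mem_southWestEdges_of_west a b ha hb ?_
    simp only [cellIndex, ha, hb, add_zero] at H
    exact consecutive_of_onSouthWest hi hj hlt b.offset_snd_le H
  have sth : ∀ a b : CellVertex, a.offset.2 = 0 → b.offset.2 = 0 → a.offset.1 < b.offset.1 →
      (∀ z ∈ segment ℝ (Λ.pos (cellIndex i j a)) (Λ.pos (cellIndex i j b)),
      ∃ s, Λ.OnSouthWest i j s ∧ s ≤ z) → (a, b) ∈ CellVertex.southWestEdges := by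
    intro a b ha hb hlt H
    refine CellVertex.mem_southWestEdges_of_south a b ha hb ?_
    simp only [cellIndex, ha, hb, add_zero] at H
    refine consecutive_of_onSouthWest (Λ := Λ.transpose) hj hi hlt b.offset_fst_le fun z hz => ?_
    obtain ⟨s, hs, hsz⟩ := H z.swap (mem_segment_swap.2 hz)
    exact ⟨s.swap, onSouthWest_swap.2 hs, ⟨hsz.2, hsz.1⟩⟩
  rcases hside with ⟨ha, hb⟩ | ⟨ha, hb⟩
  · rcases lt_trichotomy a.offset.2 b.offset.2 with hl | hl | hl
    · exact Or.inr (wst a b ha hb hl hreg')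
    · exact absurd (Prod.ext (ha.trans hb.symm) hl) hoff
    · rw [segment_symm] at hreg'
      exact Or.inl (wst b a hb ha hl hreg')
  · rcases lt_trichotomy a.offset.1 b.offset.1 with hl | hl | hl
    · exact Or.inl (sth a b ha hb hl hreg')
    · exact absurd (Prod.ext hl (ha.trans hb.symm)) hoff
    · rw [segment_symm] at hreg'
      exact Or.inr (sth b a hb ha hl hreg')

/-- The edges of a graph that lie in a cell. -/
def cellPart (Λ : Layout w h) (T : SimpleGraph Plane) (i j : ℕ) : SimpleGraph Plane where
  Adj x y := T.Adj x y ∧ (∃ a ∈ Λ.present i j, x = Λ.pos (cellIndex i j a)) ∧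
    (∃ b ∈ Λ.present i j, y = Λ.pos (cellIndex i j b)) ∧
    segment ℝ x y ⊆ cellRegion (cellAt Λ.pos i j)
  symm := ⟨fun x y h => ⟨h.1.symm, h.2.2.1, h.2.1, by rw [segment_symm]; exact h.2.2.2⟩⟩
  loopless := ⟨fun _ h => h.1.ne rfl⟩

/-- Graphs in the cells that lie in the cell regions have no edges along the west and south sides
other than those of these sides. -/
theorem isOwnFamily_sdiff {G : Fin w × Fin h → SimpleGraph Plane}
    (hmem : ∀ c x y, (G c).Adj x y → ∃ a ∈ Λ.present c.1 c.2, ∃ b ∈ Λ.present c.1 c.2,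
      x = Λ.pos (cellIndex c.1 c.2 a) ∧ y = Λ.pos (cellIndex c.1 c.2 b))
    (hreg : ∀ c x y, (G c).Adj x y → segment ℝ x y ⊆ cellRegion (cellAt Λ.pos c.1 c.2)) :
    Λ.IsOwnFamily fun c => G c \ southWestGraph (cellAt Λ.pos c.1 c.2) := by
  rintro c x y ⟨hG, hsw⟩
  obtain ⟨a, ha, b, hb, rfl, rfl⟩ := hmem c x y hG
  have hne : a ≠ b := fun e => hG.ne (by rw [e])
  have : ¬ ((a.offset.1 = 0 ∧ b.offset.1 = 0) ∨ (a.offset.2 = 0 ∧ b.offset.2 = 0)) := fun hside =>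
    hsw (southWestGraph_adj_of_mem c.1.2 c.2.2
      (mem_southWestEdges_of_inside c.1.2 c.2.2 hne (hreg c _ _ hG) hside))
  exact ⟨a, ha, b, hb, rfl, rfl, by omega, by omega⟩

theorem IsFramed.baseGraph_le (hT : Λ.IsFramed T) : Λ.baseGraph ≤ T := by
  have key : ∀ x y, ((x = Λ.cone ∧ ((∃ n ≤ 4 * h, y = Λ.pos (0, n)) ∨ ∃ m ≤ 4 * w, y = Λ.pos (m, 0))) ∨
      (∃ n < 4 * h, x = Λ.pos (0, n + 1) ∧ y = Λ.pos (0, n)) ∨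
      (∃ m < 4 * w, x = Λ.pos (m + 1, 0) ∧ y = Λ.pos (m, 0))) → T.Adj x y := by
    rintro x y (⟨rfl, ⟨n, hn, rfl⟩ | ⟨m, hm, rfl⟩⟩ | ⟨n, hn, rfl, rfl⟩ | ⟨m, hm, rfl, rfl⟩)
    · exact hT.cone_path n hn
    · exact hT.cone_row m hm
    · exact hT.path 0 (Nat.zero_le _) n hn
    · exact hT.row 0 (Nat.zero_le _) m hm
  rintro x y ⟨-, hxy | hxy⟩
  · exact key x y hxy
  · exact (key y x hxy).symm

theorem IsFramed.segment_subset (hT : Λ.IsFramed T) {i j : ℕ} (hi : i < w) (hj : j < h)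
    {a b : CellVertex} (ha : a ∈ Λ.present i j) (hb : b ∈ Λ.present i j)
    (hadj : T.Adj (Λ.pos (cellIndex i j a)) (Λ.pos (cellIndex i j b)))
    (hwest : 0 < a.offset.1 ∨ 0 < b.offset.1) (hsouth : 0 < a.offset.2 ∨ 0 < b.offset.2) :
    segment ℝ (Λ.pos (cellIndex i j a)) (Λ.pos (cellIndex i j b)) ⊆
      cellRegion (cellAt Λ.pos i j) := fun z hz => by
  obtain ⟨s, hs, hsz⟩ := hT.exists_onSouthWest_le hi hj ha hb hadj hwest hsouth hz
  exact ⟨⟨s, mem_pathOf_southWest.2 hs, hsz⟩, exists_northEast_ge hi hj ha hb hz⟩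

/-- Adjacent vertices of a vertical path are consecutive or lie on the east side of a cell. -/
theorem IsFramed.path_cases (hT : Λ.IsFramed T) {k k' : ℕ × ℕ} (hk : Λ.Used k) (hk' : Λ.Used k')
    (hadj : T.Adj (Λ.pos k) (Λ.pos k')) {i j : ℕ} (hj : j < h) (hi : i ≤ w) (h1 : k.1 = 4 * i)
    (h2 : k'.1 = 4 * i) (h3 : 4 * j ≤ k.2) (h4 : k.2 ≤ 4 * j + 4) (h5 : 4 * j ≤ k'.2)
    (h6 : k'.2 ≤ 4 * j + 4) :
    (∃ n < 4 * h, (k = (0, n + 1) ∧ k' = (0, n)) ∨ (k' = (0, n + 1) ∧ k = (0, n))) ∨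
    ∃ i' < w, ∃ a ∈ Λ.present i' j, ∃ b ∈ Λ.present i' j, k = cellIndex i' j a ∧
      k' = cellIndex i' j b ∧ 0 < a.offset.1 ∧ (0 < a.offset.2 ∨ 0 < b.offset.2) := by
  have hne : k.2 ≠ k'.2 := fun e => hadj.ne (by rw [Prod.ext (h1.trans h2.symm) e])
  -- On the first path, chords are excluded by the cone edges. On any other path the pair is
  -- attributed to the cell to the west, of which the path is the east side.
  rcases Nat.eq_zero_or_pos i with rfl | hpos
  · left
    have ek : k = (0, k.2) := Prod.ext h1 rfl
    have ek' : k' = (0, k'.2) := Prod.ext h2 rfl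
    have key : ∀ n m, n < m → m ≤ 4 * h → T.Adj (Λ.pos (0, m)) (Λ.pos (0, n)) → m = n + 1 := by
      intro n m hnm hm hadj
      by_contra hc
      exact not_adj_of_adj_cone hT.psl (hT.cone_path (n + 1) (by omega)) (by omega) hm hadj
    rcases lt_or_gt_of_ne hne with hlt | hlt
    · refine ⟨k.2, by omega, Or.inr ⟨?_, ek⟩⟩
      rw [ek, ek'] at hadj
      rw [ek', key _ _ hlt (by omega) hadj.symm]
    · refine ⟨k'.2, by omega, Or.inl ⟨?_, ek'⟩⟩
      rw [ek, ek'] at hadj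
      rw [ek, key _ _ hlt (by omega) hadj]
  · right
    obtain ⟨a, ha, e⟩ := hk.exists_cell (i := i - 1) (by omega) (by omega) h3 h4
    obtain ⟨b, hb, e'⟩ := hk'.exists_cell (i := i - 1) (by omega) (by omega) h5 h6
    have e1 := congrArg Prod.fst e
    have e2 := congrArg Prod.snd e
    have e3 := congrArg Prod.snd e'
    simp only [cellIndex] at e1 e2 e3
    exact ⟨i - 1, by omega, a, ha, b, hb, e, e', by omega, by omega⟩

/-- Every edge of a framed graph that is not at the cone vertex is a base edge or belongs to a
cell. -/
theorem IsFramed.adj_cases (hT : Λ.IsFramed T) {k k' : ℕ × ℕ} (hk : Λ.Used k) (hk' : Λ.Used k')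
    (hadj : T.Adj (Λ.pos k) (Λ.pos k')) : Λ.baseGraph.Adj (Λ.pos k) (Λ.pos k') ∨
    ∃ c : Fin w × Fin h, (Λ.cellPart T c.1 c.2 \ southWestGraph (cellAt Λ.pos c.1 c.2)).Adj
      (Λ.pos k) (Λ.pos k') := by
  -- an edge within a cell that is not a chord of the west or south side
  have own : ∀ i < w, ∀ j < h, ∀ a ∈ Λ.present i j, ∀ b ∈ Λ.present i j, k = cellIndex i j a →
      k' = cellIndex i j b → (0 < a.offset.1 ∨ 0 < b.offset.1) → (0 < a.offset.2 ∨ 0 < b.offset.2) →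
      ∃ c : Fin w × Fin h, (Λ.cellPart T c.1 c.2 \ southWestGraph (cellAt Λ.pos c.1 c.2)).Adj
        (Λ.pos k) (Λ.pos k') := by
    rintro i hi j hj a ha b hb rfl rfl h1 h2
    refine ⟨(⟨i, hi⟩, ⟨j, hj⟩), ⟨hadj, ⟨a, ha, rfl⟩, ⟨b, hb, rfl⟩,
      hT.segment_subset hi hj ha hb hadj h1 h2⟩, fun hsw => ?_⟩
    obtain ⟨a', b', p1, p2, p3, p4, e1, e2, hm⟩ := southWestGraph_adj hsw
    obtain rfl := pos_cell_injective hi hj ha (Λ.mem_present i j _ p1 p2) e1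
    obtain rfl := pos_cell_injective hi hj hb (Λ.mem_present i j _ p3 p4) e2
    rcases hm with hm | hm
    · have := (CellVertex.southWestEdges_same_side _ hm).2.2.2.2.2
      dsimp only at this
      omega
    · have := (CellVertex.southWestEdges_same_side _ hm).2.2.2.2.2
      dsimp only at this
      omega
  obtain ⟨i, hi, j, hj, a, ha, b, hb, e, e'⟩ := hT.exists_cell hk hk' hadj
  have o1 := a.offset_fst_le
  have o2 := a.offset_snd_le
  have o3 := b.offset_fst_le
  have o4 := b.offset_snd_le
  -- A pair along the west side is passed on to the cell to the west, and a pair along the south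
  -- side to the cell to the south, unless it is a base edge. Other pairs stay in the cell.
  by_cases hw : a.offset.1 = 0 ∧ b.offset.1 = 0
  · rcases hT.path_cases hk hk' hadj (i := i) hj hi.le (by rw [e]; simp [cellIndex, hw.1])
      (by rw [e']; simp [cellIndex, hw.2]) (by rw [e]; simp [cellIndex])
      (by rw [e]; simp only [cellIndex]; omega) (by rw [e']; simp [cellIndex])
      (by rw [e']; simp only [cellIndex]; omega) with
      ⟨n, hn, ⟨rfl, rfl⟩ | ⟨rfl, rfl⟩⟩ | ⟨i', hi', a', ha', b', hb', e1, e2, h1, h2⟩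
    · exact Or.inl ⟨hadj.ne, Or.inl (Or.inr (Or.inl ⟨n, hn, rfl, rfl⟩))⟩
    · exact Or.inl ⟨hadj.ne, Or.inr (Or.inr (Or.inl ⟨n, hn, rfl, rfl⟩))⟩
    · exact Or.inr (own i' hi' j hj a' ha' b' hb' e1 e2 (Or.inl h1) h2)
  by_cases hs : a.offset.2 = 0 ∧ b.offset.2 = 0
  · rcases hT.transpose.path_cases (used_transpose.2 hk) (used_transpose.2 hk')
      (k := k.swap) (k' := k'.swap) hadj (i := j) hi hj.le (by rw [e]; simp [cellIndex, hs.1])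
      (by rw [e']; simp [cellIndex, hs.2]) (by rw [e]; simp [cellIndex])
      (by rw [e]; simp only [cellIndex, Prod.snd_swap]; omega) (by rw [e']; simp [cellIndex])
      (by rw [e']; simp only [cellIndex, Prod.snd_swap]; omega) with
      ⟨n, hn, ⟨e1, e2⟩ | ⟨e1, e2⟩⟩ | ⟨j', hj', a', ha', b', hb', e1, e2, h1, h2⟩
    · obtain rfl : k = (n + 1, 0) := Prod.swap_injective e1
      obtain rfl : k' = (n, 0) := Prod.swap_injective e2
      exact Or.inl ⟨hadj.ne, Or.inl (Or.inr (Or.inr ⟨n, hn, rfl, rfl⟩))⟩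
    · obtain rfl : k' = (n + 1, 0) := Prod.swap_injective e1
      obtain rfl : k = (n, 0) := Prod.swap_injective e2
      exact Or.inl ⟨hadj.ne, Or.inr (Or.inr (Or.inr ⟨n, hn, rfl, rfl⟩))⟩
    · obtain ⟨a', ha'', rfl⟩ := Finset.mem_image.1 ha'
      obtain ⟨b', hb'', rfl⟩ := Finset.mem_image.1 hb'
      rw [cellIndex_swap] at e1 e2
      rw [CellVertex.offset_swap] at h1 h2
      rw [CellVertex.offset_swap] at h2
      exact Or.inr (own i hi j' hj' a' ha'' b' hb'' (Prod.swap_injective e1)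
        (Prod.swap_injective e2) h2 (Or.inl h1))
  exact Or.inr (own i hi j hj a ha b hb e e' (by omega) (by omega))

end Layout

/-! ### Degrees and edge numbers of graphs drawn in a cell -/

/-- The graph with the given edges between cell vertices, drawn at the positions `f`. -/
def drawn (f : CellVertex → Plane) (E : Set (Sym2 CellVertex)) : SimpleGraph Plane :=
  SimpleGraph.fromRel fun x y => ∃ a b, s(a, b) ∈ E ∧ f a = x ∧ f b = y

/-- The edges of the west and south sides of a cell. -/
def southWestSet : Set (Sym2 CellVertex) := {e | ∃ p ∈ CellVertex.southWestEdges, e = s(p.1, p.2)}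

theorem drawn_southWestSet (f : CellVertex → Plane) : drawn f southWestSet = southWestGraph f := by
  have key : ∀ x y, (∃ a b, s(a, b) ∈ southWestSet ∧ f a = x ∧ f b = y) ↔
      ((∃ e ∈ CellVertex.southWestEdges, f e.1 = x ∧ f e.2 = y) ∨
      ∃ e ∈ CellVertex.southWestEdges, f e.1 = y ∧ f e.2 = x) := by
    intro x y
    constructor
    · rintro ⟨a, b, ⟨e, he, hab⟩, rfl, rfl⟩
      rcases Sym2.eq_iff.1 hab with ⟨rfl, rfl⟩ | ⟨rfl, rfl⟩
      · exact Or.inl ⟨e, he, rfl, rfl⟩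
      · exact Or.inr ⟨e, he, rfl, rfl⟩
    · rintro (⟨e, he, rfl, rfl⟩ | ⟨e, he, rfl, rfl⟩)
      · exact ⟨e.1, e.2, ⟨e, he, rfl⟩, rfl, rfl⟩
      · exact ⟨e.2, e.1, ⟨e, he, Sym2.eq_swap⟩, rfl, rfl⟩
  ext x y
  simp only [drawn, southWestGraph, SimpleGraph.fromRel_adj, key]
  exact and_congr_right fun _ => ⟨fun H => H.elim id Or.symm, Or.inl⟩

theorem ncard_southWestSet_le : southWestSet.ncard ≤ 8 := by
  classical
  have : southWestSet ⊆ ((CellVertex.southWestEdges.toFinset.image fun p => s(p.1, p.2)) :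
      Finset (Sym2 CellVertex)) := by
    rintro e ⟨p, hp, rfl⟩
    simp only [Finset.coe_image, Set.mem_image, Finset.mem_coe, List.mem_toFinset]
    exact ⟨p, hp, rfl⟩
  refine (Set.ncard_le_ncard this).trans ?_
  rw [Set.ncard_coe_finset]
  exact Finset.card_image_le.trans (List.toFinset_card_le _)

namespace CellVertex

theorem toward_total : ∀ (d : Dir) (a b : CellVertex), a ≠ b → Toward d a b ∨ Toward d b a := by
  intro d; cases d <;> decide

theorem toward_asymm (d : Dir) {a b : CellVertex} (h : Toward d a b) : ¬ Toward d b a := by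
  cases d <;> exact lt_asymm h

/-- Every edge goes in a given direction from exactly one of its ends. -/
theorem sum_ncard_toward (E : Set (Sym2 CellVertex)) (hloop : ∀ a, s(a, a) ∉ E) (d : Dir) :
    ∑ a, {b | s(a, b) ∈ E ∧ Toward d a b}.ncard = E.ncard := by
  classical
  have h1 : ∀ a, {b | s(a, b) ∈ E ∧ Toward d a b}.ncard =
      (Finset.univ.filter fun b => s(a, b) ∈ E ∧ Toward d a b).card := by
    intro a
    rw [← Set.ncard_coe_finset]
    simp
  rw [Finset.sum_congr rfl fun a _ => h1 a, ← Finset.card_sigma, ← Set.ncard_coe_finset]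
  refine Set.ncard_congr (fun p _ => s(p.1, p.2)) ?_ ?_ ?_
  · rintro ⟨a, b⟩ hp
    simp only [Finset.mem_coe, Finset.mem_sigma, Finset.mem_univ, Finset.mem_filter, true_and] at hp
    exact hp.1
  · rintro ⟨a, b⟩ ⟨a', b'⟩ hp hp' e
    simp only [Finset.mem_coe, Finset.mem_sigma, Finset.mem_univ, Finset.mem_filter, true_and] at hp hp'
    rcases Sym2.eq_iff.1 e with ⟨h, h'⟩ | ⟨h, h'⟩
    · dsimp only at h h'
      subst h h'
      rfl
    · dsimp only at h h'
      subst h h'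
      exact absurd hp.2 (toward_asymm d hp'.2)
  · intro e he
    induction e using Sym2.inductionOn with
    | hf a b =>
      have hne : a ≠ b := by
        rintro rfl
        exact hloop a he
      rcases toward_total d a b hne with h | h
      · exact ⟨⟨a, b⟩, by simpa using ⟨he, h⟩, rfl⟩
      · exact ⟨⟨b, a⟩, by
          simp only [Finset.mem_coe, Finset.mem_sigma, Finset.mem_univ, Finset.mem_filter, true_and]
          exact ⟨by rwa [Sym2.eq_swap], h⟩, Sym2.eq_swap⟩

end CellVertex

namespace Layout

variable {w h : ℕ} {Λ : Layout w h} {T : SimpleGraph Plane}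

theorem toward_iff {i j : ℕ} (hi : i < w) (hj : j < h) {a b : CellVertex} (ha : a ∈ Λ.present i j)
    (hb : b ∈ Λ.present i j) (d : Dir) :
    Toward d (Λ.pos (cellIndex i j a)) (Λ.pos (cellIndex i j b)) ↔ CellVertex.Toward d a b := by
  have key : ∀ d, ∀ a ∈ Λ.present i j, ∀ b ∈ Λ.present i j, CellVertex.Toward d a b →
      Toward d (Λ.pos (cellIndex i j a)) (Λ.pos (cellIndex i j b)) := by
    intro d a ha b hb hab
    cases d
    · exact Λ.y_order i hi j hj a ha b hb hab
    · exact Λ.y_order i hi j hj b hb a ha hab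
    · exact Λ.x_order i hi j hj a ha b hb hab
    · exact Λ.x_order i hi j hj b hb a ha hab
  refine ⟨fun hab => ?_, key d a ha b hb⟩
  by_contra hn
  by_cases e : a = b
  · subst e
    cases d <;> exact lt_irrefl _ hab
  · have h2 := key d b hb a ha ((CellVertex.toward_total d a b e).resolve_left hn)
    cases d <;> exact lt_asymm hab h2

variable {E : Set (Sym2 CellVertex)} {i j : ℕ}

theorem drawn_adj (hi : i < w) (hj : j < h)
    (hE : ∀ a b, s(a, b) ∈ E → a ∈ Λ.present i j ∧ b ∈ Λ.present i j) (hloop : ∀ a, s(a, a) ∉ E)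
    {x y : Plane} : (drawn (cellAt Λ.pos i j) E).Adj x y ↔
      ∃ a b, s(a, b) ∈ E ∧ x = Λ.pos (cellIndex i j a) ∧ y = Λ.pos (cellIndex i j b) := by
  constructor
  · rintro ⟨-, ⟨a, b, hab, rfl, rfl⟩ | ⟨a, b, hab, rfl, rfl⟩⟩
    · exact ⟨a, b, hab, rfl, rfl⟩
    · exact ⟨b, a, by rwa [Sym2.eq_swap], rfl, rfl⟩
  · rintro ⟨a, b, hab, rfl, rfl⟩
    refine ⟨fun e => ?_, Or.inl ⟨a, b, hab, rfl, rfl⟩⟩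
    obtain rfl := pos_cell_injective hi hj (hE a b hab).1 (hE a b hab).2 e
    exact hloop a hab

theorem drawn_adj_pos (hi : i < w) (hj : j < h)
    (hE : ∀ a b, s(a, b) ∈ E → a ∈ Λ.present i j ∧ b ∈ Λ.present i j) (hloop : ∀ a, s(a, a) ∉ E)
    {a b : CellVertex} (ha : a ∈ Λ.present i j) (hb : b ∈ Λ.present i j) :
    (drawn (cellAt Λ.pos i j) E).Adj (Λ.pos (cellIndex i j a)) (Λ.pos (cellIndex i j b)) ↔
      s(a, b) ∈ E := by
  rw [drawn_adj hi hj hE hloop]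
  constructor
  · rintro ⟨a', b', hab, e1, e2⟩
    obtain rfl := pos_cell_injective hi hj ha (hE a' b' hab).1 e1
    obtain rfl := pos_cell_injective hi hj hb (hE a b' hab).2 e2
    exact hab
  · exact fun hab => ⟨a, b, hab, rfl, rfl⟩

/-- Cardinal degrees in a drawn graph are determined by the order of the cell vertices. -/
theorem cardinalDegree_drawn (hi : i < w) (hj : j < h)
    (hE : ∀ a b, s(a, b) ∈ E → a ∈ Λ.present i j ∧ b ∈ Λ.present i j) (hloop : ∀ a, s(a, a) ∉ E)
    {a : CellVertex} (ha : a ∈ Λ.present i j) (d : Dir) :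
    cardinalDegree (drawn (cellAt Λ.pos i j) E) d (Λ.pos (cellIndex i j a)) =
      {b | s(a, b) ∈ E ∧ CellVertex.Toward d a b}.ncard := by
  symm
  refine Set.ncard_congr (fun b _ => Λ.pos (cellIndex i j b)) ?_ ?_ ?_
  · intro b hb
    have hbp := (hE a b hb.1).2
    exact ⟨(drawn_adj_pos hi hj hE hloop ha hbp).2 hb.1, (toward_iff hi hj ha hbp d).2 hb.2⟩
  · intro b b' hb hb' e
    exact pos_cell_injective hi hj (hE a b hb.1).2 (hE a b' hb'.1).2 e
  · rintro u ⟨hu, hd⟩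
    obtain ⟨a', b, hab, e, rfl⟩ := (drawn_adj hi hj hE hloop).1 hu
    obtain rfl := pos_cell_injective hi hj ha (hE a' b hab).1 e
    exact ⟨b, ⟨hab, (toward_iff hi hj ha (hE a b hab).2 d).1 hd⟩, rfl⟩

theorem cardinalDegree_drawn_eq_zero (hi : i < w) (hj : j < h)
    (hE : ∀ a b, s(a, b) ∈ E → a ∈ Λ.present i j ∧ b ∈ Λ.present i j) (hloop : ∀ a, s(a, a) ∉ E)
    {v : Plane} (hv : ∀ a ∈ Λ.present i j, v ≠ Λ.pos (cellIndex i j a)) (d : Dir) :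
    cardinalDegree (drawn (cellAt Λ.pos i j) E) d v = 0 := by
  have : {u | (drawn (cellAt Λ.pos i j) E).Adj v u ∧ Toward d v u} = ∅ := by
    refine Set.eq_empty_of_forall_notMem fun u hu => ?_
    obtain ⟨a, b, hab, e, -⟩ := (drawn_adj hi hj hE hloop).1 hu.1
    exact hv a (hE a b hab).1 e
  rw [cardinalDegree, this, Set.ncard_empty]

/-- Each edge is seen in the given direction from exactly one of its ends. Crossings do not matter,
so this also applies to the light graph of a critical tile. -/
theorem sum_cardinalDegree_drawn (hi : i < w) (hj : j < h)
    (hE : ∀ a b, s(a, b) ∈ E → a ∈ Λ.present i j ∧ b ∈ Λ.present i j) (hloop : ∀ a, s(a, a) ∉ E)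
    {W : Finset Plane} (hW : ∀ a ∈ Λ.present i j, Λ.pos (cellIndex i j a) ∈ W) (d : Dir) :
    ∑ v ∈ W, cardinalDegree (drawn (cellAt Λ.pos i j) E) d v = E.ncard := by
  classical
  rw [← CellVertex.sum_ncard_toward E hloop d,
    ← Finset.sum_subset (Finset.subset_univ (Λ.present i j))]
  · rw [← Finset.sum_subset (s₁ := (Λ.present i j).image fun a => Λ.pos (cellIndex i j a))]
    · rw [Finset.sum_image fun a ha b hb e => pos_cell_injective hi hj ha hb e]
      exact Finset.sum_congr rfl fun a ha => cardinalDegree_drawn hi hj hE hloop ha d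
    · intro z hz
      obtain ⟨a, ha, rfl⟩ := Finset.mem_image.1 hz
      exact hW a ha
    · intro v _ hv
      exact cardinalDegree_drawn_eq_zero hi hj hE hloop
        (fun a ha e => hv (Finset.mem_image.2 ⟨a, ha, e.symm⟩)) d
  · intro a _ ha
    rw [Set.ncard_eq_zero]
    exact Set.eq_empty_of_forall_notMem fun b hb => ha (hE a b hb.1).1

theorem southWestSet_present {a b : CellVertex} (hab : s(a, b) ∈ southWestSet) :
    a ∈ Λ.present i j ∧ b ∈ Λ.present i j := by
  obtain ⟨e, he, h'⟩ := hab
  obtain ⟨h1, h2, h3, h4, -⟩ := CellVertex.southWestEdges_same_side e he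
  rcases Sym2.eq_iff.1 h' with ⟨rfl, rfl⟩ | ⟨rfl, rfl⟩
  · exact ⟨Λ.mem_present _ _ _ h1 h2, Λ.mem_present _ _ _ h3 h4⟩
  · exact ⟨Λ.mem_present _ _ _ h3 h4, Λ.mem_present _ _ _ h1 h2⟩

theorem southWestSet_loop (a : CellVertex) : s(a, a) ∉ southWestSet := by
  rintro ⟨e, he, h'⟩
  have h5 := (CellVertex.southWestEdges_same_side e he).2.2.2.2.1
  rcases Sym2.eq_iff.1 h' with ⟨rfl, h''⟩ | ⟨rfl, h''⟩
  · exact h5 h''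
  · exact h5 h''.symm

/-- Edge sets of graphs in the cells with as many edges as triangulations of the cells, and a graph
whose cardinal degrees are those of the union of these graphs and the base graph. -/
structure IsModel (Λ : Layout w h) (E : Fin w × Fin h → Set (Sym2 CellVertex))
    (T : SimpleGraph Plane) : Prop where
  psl : IsPSLGraph Λ.verts T
  present : ∀ c a b, s(a, b) ∈ E c → a ∈ Λ.present c.1 c.2 ∧ b ∈ Λ.present c.1 c.2
  loop : ∀ c a, s(a, a) ∉ E c
  southWest : ∀ c, southWestSet ⊆ E c
  ncard : ∀ c, (E c).ncard = 8 + 3 * (Λ.own c.1 c.2).card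
  degree : ∀ d, ∀ v ∈ Λ.verts, cardinalDegree T d v +
    ∑ c : Fin w × Fin h, cardinalDegree (southWestGraph (cellAt Λ.pos c.1 c.2)) d v =
    cardinalDegree Λ.baseGraph d v +
      ∑ c : Fin w × Fin h, cardinalDegree (drawn (cellAt Λ.pos c.1 c.2) (E c)) d v

variable {E : Fin w × Fin h → Set (Sym2 CellVertex)}

theorem IsModel.southWest_le (hM : Λ.IsModel E T) (c : Fin w × Fin h) (d : Dir) (v : Plane) :
    cardinalDegree (southWestGraph (cellAt Λ.pos c.1 c.2)) d v ≤
      cardinalDegree (drawn (cellAt Λ.pos c.1 c.2) (E c)) d v := by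
  rw [← drawn_southWestSet]
  refine cardinalDegree_mono (V := Λ.verts) ?_ ?_ d v
  · intro x y hxy
    obtain ⟨a, b, hab, rfl, rfl⟩ := (drawn_adj c.1.2 c.2.2 (hM.present c) (hM.loop c)).1 hxy
    exact ⟨(used_of_cell c.1.2 c.2.2 (hM.present c a b hab).1).mem,
      (used_of_cell c.1.2 c.2.2 (hM.present c a b hab).2).mem⟩
  · rintro x y ⟨hne, ⟨a, b, hab, e⟩ | ⟨a, b, hab, e⟩⟩
    · exact ⟨hne, Or.inl ⟨a, b, hM.southWest c hab, e⟩⟩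
    · exact ⟨hne, Or.inr ⟨a, b, hM.southWest c hab, e⟩⟩

/-- The subtracted sides are contained in the graphs of the cells, so what is added to the base
graph is nonnegative. -/
theorem IsModel.base_le (hM : Λ.IsModel E T) (d : Dir) {v : Plane} (hv : v ∈ Λ.verts) :
    cardinalDegree Λ.baseGraph d v ≤ cardinalDegree T d v := by
  have h1 := hM.degree d v hv
  have h2 := Finset.sum_le_sum fun c (_ : c ∈ (Finset.univ : Finset (Fin w × Fin h))) =>
    hM.southWest_le c d v
  omega

/-- The total degree in one direction within a set of vertices that contains the given cells. -/
theorem IsModel.sum_degree (hM : Λ.IsModel E T) (d : Dir) {W : Finset Plane} (hW : W ⊆ Λ.verts)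
    (C : Finset (Fin w × Fin h))
    (hC : ∀ c ∈ C, ∀ a ∈ Λ.present c.1 c.2, Λ.pos (cellIndex c.1 c.2 a) ∈ W) :
    ∑ v ∈ W, cardinalDegree Λ.baseGraph d v + 3 * ∑ c ∈ C, (Λ.own c.1 c.2).card ≤
      ∑ v ∈ W, cardinalDegree T d v := by
  have h1 : ∑ v ∈ W, cardinalDegree T d v + ∑ c : Fin w × Fin h,
      ∑ v ∈ W, cardinalDegree (southWestGraph (cellAt Λ.pos c.1 c.2)) d v =
      ∑ v ∈ W, cardinalDegree Λ.baseGraph d v + ∑ c : Fin w × Fin h,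
        ∑ v ∈ W, cardinalDegree (drawn (cellAt Λ.pos c.1 c.2) (E c)) d v := by
    rw [Finset.sum_comm, ← Finset.sum_add_distrib, Finset.sum_comm (t := W),
      ← Finset.sum_add_distrib]
    exact Finset.sum_congr rfl fun v hv => hM.degree d v (hW hv)
  -- A cell of `C` has all its vertices in `W`, so it contributes its full edge number beyond the
  -- eight edges of its west and south sides. The other cells contribute a nonnegative difference.
  have h2 : ∑ c : Fin w × Fin h,
      ∑ v ∈ W, cardinalDegree (southWestGraph (cellAt Λ.pos c.1 c.2)) d v +
      3 * ∑ c ∈ C, (Λ.own c.1 c.2).card ≤ ∑ c : Fin w × Fin h,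
        ∑ v ∈ W, cardinalDegree (drawn (cellAt Λ.pos c.1 c.2) (E c)) d v := by
    classical
    rw [← Finset.sum_sdiff (Finset.subset_univ C), ← Finset.sum_sdiff (Finset.subset_univ C)
      (f := fun c => ∑ v ∈ W, cardinalDegree (drawn (cellAt Λ.pos c.1 c.2) (E c)) d v),
      add_assoc, Finset.mul_sum, ← Finset.sum_add_distrib]
    refine add_le_add (Finset.sum_le_sum fun c _ => Finset.sum_le_sum fun v _ =>
      hM.southWest_le c d v) (Finset.sum_le_sum fun c hc => ?_)
    rw [sum_cardinalDegree_drawn c.1.2 c.2.2 (hM.present c) (hM.loop c) (hC c hc), hM.ncard,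
      ← drawn_southWestSet, sum_cardinalDegree_drawn c.1.2 c.2.2
        (fun _ _ => southWestSet_present) southWestSet_loop (hC c hc)]
    exact Nat.add_le_add_right ncard_southWestSet_le _
  omega

end Layout

/-! ### Every realization contains the frame -/

theorem cardinalDegree_swapGraph_west (G : SimpleGraph Plane) (v : Plane) :
    cardinalDegree (swapGraph G) .west v = cardinalDegree G .south v.swap := by
  refine Set.ncard_congr (fun u _ => u.swap) (fun u hu => hu)
    (fun u u' _ _ e => Prod.swap_injective e) fun u hu => ⟨u.swap, ?_, Prod.swap_swap u⟩
  exact ⟨by simpa [swapGraph] using hu.1, hu.2⟩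

theorem sum_prod_filter_fst_lt {w h i : ℕ} (hi : i ≤ w) (f : ℕ → ℕ → ℕ) :
    ∑ c ∈ (Finset.univ : Finset (Fin w × Fin h)).filter (fun c => (c.1 : ℕ) < i), f c.1 c.2 =
      ∑ i' ∈ Finset.range i, ∑ j ∈ Finset.range h, f i' j := by
  rw [Finset.sum_filter, Fintype.sum_prod_type]
  have h1 : ∀ x : Fin w, ∑ y : Fin h, (if (x : ℕ) < i then f x y else 0) =
      if (x : ℕ) < i then ∑ j ∈ Finset.range h, f x j else 0 := by
    intro x
    split_ifs
    · exact Fin.sum_univ_eq_sum_range (fun y => f x y) h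
    · simp
  rw [Finset.sum_congr rfl fun x _ => h1 x, Fin.sum_univ_eq_sum_range
    (fun x => if x < i then ∑ j ∈ Finset.range h, f x j else 0) w, ← Finset.sum_filter]
  congr 1
  ext x
  simp only [Finset.mem_filter, Finset.mem_range]
  omega

theorem sum_prod_filter_snd_lt {w h j : ℕ} (hj : j ≤ h) (f : ℕ → ℕ → ℕ) :
    ∑ c ∈ (Finset.univ : Finset (Fin w × Fin h)).filter (fun c => (c.2 : ℕ) < j), f c.1 c.2 =
      ∑ j' ∈ Finset.range j, ∑ i ∈ Finset.range w, f i j' := by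
  rw [← sum_prod_filter_fst_lt hj (fun j i => f i j)]
  exact Finset.sum_equiv (Equiv.prodComm _ _) (by simp) (by simp)

namespace Layout

variable {w h : ℕ} {Λ : Layout w h} {T : SimpleGraph Plane} {E : Fin w × Fin h → Set (Sym2 CellVertex)}

theorem baseGraph_mem {x y : Plane} (hxy : Λ.baseGraph.Adj x y) : x ∈ Λ.verts ∧ y ∈ Λ.verts := by
  have hp : ∀ n ≤ 4 * h, Λ.pos (0, n) ∈ Λ.verts := fun n hn =>
    (used_path (i := 0) (Nat.zero_le _) hn).mem
  have hr : ∀ m ≤ 4 * w, Λ.pos (m, 0) ∈ Λ.verts := fun m hm =>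
    (used_row (j := 0) (Nat.zero_le _) hm).mem
  have key : ∀ x y, ((x = Λ.cone ∧ ((∃ n ≤ 4 * h, y = Λ.pos (0, n)) ∨ ∃ m ≤ 4 * w, y = Λ.pos (m, 0))) ∨
      (∃ n < 4 * h, x = Λ.pos (0, n + 1) ∧ y = Λ.pos (0, n)) ∨
      (∃ m < 4 * w, x = Λ.pos (m + 1, 0) ∧ y = Λ.pos (m, 0))) → x ∈ Λ.verts ∧ y ∈ Λ.verts := by
    rintro x y (⟨rfl, ⟨n, hn, rfl⟩ | ⟨m, hm, rfl⟩⟩ | ⟨n, hn, rfl, rfl⟩ | ⟨m, hm, rfl, rfl⟩)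
    · exact ⟨cone_mem, hp n hn⟩
    · exact ⟨cone_mem, hr m hm⟩
    · exact ⟨hp _ hn, hp _ hn.le⟩
    · exact ⟨hr _ hm, hr _ hm.le⟩
  rcases hxy.2 with h' | h'
  · exact key x y h'
  · exact (key y x h').symm

theorem baseGraph_west_finite (v : Plane) :
    {u | Λ.baseGraph.Adj v u ∧ Toward .west v u}.Finite :=
  Λ.verts.finite_toSet.subset fun _ hu => (baseGraph_mem hu.1).2

theorem two_le_base_path {n : ℕ} (hn : n < 4 * h) :
    2 ≤ cardinalDegree Λ.baseGraph .west (Λ.pos (0, n)) := by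
  have u1 := used_path (Λ := Λ) (i := 0) (Nat.zero_le _) hn.le
  have u2 := used_path (Λ := Λ) (i := 0) (Nat.zero_le _) (n := n + 1) hn
  have hs := path_step (Λ := Λ) (i := 0) (Nat.zero_le _) hn
  have hsub : {Λ.cone, Λ.pos (0, n + 1)} ⊆
      {u | Λ.baseGraph.Adj (Λ.pos (0, n)) u ∧ Toward .west (Λ.pos (0, n)) u} := by
    rintro u (rfl | rfl)
    · exact ⟨⟨pos_ne_cone u1, Or.inr (Or.inl ⟨rfl, Or.inl ⟨n, hn.le, rfl⟩⟩)⟩, (cone_lt u1).1⟩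
    · exact ⟨⟨fun e => hs.1.ne' (congrArg Prod.fst e), Or.inr (Or.inr (Or.inl ⟨n, hn, rfl, rfl⟩))⟩, hs.1⟩
  have := Set.ncard_le_ncard hsub (baseGraph_west_finite _)
  rwa [Set.ncard_pair (pos_ne_cone u2).symm] at this

theorem one_le_base_path_end : 1 ≤ cardinalDegree Λ.baseGraph .west (Λ.pos (0, 4 * h)) := by
  have u1 := used_path (Λ := Λ) (i := 0) (Nat.zero_le _) (le_refl (4 * h))
  refine (Set.ncard_pos (baseGraph_west_finite _)).2 ⟨Λ.cone, ?_⟩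
  exact ⟨⟨pos_ne_cone u1, Or.inr (Or.inl ⟨rfl, Or.inl ⟨_, le_rfl, rfl⟩⟩)⟩, (cone_lt u1).1⟩

theorem two_le_base_row {m : ℕ} (hm : m < 4 * w) :
    2 ≤ cardinalDegree Λ.baseGraph .west (Λ.pos (m + 1, 0)) := by
  have u1 := used_row (Λ := Λ) (j := 0) (Nat.zero_le _) (m := m + 1) hm
  have u2 := used_row (Λ := Λ) (j := 0) (Nat.zero_le _) hm.le
  have hs := row_lt (Λ := Λ) (j := 0) (Nat.zero_le _) (Nat.lt_succ_self m) hm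
  have hsub : {Λ.cone, Λ.pos (m, 0)} ⊆
      {u | Λ.baseGraph.Adj (Λ.pos (m + 1, 0)) u ∧ Toward .west (Λ.pos (m + 1, 0)) u} := by
    rintro u (rfl | rfl)
    · exact ⟨⟨pos_ne_cone u1, Or.inr (Or.inl ⟨rfl, Or.inr ⟨m + 1, hm, rfl⟩⟩)⟩, (cone_lt u1).1⟩
    · exact ⟨⟨fun e => hs.1.ne' (congrArg Prod.fst e), Or.inl (Or.inr (Or.inr ⟨m, hm, rfl, rfl⟩))⟩, hs.1⟩
  have := Set.ncard_le_ncard hsub (baseGraph_west_finite _)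
  rwa [Set.ncard_pair (pos_ne_cone u2).symm] at this

/-- Each vertex of the first path has the cone vertex and the next path vertex to its west, the top
one only the cone vertex. Each of the `4 i` bottom row vertices after the corner has the cone vertex
and its predecessor to its west. -/
theorem base_westPart_ge {i : ℕ} (hi : i ≤ w) :
    8 * h + 8 * i + 1 ≤ ∑ v ∈ Λ.westPart i, cardinalDegree Λ.baseGraph .west v := by
  classical
  have hp : ∀ n ≤ 4 * h, Λ.Used (0, n) := fun n hn => used_path (i := 0) (Nat.zero_le _) hn
  have hr : ∀ m ≤ 4 * w, Λ.Used (m, 0) := fun m hm => used_row (j := 0) (Nat.zero_le _) hm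
  have hmem : ∀ k, Λ.Used k → k.1 ≤ 4 * i → Λ.pos k ∈ Λ.westPart i := fun k hk hle =>
    Finset.mem_filter.2 ⟨hk.mem, (hk.fst_le_iff hi).2 hle⟩
  let A : Finset Plane := (Finset.range (4 * h)).image fun n => Λ.pos (0, n)
  let B : Finset Plane := (Finset.range (4 * i)).image fun m => Λ.pos (m + 1, 0)
  have hA : A.card = 4 * h := by
    rw [Finset.card_image_of_injOn, Finset.card_range]
    intro n hn n' hn' e
    rw [Finset.mem_coe, Finset.mem_range] at hn hn'
    exact congrArg Prod.snd (pos_injOn (hp n hn.le) (hp n' hn'.le) e)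
  have hB : B.card = 4 * i := by
    rw [Finset.card_image_of_injOn, Finset.card_range]
    intro m hm m' hm' e
    rw [Finset.mem_coe, Finset.mem_range] at hm hm'
    exact Nat.succ_injective
      (congrArg Prod.fst (pos_injOn (hr (m + 1) (by omega)) (hr (m' + 1) (by omega)) e))
  have hAB : Disjoint A B := by
    refine Finset.disjoint_left.2 fun z hz hz' => ?_
    obtain ⟨n, hn, rfl⟩ := Finset.mem_image.1 hz
    obtain ⟨m, hm, e⟩ := Finset.mem_image.1 hz'
    rw [Finset.mem_range] at hn hm
    exact absurd (congrArg Prod.fst (pos_injOn (hr (m + 1) (by omega)) (hp n hn.le) e)) (by simp)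
  have hend : Λ.pos (0, 4 * h) ∉ A ∪ B := by
    intro hz
    rcases Finset.mem_union.1 hz with hz | hz
    · obtain ⟨n, hn, e⟩ := Finset.mem_image.1 hz
      rw [Finset.mem_range] at hn
      have := congrArg Prod.snd (pos_injOn (hp n hn.le) (hp _ le_rfl) e)
      dsimp only at this
      omega
    · obtain ⟨m, hm, e⟩ := Finset.mem_image.1 hz
      rw [Finset.mem_range] at hm
      exact absurd (congrArg Prod.fst (pos_injOn (hr (m + 1) (by omega)) (hp _ le_rfl) e)) (by simp)
  have hsub : insert (Λ.pos (0, 4 * h)) (A ∪ B) ⊆ Λ.westPart i := by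
    intro z hz
    rcases Finset.mem_insert.1 hz with rfl | hz
    · exact hmem _ (hp _ le_rfl) (Nat.zero_le _)
    rcases Finset.mem_union.1 hz with hz | hz
    · obtain ⟨n, hn, rfl⟩ := Finset.mem_image.1 hz
      rw [Finset.mem_range] at hn
      exact hmem _ (hp _ hn.le) (Nat.zero_le _)
    · obtain ⟨m, hm, rfl⟩ := Finset.mem_image.1 hz
      rw [Finset.mem_range] at hm
      exact hmem _ (hr _ (by omega)) hm
  refine le_trans ?_ (Finset.sum_le_sum_of_subset hsub)
  rw [Finset.sum_insert hend, Finset.sum_union hAB]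
  have h1 : A.card • 2 ≤ ∑ v ∈ A, cardinalDegree Λ.baseGraph .west v :=
    Finset.card_nsmul_le_sum _ _ _ fun z hz => by
      obtain ⟨n, hn, rfl⟩ := Finset.mem_image.1 hz
      exact two_le_base_path (Finset.mem_range.1 hn)
  have h2 : B.card • 2 ≤ ∑ v ∈ B, cardinalDegree Λ.baseGraph .west v :=
    Finset.card_nsmul_le_sum _ _ _ fun z hz => by
      obtain ⟨m, hm, rfl⟩ := Finset.mem_image.1 hz
      rw [Finset.mem_range] at hm
      exact two_le_base_row (by omega)
  have h3 := one_le_base_path_end (Λ := Λ)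
  rw [hA, smul_eq_mul] at h1
  rw [hB, smul_eq_mul] at h2
  omega

/-- The vertices that are not north of the westmost vertex of a horizontal path. -/
noncomputable def southPart (Λ : Layout w h) (j : ℕ) : Finset Plane :=
  Λ.verts.filter fun z => z.2 ≤ (Λ.pos (0, 4 * j)).2

theorem sum_westPart_transpose (G : SimpleGraph Plane) (j : ℕ) :
    ∑ v ∈ Λ.transpose.westPart j, cardinalDegree (swapGraph G) .west v =
      ∑ v ∈ Λ.southPart j, cardinalDegree G .south v := by
  classical
  have : Λ.transpose.westPart j = (Λ.southPart j).image Prod.swap := by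
    ext z
    simp only [westPart, southPart, Finset.mem_filter, Finset.mem_image]
    constructor
    · rintro ⟨hz, hx⟩
      obtain ⟨z, hz', rfl⟩ := Finset.mem_image.1 hz
      exact ⟨z, ⟨hz', hx⟩, rfl⟩
    · rintro ⟨z, ⟨hz, hx⟩, rfl⟩
      exact ⟨Finset.mem_image_of_mem _ hz, hx⟩
  rw [this, Finset.sum_image fun a _ b _ e => Prod.swap_injective e]
  exact Finset.sum_congr rfl fun v _ => by rw [cardinalDegree_swapGraph_west, Prod.swap_swap]

theorem card_own_transpose (i j : ℕ) : (Λ.transpose.own j i).card = (Λ.own i j).card := by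
  rw [← Finset.card_image_of_injective (Λ.own i j) CellVertex.swap_injective]
  congr 1
  ext a
  simp only [own, Finset.mem_filter, Finset.mem_image]
  constructor
  · rintro ⟨ha, h1⟩
    obtain ⟨a, ha', rfl⟩ := Finset.mem_image.1 ha
    rw [CellVertex.offset_swap] at h1
    exact ⟨a, ⟨ha', h1.symm⟩, rfl⟩
  · rintro ⟨a, ⟨ha, h1⟩, rfl⟩
    rw [CellVertex.offset_swap]
    exact ⟨Finset.mem_image_of_mem _ ha, h1.symm⟩

/-- The base edges and the first `i` columns together supply the edge count that makes the bound for
the west part tight. -/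
theorem IsModel.adj_path (hM : Λ.IsModel E T) {i : ℕ} (hi : i ≤ w) {n : ℕ} (hn : n < 4 * h) :
    T.Adj (Λ.pos (4 * i, n + 1)) (Λ.pos (4 * i, n)) := by
  refine Layout.adj_path hM.psl hi ?_ hn
  have h1 := hM.sum_degree .west (W := Λ.westPart i) (Finset.filter_subset _ _)
    (Finset.univ.filter fun c => (c.1 : ℕ) < i) (by
      intro c hc a ha
      have hu := used_of_cell (Λ := Λ) c.1.2 c.2.2 ha
      have := a.offset_fst_le
      have := (Finset.mem_filter.1 hc).2
      exact Finset.mem_filter.2 ⟨hu.mem, (hu.fst_le_iff hi).2 (by simp only [cellIndex]; omega)⟩)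
  rw [sum_prod_filter_fst_lt hi fun i j => (Λ.own i j).card] at h1
  have := base_westPart_ge (Λ := Λ) hi
  omega

theorem IsModel.adj_row (hM : Λ.IsModel E T) {j : ℕ} (hj : j ≤ h) {m : ℕ} (hm : m < 4 * w) :
    T.Adj (Λ.pos (m + 1, 4 * j)) (Λ.pos (m, 4 * j)) := by
  refine Layout.adj_path (Λ := Λ.transpose) (T := swapGraph T) hM.psl.swap hj ?_ hm
  have h1 := hM.sum_degree .south (W := Λ.southPart j) (Finset.filter_subset _ _)
    (Finset.univ.filter fun c => (c.2 : ℕ) < j) (by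
      intro c hc a ha
      have hu := used_of_cell (Λ := Λ) c.1.2 c.2.2 ha
      have := a.offset_snd_le
      have := (Finset.mem_filter.1 hc).2
      exact Finset.mem_filter.2 ⟨hu.mem, (hu.snd_le_iff hj).2 (by simp only [cellIndex]; omega)⟩)
  rw [sum_prod_filter_snd_lt hj fun i j => (Λ.own i j).card] at h1
  have h2 := base_westPart_ge (Λ := Λ.transpose) hj
  rw [baseGraph_transpose, sum_westPart_transpose] at h2
  rw [sum_westPart_transpose]
  simp only [card_own_transpose]
  omega

/-- A graph with the cardinal degrees of a model contains the frame. -/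
theorem IsModel.isFramed (hM : Λ.IsModel E T) : Λ.IsFramed T where
  psl := hM.psl
  path _ hi _ hn := hM.adj_path hi hn
  row _ hj _ hm := hM.adj_row hj hm
  cone_path n hn := by
    refine adj_cone hM.psl (fun n hn => ?_) ?_ hn
    · exact (two_le_base_path hn).trans
        (hM.base_le _ (used_path (i := 0) (Nat.zero_le _) hn.le).mem)
    · exact one_le_base_path_end.trans
        (hM.base_le _ (used_path (i := 0) (Nat.zero_le _) le_rfl).mem)
  cone_row m hm := by
    have key : ∀ m ≤ 4 * w, cardinalDegree Λ.transpose.baseGraph .west (Λ.transpose.pos (0, m)) ≤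
        cardinalDegree (swapGraph T) .west (Λ.transpose.pos (0, m)) := by
      intro m hm
      rw [baseGraph_transpose, cardinalDegree_swapGraph_west, cardinalDegree_swapGraph_west]
      exact hM.base_le _ (used_row (j := 0) (Nat.zero_le _) hm).mem
    exact adj_cone (Λ := Λ.transpose) (T := swapGraph T) hM.psl.swap
      (fun n hn => (two_le_base_path hn).trans (key n hn.le)) (one_le_base_path_end.trans (key _ le_rfl)) hm

/-- No cell contains the cone vertex, so its north degree in the realization is that in the base
graph. The base graph is contained in the realization and every other vertex is north of the cone
vertex, so there are no further edges. -/
theorem IsModel.adj_base_of_cone (hM : Λ.IsModel E T) {y : Plane} (hy : T.Adj Λ.cone y) :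
    Λ.baseGraph.Adj Λ.cone y := by
  have hT := hM.isFramed
  have h0 := hM.degree .north Λ.cone cone_mem
  rw [Finset.sum_eq_zero, Finset.sum_eq_zero, add_zero, add_zero] at h0
  · have hfin : {u | T.Adj Λ.cone u ∧ Toward .north Λ.cone u}.Finite :=
      Λ.verts.finite_toSet.subset fun u hu => (hT.psl.mem _ _ hu.1).2
    have hsub : {u | Λ.baseGraph.Adj Λ.cone u ∧ Toward .north Λ.cone u} ⊆
        {u | T.Adj Λ.cone u ∧ Toward .north Λ.cone u} := fun u hu => ⟨hT.baseGraph_le hu.1, hu.2⟩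
    have heq := Set.eq_of_subset_of_ncard_le hsub h0.le hfin
    have hmem : y ∈ {u | T.Adj Λ.cone u ∧ Toward .north Λ.cone u} :=
      ⟨hy, (Λ.cone_southWest y (hT.psl.mem _ _ hy).2 hy.ne').2⟩
    rw [← heq] at hmem
    exact hmem.1
  · intro c _
    exact cardinalDegree_drawn_eq_zero c.1.2 c.2.2 (hM.present c) (hM.loop c)
      (fun a ha e => pos_ne_cone (used_of_cell c.1.2 c.2.2 ha) e.symm) _
  · intro c _
    rw [← drawn_southWestSet]
    exact cardinalDegree_drawn_eq_zero c.1.2 c.2.2 (fun _ _ => southWestSet_present)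
      southWestSet_loop (fun a ha e => pos_ne_cone (used_of_cell c.1.2 c.2.2 ha) e.symm) _

end Layout

/-! ### Each cell part is a triangulation -/

namespace CellVertex

/-- The vertices inside the south-west path of a cell. -/
def southWestInner : List CellVertex := [b5, b6, b7, v8, v7, v6, v5]

/-- The vertices inside the north-east path of a cell. -/
def northEastInner : List CellVertex := [v3, v2, v1, v0, b1, b2, b3]

-- Since the south-west path descends eastward, each of its edges is either not below `u` or not
-- west of `u`. In the second case, only `u` itself can be a point of the edge that is not east of
-- `u`.
set_option maxRecDepth 10000 in
theorem southWestEdges_inner : ∀ e ∈ southWestEdges, ∀ u ∈ southWestInner,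
    ((u = e.1 ∨ Toward .north u e.1) ∧ (u = e.2 ∨ Toward .north u e.2)) ∨
      ((u = e.1 ∨ Toward .east u e.1) ∧ Toward .east e.1 e.2) := by decide

set_option maxRecDepth 10000 in
theorem inner_spec : ∀ u, (u ∈ southWestInner ∨ u ∈ northEastInner) →
    u ≠ .p ∧ u ≠ .q ∧ u ≠ .b4 ∧ u ≠ .v4 := by decide

set_option maxRecDepth 10000 in
theorem northEastInner_offset : ∀ u ∈ northEastInner,
    (u.offset.1 = 4 ∧ 0 < u.offset.2) ∨ (u.offset.1 < 4 ∧ u.offset.2 = 4) := by decide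

set_option maxRecDepth 10000 in
theorem toward_east_ends : ∀ a : CellVertex,
    (a = .b4 ∨ Toward .east .b4 a) ∧ (a = .v4 ∨ Toward .east a .v4) := by decide

end CellVertex

namespace Layout

variable {w h : ℕ} {Λ : Layout w h} {T : SimpleGraph Plane}

/-- The points at the vertices of a cell. -/
noncomputable def cellPoints (Λ : Layout w h) (i j : ℕ) : Finset Plane :=
  (Λ.present i j).image (cellAt Λ.pos i j)

theorem mem_cellPoints {i j : ℕ} {z : Plane} :
    z ∈ Λ.cellPoints i j ↔ ∃ a ∈ Λ.present i j, z = Λ.pos (cellIndex i j a) := by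
  rw [cellPoints, Finset.mem_image]
  exact exists_congr fun a => and_congr_right fun _ => eq_comm

theorem cellPoints_subset {i j : ℕ} (hi : i < w) (hj : j < h) : Λ.cellPoints i j ⊆ Λ.verts := by
  intro z hz
  obtain ⟨a, ha, rfl⟩ := mem_cellPoints.1 hz
  exact (used_of_cell hi hj ha).mem

theorem card_cellPoints {i j : ℕ} (hi : i < w) (hj : j < h) :
    (Λ.cellPoints i j).card = (Λ.present i j).card :=
  Finset.card_image_of_injOn fun _ ha _ hb e => pos_cell_injective hi hj ha hb e

theorem card_present (i j : ℕ) : (Λ.present i j).card = 9 + (Λ.own i j).card := by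
  have h1 := Finset.card_filter_add_card_filter_not (s := Λ.present i j)
    fun a => 0 < a.offset.1 ∧ 0 < a.offset.2
  have h2 : (Λ.present i j).filter (fun a => ¬ (0 < a.offset.1 ∧ 0 < a.offset.2)) =
      Finset.univ.filter fun a => ¬ (0 < a.offset.1 ∧ 0 < a.offset.2) := by
    ext a
    simp only [Finset.mem_filter, Finset.mem_univ, true_and, and_iff_right_iff_imp]
    exact fun ha => Λ.mem_present i j a (by rintro rfl; exact ha (by decide))
      (by rintro rfl; exact ha (by decide))
  have h3 : (Finset.univ.filter fun a : CellVertex => ¬ (0 < a.offset.1 ∧ 0 < a.offset.2)).card = 9 := by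
    decide
  rw [h2, h3] at h1
  rw [own]
  omega

/-- Edges in a cell pass above the inner vertices of its south-west path. -/
theorem southWestInner_le {i j : ℕ} (hi : i < w) (hj : j < h) {u : CellVertex}
    (hu : u ∈ CellVertex.southWestInner) {z : Plane} (hz1 : z.1 = (Λ.pos (cellIndex i j u)).1)
    (hz : ∃ s ∈ pathOf (cellAt Λ.pos i j) CellVertex.southWestEdges, s ≤ z) :
    (Λ.pos (cellIndex i j u)).2 ≤ z.2 := by
  obtain ⟨s, ⟨e, he, hs⟩, hsz⟩ := hz
  obtain ⟨h1, h2, h3, h4, -, -⟩ := CellVertex.southWestEdges_same_side e he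
  have m1 := Λ.mem_present i j _ h1 h2
  have m2 := Λ.mem_present i j _ h3 h4
  have hup := CellVertex.inner_spec u (Or.inl hu)
  have mu := Λ.mem_present i j u hup.1 hup.2.1
  refine le_trans ?_ hsz.2
  rcases CellVertex.southWestEdges_inner e he u hu with ⟨h5, h6⟩ | ⟨h5, h6⟩
  · have key : ∀ a ∈ Λ.present i j, (u = a ∨ CellVertex.Toward .north u a) →
        (Λ.pos (cellIndex i j u)).2 ≤ (cellAt Λ.pos i j a).2 := by
      rintro a ha (rfl | hd)
      · exact le_rfl
      · exact (Λ.y_order i hi j hj u mu a ha hd).le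
    have hc : Convex ℝ {z : Plane | (Λ.pos (cellIndex i j u)).2 ≤ z.2} :=
      convex_halfSpace_ge (LinearMap.snd ℝ ℝ ℝ).isLinear _
    exact hc.segment_subset (key _ m1 h5) (key _ m2 h6) hs
  · have hlt := Λ.x_order i hi j hj _ m1 _ m2 h6
    obtain ⟨h7, -, h8⟩ := (mem_segment_iff_lineAt hlt s).1 hs
    have h9 : s.1 ≤ (Λ.pos (cellIndex i j u)).1 := hsz.1.trans hz1.le
    rcases h5 with rfl | h5
    · have : s.1 = (cellAt Λ.pos i j e.1).1 := le_antisymm h9 h7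
      rw [h8, this, lineAt_left]
      exact le_rfl
    · exact absurd (Λ.x_order i hi j hj u mu _ m1 h5) (not_lt.2 (h7.trans h9))

/-- Edges in a cell pass below the inner vertices of its north-east path. -/
theorem lineAt_le_northEastInner {i j : ℕ} (hi : i < w) (hj : j < h) {u a b : CellVertex}
    (hu : u ∈ CellVertex.northEastInner) (ha : a ∈ Λ.present i j) (hb : b ∈ Λ.present i j)
    (h1 : (Λ.pos (cellIndex i j a)).1 < (Λ.pos (cellIndex i j u)).1)
    (h2 : (Λ.pos (cellIndex i j u)).1 < (Λ.pos (cellIndex i j b)).1) :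
    lineAt (Λ.pos (cellIndex i j a)) (Λ.pos (cellIndex i j b)) (Λ.pos (cellIndex i j u)).1 ≤
      (Λ.pos (cellIndex i j u)).2 := by
  have ua := used_of_cell (Λ := Λ) hi hj ha
  have ub := used_of_cell (Λ := Λ) hi hj hb
  have := a.offset_fst_le
  have := a.offset_snd_le
  have := b.offset_fst_le
  have := b.offset_snd_le
  rcases CellVertex.northEastInner_offset u hu with ⟨h3, h4⟩ | ⟨h3, h4⟩
  · have hle := u.offset_snd_le
    obtain ⟨n, hn⟩ : ∃ n, u.offset.2 = n + 1 := ⟨u.offset.2 - 1, by omega⟩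
    have e : cellIndex i j u = (4 * (i + 1), 4 * j + n + 1) := by
      unfold cellIndex; ext <;> omega
    have key : ∀ k, Λ.Used k → k.1 ≤ 4 * (i + 1) → (Λ.pos k).2 ≤
        lineAt (Λ.pos (4 * (i + 1), 4 * j + n + 1)) (Λ.pos (4 * (i + 1), 4 * j + n)) (Λ.pos k).1 :=
      fun k hk hle => vertical_le (by omega) (by omega) hk.mem ((hk.fst_le_iff (by omega)).2 hle)
    rw [e] at h1 h2 ⊢
    refine (lineAt_le_lineAt (h1.trans h2) h1.le h2.le (key _ ua (by simp only [cellIndex]; omega))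
      (key _ ub (by simp only [cellIndex]; omega))).trans_eq (lineAt_left _ _)
  · have e : cellIndex i j u = (4 * i + u.offset.1, 4 * (j + 1)) := by
      unfold cellIndex; ext <;> omega
    have key : ∀ k, Λ.Used k → k.2 ≤ 4 * (j + 1) → (Λ.pos k).2 ≤
        lineAt (Λ.pos (4 * i + u.offset.1, 4 * (j + 1)))
          (Λ.pos (4 * i + u.offset.1 + 1, 4 * (j + 1))) (Λ.pos k).1 :=
      fun k hk hle => horizontal_le (by omega) (by omega) hk.mem ((hk.snd_le_iff (by omega)).2 hle)
    rw [e] at h1 h2 ⊢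
    refine (lineAt_le_lineAt (h1.trans h2) h1.le h2.le (key _ ua (by simp only [cellIndex]; omega))
      (key _ ub (by simp only [cellIndex]; omega))).trans_eq (lineAt_left _ _)

/-- A plane graph in a cell has at most as many edges as a triangulation of the cell. -/
theorem cell_edge_bound {i j : ℕ} (hi : i < w) (hj : j < h) {G : SimpleGraph Plane}
    (hG : IsPSLGraph (Λ.cellPoints i j) G)
    (hreg : ∀ a b, G.Adj a b → segment ℝ a b ⊆ cellRegion (cellAt Λ.pos i j)) :
    ∑ v ∈ Λ.cellPoints i j, cardinalDegree G .east v ≤ 8 + 3 * (Λ.own i j).card := by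
  have hb4 := Λ.mem_present i j .b4 (by decide) (by decide)
  have hv4 := Λ.mem_present i j .v4 (by decide) (by decide)
  have hpt : ∀ {a}, a ∈ Λ.present i j → cellAt Λ.pos i j a ∈ Λ.cellPoints i j := fun ha =>
    Finset.mem_image_of_mem _ ha
  have key : ∀ l : List CellVertex, l.Nodup → (∀ u ∈ l, u ≠ .p ∧ u ≠ .q ∧ u ≠ .b4 ∧ u ≠ .v4) →
      (l.toFinset.image (cellAt Λ.pos i j)).card = l.length ∧
      l.toFinset.image (cellAt Λ.pos i j) ⊆ Λ.cellPoints i j ∧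
      cellAt Λ.pos i j .b4 ∉ l.toFinset.image (cellAt Λ.pos i j) ∧
      cellAt Λ.pos i j .v4 ∉ l.toFinset.image (cellAt Λ.pos i j) := by
    intro l hnd hl
    have hp : ∀ u ∈ l.toFinset, u ∈ Λ.present i j := fun u hu =>
      Λ.mem_present i j u (hl u (List.mem_toFinset.1 hu)).1 (hl u (List.mem_toFinset.1 hu)).2.1
    refine ⟨?_, Finset.image_subset_image hp, ?_, ?_⟩
    · refine (Finset.card_image_of_injOn fun a ha b hb e =>
        pos_cell_injective hi hj (hp a ha) (hp b hb) e).trans (List.toFinset_card_of_nodup hnd)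
    · intro hm
      obtain ⟨u, hu, e⟩ := Finset.mem_image.1 hm
      exact (hl u (List.mem_toFinset.1 hu)).2.2.1 (pos_cell_injective hi hj (hp u hu) hb4 e)
    · intro hm
      obtain ⟨u, hu, e⟩ := Finset.mem_image.1 hm
      exact (hl u (List.mem_toFinset.1 hu)).2.2.2 (pos_cell_injective hi hj (hp u hu) hv4 e)
  obtain ⟨u1, u2, u3, u4⟩ := key CellVertex.northEastInner (by decide)
    fun u hu => CellVertex.inner_spec u (Or.inr hu)
  obtain ⟨d1, d2, d3, d4⟩ := key CellVertex.southWestInner (by decide)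
    fun u hu => CellVertex.inner_spec u (Or.inl hu)
  -- The cell has nine vertices more than `own`. Seven inner vertices of the north-east path have no
  -- edge above them and seven of the south-west path none below, so the bound is `3 (9 + |own|) - 5
  -- - 14 = 8 + 3 |own|`.
  have hbound := hG.edge_bound (Λ.fst_injOn.mono (Finset.coe_subset.2 (cellPoints_subset hi hj)))
    (hpt hb4) (hpt hv4) (fun e => by
      have := pos_cell_injective hi hj hb4 hv4 e
      exact absurd this (by decide))
    (by
      intro z hz
      obtain ⟨a, ha, rfl⟩ := mem_cellPoints.1 hz
      rcases (CellVertex.toward_east_ends a).1 with rfl | ht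
      · exact le_rfl
      · exact (Λ.x_order i hi j hj _ hb4 a ha ht).le)
    (by
      intro z hz
      obtain ⟨a, ha, rfl⟩ := mem_cellPoints.1 hz
      rcases (CellVertex.toward_east_ends a).2 with rfl | ht
      · exact le_rfl
      · exact (Λ.x_order i hi j hj a ha _ hv4 ht).le)
    (CellVertex.northEastInner.toFinset.image (cellAt Λ.pos i j))
    (CellVertex.southWestInner.toFinset.image (cellAt Λ.pos i j)) u2 d2 u3 u4 d3 d4
    (by
      intro z hz x y hxy h1 h2
      obtain ⟨u, hu, rfl⟩ := Finset.mem_image.1 hz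
      obtain ⟨a, ha, rfl⟩ := mem_cellPoints.1 (hG.mem _ _ hxy).1
      obtain ⟨b, hb, rfl⟩ := mem_cellPoints.1 (hG.mem _ _ hxy).2
      exact lineAt_le_northEastInner hi hj (List.mem_toFinset.1 hu) ha hb h1 h2)
    (by
      intro z hz x y hxy h1 h2
      obtain ⟨u, hu, rfl⟩ := Finset.mem_image.1 hz
      exact southWestInner_le hi hj (List.mem_toFinset.1 hu)
        (z := ((cellAt Λ.pos i j u).1, lineAt x y (cellAt Λ.pos i j u).1)) rfl
        (hreg x y hxy ((mem_segment_iff_lineAt (h1.trans h2)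
          ((cellAt Λ.pos i j u).1, lineAt x y (cellAt Λ.pos i j u).1)).2 ⟨h1.le, h2.le, rfl⟩)).1)
  rw [u1, d1, card_cellPoints hi hj, card_present] at hbound
  simp only [CellVertex.northEastInner, CellVertex.southWestInner, List.length_cons,
    List.length_nil] at hbound
  omega

theorem cellPart_mem {i j : ℕ} {x y : Plane} (hxy : (Λ.cellPart T i j).Adj x y) :
    x ∈ Λ.cellPoints i j ∧ y ∈ Λ.cellPoints i j :=
  ⟨mem_cellPoints.2 hxy.2.1, mem_cellPoints.2 hxy.2.2.1⟩

theorem cellPart_psl (hT : IsPSLGraph Λ.verts T) {i j : ℕ} (hi : i < w) (hj : j < h) :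
    IsPSLGraph (Λ.cellPoints i j) (Λ.cellPart T i j) where
  mem _ _ h := cellPart_mem h
  crossingFree a b c d h1 h2 := hT.crossingFree a b c d h1.1 h2.1
  not_mem_edge a b h v hv := hT.not_mem_edge a b h.1 v (cellPoints_subset hi hj hv)

theorem IsFramed.adj_southWest (hT : Λ.IsFramed T) {i j : ℕ} (hi : i < w) (hj : j < h)
    {e : CellVertex × CellVertex} (he : e ∈ CellVertex.southWestEdges) :
    T.Adj (Λ.pos (cellIndex i j e.1)) (Λ.pos (cellIndex i j e.2)) := by
  have := e.1.offset_fst_le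
  have := e.1.offset_snd_le
  have := e.2.offset_fst_le
  have := e.2.offset_snd_le
  rcases CellVertex.southWestEdges_cases e he with ⟨h1, h2, h3, -⟩ | ⟨h1, h2, h3, -⟩
  · rw [show cellIndex i j e.1 = (4 * i, 4 * j + e.2.offset.2 + 1) by
      unfold cellIndex; ext <;> omega, show cellIndex i j e.2 = (4 * i, 4 * j + e.2.offset.2) by
      unfold cellIndex; ext <;> omega]
    exact hT.path i hi.le _ (by omega)
  · rw [show cellIndex i j e.2 = (4 * i + e.1.offset.1 + 1, 4 * j) by
      unfold cellIndex; ext <;> omega, show cellIndex i j e.1 = (4 * i + e.1.offset.1, 4 * j) by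
      unfold cellIndex; ext <;> omega]
    exact (hT.row j hj.le _ (by omega)).symm

theorem IsFramed.southWestGraph_le (hT : Λ.IsFramed T) {i j : ℕ} (hi : i < w) (hj : j < h) :
    southWestGraph (cellAt Λ.pos i j) ≤ Λ.cellPart T i j := by
  have key : ∀ e ∈ CellVertex.southWestEdges, (Λ.cellPart T i j).Adj
      (Λ.pos (cellIndex i j e.1)) (Λ.pos (cellIndex i j e.2)) := by
    intro e he
    obtain ⟨h1, h2, h3, h4, -, -⟩ := CellVertex.southWestEdges_same_side e he
    have m1 := Λ.mem_present i j _ h1 h2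
    have m2 := Λ.mem_present i j _ h3 h4
    exact ⟨hT.adj_southWest hi hj he, ⟨_, m1, rfl⟩, ⟨_, m2, rfl⟩, fun z hz =>
      ⟨⟨z, ⟨e, he, hz⟩, le_rfl⟩, exists_northEast_ge hi hj m1 m2 hz⟩⟩
  rintro x y ⟨-, ⟨e, he, rfl, rfl⟩ | ⟨e, he, rfl, rfl⟩⟩
  · exact key e he
  · exact (key e he).symm

variable {E : Fin w × Fin h → Set (Sym2 CellVertex)}

theorem IsModel.adj_iff (hM : Λ.IsModel E T) (x y : Plane) : T.Adj x y ↔ Λ.baseGraph.Adj x y ∨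
    ∃ c : Fin w × Fin h,
      (Λ.cellPart T c.1 c.2 \ southWestGraph (cellAt Λ.pos c.1 c.2)).Adj x y := by
  constructor
  · intro hxy
    rcases mem_verts_iff.1 (hM.psl.mem _ _ hxy).1 with rfl | ⟨k, hk, rfl⟩
    · exact Or.inl (hM.adj_base_of_cone hxy)
    rcases mem_verts_iff.1 (hM.psl.mem _ _ hxy).2 with rfl | ⟨k', hk', rfl⟩
    · exact Or.inl (hM.adj_base_of_cone hxy.symm).symm
    exact hM.isFramed.adj_cases hk hk' hxy
  · rintro (hxy | ⟨c, hxy⟩)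
    · exact hM.isFramed.baseGraph_le hxy
    · exact hxy.1.1

/-- At every vertex, the parts of the graph in the cells have in total the prescribed cardinal
degrees. -/
theorem IsModel.sum_cellPart (hM : Λ.IsModel E T) (d : Dir) {v : Plane} (hv : v ∈ Λ.verts) :
    ∑ c : Fin w × Fin h, cardinalDegree (Λ.cellPart T c.1 c.2) d v =
      ∑ c : Fin w × Fin h, cardinalDegree (drawn (cellAt Λ.pos c.1 c.2) (E c)) d v := by
  have hmem : ∀ (c : Fin w × Fin h) x y, (Λ.cellPart T c.1 c.2).Adj x y →
      x ∈ Λ.verts ∧ y ∈ Λ.verts := fun c x y h => hM.psl.mem _ _ h.1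
  have hown := isOwnFamily_sdiff (Λ := Λ)
    (G := fun c : Fin w × Fin h => Λ.cellPart T c.1 c.2)
    (fun c x y h => by
      obtain ⟨-, ⟨a, ha, e⟩, ⟨b, hb, e'⟩, -⟩ := h
      exact ⟨a, ha, b, hb, e, e'⟩) (fun c x y h => h.2.2.2)
  have h1 := cardinalDegree_eq_add_sum hM.psl.mem (hM.adj_iff v)
    (fun u c => hown.not_adj_base (c := c)) (fun u c c' => hown.eq_of_adj) d
  have h2 := hM.degree d v hv
  have h3 : ∑ c : Fin w × Fin h, cardinalDegree (Λ.cellPart T c.1 c.2) d v =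
      ∑ c : Fin w × Fin h, cardinalDegree
        (Λ.cellPart T c.1 c.2 \ southWestGraph (cellAt Λ.pos c.1 c.2)) d v +
      ∑ c : Fin w × Fin h, cardinalDegree (southWestGraph (cellAt Λ.pos c.1 c.2)) d v := by
    rw [← Finset.sum_add_distrib]
    exact Finset.sum_congr rfl fun c _ => (cardinalDegree_sdiff_add (hmem c)
      (hM.isFramed.southWestGraph_le c.1.2 c.2.2) d v).symm
  omega

theorem sum_verts_eq {i j : ℕ} (hi : i < w) (hj : j < h) {G : SimpleGraph Plane}
    (hG : ∀ a b, G.Adj a b → a ∈ Λ.cellPoints i j ∧ b ∈ Λ.cellPoints i j) (d : Dir) :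
    ∑ v ∈ Λ.verts, cardinalDegree G d v = ∑ v ∈ Λ.cellPoints i j, cardinalDegree G d v := by
  refine (Finset.sum_subset (cellPoints_subset hi hj) fun v _ hv => ?_).symm
  have : {u | G.Adj v u ∧ Toward d v u} = ∅ :=
    Set.eq_empty_of_forall_notMem fun u hu => hv (hG _ _ hu.1).1
  rw [cardinalDegree, this, Set.ncard_empty]

/-- No cell part exceeds the number of edges of a triangulation, and the degrees force the total
over all cells to be the sum of these numbers. Hence equality holds in every cell. -/
theorem IsModel.edge_count (hM : Λ.IsModel E T) (c : Fin w × Fin h) :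
    ∑ v ∈ Λ.cellPoints c.1 c.2, cardinalDegree (Λ.cellPart T c.1 c.2) .east v =
      8 + 3 * (Λ.own c.1 c.2).card := by
  have hle : ∀ c : Fin w × Fin h, ∑ v ∈ Λ.cellPoints c.1 c.2,
      cardinalDegree (Λ.cellPart T c.1 c.2) .east v ≤ 8 + 3 * (Λ.own c.1 c.2).card := fun c =>
    cell_edge_bound c.1.2 c.2.2 (cellPart_psl hM.psl c.1.2 c.2.2) fun a b h => h.2.2.2
  have hsum : ∑ c : Fin w × Fin h, ∑ v ∈ Λ.cellPoints c.1 c.2,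
      cardinalDegree (Λ.cellPart T c.1 c.2) .east v =
      ∑ c : Fin w × Fin h, (8 + 3 * (Λ.own c.1 c.2).card) := by
    have h1 : ∀ c : Fin w × Fin h, ∑ v ∈ Λ.cellPoints c.1 c.2,
        cardinalDegree (Λ.cellPart T c.1 c.2) .east v =
        ∑ v ∈ Λ.verts, cardinalDegree (Λ.cellPart T c.1 c.2) .east v := fun c =>
      (sum_verts_eq c.1.2 c.2.2 (fun _ _ => cellPart_mem) _).symm
    rw [Finset.sum_congr rfl fun c _ => h1 c, Finset.sum_comm,
      Finset.sum_congr rfl fun v hv => hM.sum_cellPart .east hv, Finset.sum_comm]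
    refine Finset.sum_congr rfl fun c _ => ?_
    rw [sum_cardinalDegree_drawn c.1.2 c.2.2 (hM.present c) (hM.loop c)
      fun a ha => (used_of_cell c.1.2 c.2.2 ha).mem]
    exact hM.ncard c
  exact (Finset.sum_eq_sum_iff_of_le fun c _ => hle c).1 hsum c (Finset.mem_univ c)

/-- No edges can be added to the part of the graph in a cell. -/
theorem IsModel.cellPart_maximal (hM : Λ.IsModel E T) (c : Fin w × Fin h) {G : SimpleGraph Plane}
    (hG : IsPSLGraph (Λ.cellPoints c.1 c.2) G)
    (hreg : ∀ a b, G.Adj a b → segment ℝ a b ⊆ cellRegion (cellAt Λ.pos c.1 c.2))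
    (hle : Λ.cellPart T c.1 c.2 ≤ G) : G ≤ Λ.cellPart T c.1 c.2 := by
  have hmono : ∀ v ∈ Λ.cellPoints c.1 c.2, cardinalDegree (Λ.cellPart T c.1 c.2) .east v ≤
      cardinalDegree G .east v := fun v _ => cardinalDegree_mono hG.mem hle _ v
  -- The larger graph obeys the same edge bound, which the cell part already attains, so no east
  -- degree can grow.
  have heq : ∀ v ∈ Λ.cellPoints c.1 c.2, cardinalDegree (Λ.cellPart T c.1 c.2) .east v =
      cardinalDegree G .east v := by
    refine (Finset.sum_eq_sum_iff_of_le hmono).1 (le_antisymm (Finset.sum_le_sum hmono) ?_)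
    rw [hM.edge_count c]
    exact cell_edge_bound c.1.2 c.2.2 hG hreg
  have key : ∀ x y, G.Adj x y → x.1 < y.1 → (Λ.cellPart T c.1 c.2).Adj x y := by
    intro x y hxy hlt
    have hset : {u | (Λ.cellPart T c.1 c.2).Adj x u ∧ Toward .east x u} =
        {u | G.Adj x u ∧ Toward .east x u} :=
      Set.eq_of_subset_of_ncard_le (fun u hu => ⟨hle hu.1, hu.2⟩) (heq x (hG.mem _ _ hxy).1).ge
        ((Λ.cellPoints c.1 c.2).finite_toSet.subset fun u hu => (hG.mem _ _ hu.1).2)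
    have hy : y ∈ {u | G.Adj x u ∧ Toward .east x u} := ⟨hxy, hlt⟩
    rw [← hset] at hy
    exact hy.1
  intro x y hxy
  rcases lt_or_gt_of_ne (hG.fst_ne (Λ.fst_injOn.mono
    (Finset.coe_subset.2 (cellPoints_subset c.1.2 c.2.2))) hxy) with hlt | hlt
  · exact key x y hxy hlt
  · exact (key y x hxy.symm hlt).symm

end Layout

theorem sum_eq_iff_of_eq_off {ι : Type*} [Fintype ι] {f g : ι → ℕ} (c : ι)
    (hne : ∀ c', c' ≠ c → f c' = g c') : ∑ c, f c = ∑ c, g c ↔ f c = g c := by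
  classical
  rw [← Finset.add_sum_erase _ f (Finset.mem_univ c), ← Finset.add_sum_erase _ g (Finset.mem_univ c),
    Finset.sum_congr rfl fun c' hc' => hne c' (Finset.ne_of_mem_erase hc')]
  exact Nat.add_right_cancel_iff

theorem sum_eq_iff_of_eq_off_pair {ι : Type*} [Fintype ι] {f g : ι → ℕ} {c c' : ι} (hcc : c' ≠ c)
    (hne : ∀ i, i ≠ c → i ≠ c' → f i = g i) :
    ∑ c, f c = ∑ c, g c ↔ f c + f c' = g c + g c' := by
  classical
  have hm : c' ∈ Finset.univ.erase c := Finset.mem_erase.2 ⟨hcc, Finset.mem_univ c'⟩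
  rw [← Finset.add_sum_erase _ f (Finset.mem_univ c), ← Finset.add_sum_erase _ g (Finset.mem_univ c),
    ← Finset.add_sum_erase _ f hm, ← Finset.add_sum_erase _ g hm,
    Finset.sum_congr rfl fun i hi => hne i (Finset.ne_of_mem_erase (Finset.mem_of_mem_erase hi))
      (Finset.ne_of_mem_erase hi), ← add_assoc, ← add_assoc]
  exact Nat.add_right_cancel_iff

/-! ### Gadgets as sets of edges -/

namespace Gadget

variable (g : Gadget)

/-- The edges of a color. -/
def colorEdges (k : EdgeColor) : Set (Sym2 CellVertex) := {e | g.color e = some k}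

/-- The edges of a local coloring. -/
def edges (χ : LocalColoring) : Set (Sym2 CellVertex) := {e | ∃ k, g.color e = some k ∧ χ.Uses k}

/-- The number of edges of a color at `a` in direction `d`. -/
noncomputable def colorDegree (k : EdgeColor) (d : Dir) (a : CellVertex) : ℕ :=
  {b | s(a, b) ∈ g.colorEdges k ∧ CellVertex.Toward d a b}.ncard

theorem graph_eq_drawn (f : CellVertex → Plane) (χ : LocalColoring) :
    g.graph f χ = drawn f (g.edges χ) := by
  have key : ∀ x y, (∃ a b c, g.color s(a, b) = some c ∧ χ.Uses c ∧ f a = x ∧ f b = y) ↔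
      ∃ a b, s(a, b) ∈ g.edges χ ∧ f a = x ∧ f b = y := fun x y =>
    ⟨fun ⟨a, b, c, h1, h2, h3⟩ => ⟨a, b, ⟨c, h1, h2⟩, h3⟩,
      fun ⟨a, b, ⟨c, h1, h2⟩, h3⟩ => ⟨a, b, c, h1, h2, h3⟩⟩
  ext x y
  simp only [graph, drawn, SimpleGraph.fromRel_adj, key]

theorem mem_verts_of_color {a b : CellVertex} {k : EdgeColor} (h : g.color s(a, b) = some k) :
    a ∈ g.verts ∧ b ∈ g.verts := by
  have key : ∀ a b, g.color s(a, b) = some k → a ∈ g.verts := by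
    intro a b h
    refine Finset.mem_filter.2 ⟨Finset.mem_univ a, ?_, ?_⟩
    · rintro rfl
      by_contra hp
      rw [g.noP (Bool.eq_false_iff.2 hp) b] at h
      cases h
    · rintro rfl
      by_contra hq
      rw [g.noQ (Bool.eq_false_iff.2 hq) b] at h
      cases h
  exact ⟨key a b h, key b a (by rwa [Sym2.eq_swap])⟩

theorem ne_of_color {a b : CellVertex} {k : EdgeColor} (h : g.color s(a, b) = some k) : a ≠ b := by
  rintro rfl
  rw [g.not_loop a] at h
  cases h

theorem color_southWest {e : Sym2 CellVertex} (he : e ∈ southWestSet) :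
    g.color e = some .black := by
  obtain ⟨p, hp, rfl⟩ := he
  exact g.boundary_black p (List.mem_append_left _ hp)

theorem card_verts : g.verts.card = 16 + g.hasP.toNat + g.hasQ.toNat := by
  have key : ∀ P Q : Bool, ((Finset.univ : Finset CellVertex).filter fun a =>
      (a = .p → P = true) ∧ (a = .q → Q = true)).card = 16 + P.toNat + Q.toNat := by decide
  exact key g.hasP g.hasQ

theorem ncard_edges (χ : LocalColoring) (d : Dir) (a : CellVertex) :
    {b | s(a, b) ∈ g.edges χ ∧ CellVertex.Toward d a b}.ncard = g.colorDegree .black d a +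
      g.tintDegree .red (χ .red) d a + g.tintDegree .blue (χ .blue) d a := by
  unfold colorDegree tintDegree
  rw [← Set.ncard_union_eq _ (Set.toFinite _) (Set.toFinite _),
    ← Set.ncard_union_eq _ (Set.toFinite _) (Set.toFinite _)]
  · congr 1
    ext b
    simp only [edges, colorEdges, Set.mem_ofPred_eq, Set.mem_union]
    constructor
    · rintro ⟨⟨k, hk, hu⟩, hd⟩
      rcases k with _ | ⟨_ | _, s⟩
      · exact Or.inl (Or.inl ⟨hk, hd⟩)
      · obtain rfl : χ .red = s := hu
        exact Or.inl (Or.inr ⟨hk, hd⟩)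
      · obtain rfl : χ .blue = s := hu
        exact Or.inr ⟨hk, hd⟩
    · rintro ((⟨hk, hd⟩ | ⟨hk, hd⟩) | ⟨hk, hd⟩)
      · exact ⟨⟨_, hk, trivial⟩, hd⟩
      · exact ⟨⟨_, hk, rfl⟩, hd⟩
      · exact ⟨⟨_, hk, rfl⟩, hd⟩
  · refine Set.disjoint_left.2 ?_
    rintro b (⟨h1, -⟩ | ⟨h1, -⟩) ⟨h2, -⟩
    · cases h1.symm.trans h2
    · cases h1.symm.trans h2
  · refine Set.disjoint_left.2 ?_
    rintro b ⟨h1, -⟩ ⟨h2, -⟩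
    cases h1.symm.trans h2

end Gadget

/-! ### Layout and edge colors of a frame graph -/

namespace FrameGraph

variable {w h : ℕ} {S : GadgetSystem} {X : Tiling w h} (F : FrameGraph S X)

open scoped Classical in
/-- The vertices of the gadget in a cell. -/
noncomputable def present (i j : ℕ) : Finset CellVertex :=
  -- For indices outside the grid the condition is vacuous and all cell vertices count as present,
  -- so the family is defined on all natural numbers.
  Finset.univ.filter fun a => ∀ (hi : i < w) (hj : j < h), a ∈ (F.gadget ⟨i, hi⟩ ⟨j, hj⟩).verts

theorem present_eq (i : Fin w) (j : Fin h) : F.present i j = (F.gadget i j).verts := by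
  ext a
  simp [present]

theorem orient_ne_zero {a b c : Plane} (ha : a ∈ F.verts) (hb : b ∈ F.verts) (hc : c ∈ F.verts)
    (hab : a ≠ b) (hbc : b ≠ c) (hac : a ≠ c) : orient a b c ≠ 0 := by
  intro h0
  refine F.generalPosition.not_collinear a ha b hb c hc hab hbc hac ?_
  have hne : b.1 - a.1 ≠ 0 := fun e =>
    hab (F.generalPosition.fst_injOn ha hb (sub_eq_zero.1 e).symm)
  rw [collinear_iff_of_mem (p₀ := a) (by simp)]
  refine ⟨b - a, ?_⟩
  rintro z (rfl | rfl | rfl)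
  · exact ⟨0, by simp⟩
  · exact ⟨1, by simp⟩
  · refine ⟨(z.1 - a.1) / (b.1 - a.1), ?_⟩
    unfold orient at h0
    refine Prod.ext ?_ ?_
    · simp only [vadd_eq_add, Prod.fst_add, Prod.smul_fst, Prod.fst_sub, smul_eq_mul]
      field_simp
      ring
    · simp only [vadd_eq_add, Prod.snd_add, Prod.smul_snd, Prod.snd_sub, smul_eq_mul]
      field_simp
      linarith

/-- The layout of a frame graph. -/
noncomputable def layout (hw : 0 < w) (hh : 0 < h) : Layout w h where
  pos := F.pos
  cone := F.cone
  verts := F.verts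
  present := F.present
  w_pos := hw
  h_pos := hh
  mem_present i j a hp hq := Finset.mem_filter.2 ⟨Finset.mem_univ a, fun _ _ =>
    Finset.mem_filter.2 ⟨Finset.mem_univ a, fun e => absurd e hp, fun e => absurd e hq⟩⟩
  mem_verts z := by
    simp only [verts, frameVerts, Finset.mem_insert, Finset.mem_biUnion, Finset.mem_univ, true_and,
      Gadget.points, Finset.mem_image]
    refine or_congr_right ⟨?_, ?_⟩
    · rintro ⟨i, j, a, ha, rfl⟩
      exact ⟨i, i.2, j, j.2, a, by rw [F.present_eq i j]; exact ha, rfl⟩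
    · rintro ⟨i, hi, j, hj, a, ha, rfl⟩
      exact ⟨⟨i, hi⟩, ⟨j, hj⟩, a, by rw [F.present_eq ⟨i, hi⟩ ⟨j, hj⟩] at ha; exact ha, rfl⟩
  fst_injOn := F.generalPosition.fst_injOn
  snd_injOn := F.generalPosition.snd_injOn
  orient_ne_zero a ha b hb c hc := F.orient_ne_zero ha hb hc
  x_order i hi j hj a ha b hb := by
    rw [F.present_eq ⟨i, hi⟩ ⟨j, hj⟩] at ha hb
    exact (F.frameCell ⟨i, hi⟩ ⟨j, hj⟩).x_order a ha b hb
  y_order i hi j hj a ha b hb := by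
    rw [F.present_eq ⟨i, hi⟩ ⟨j, hj⟩] at ha hb
    exact (F.frameCell ⟨i, hi⟩ ⟨j, hj⟩).y_order a ha b hb
  vertical_hull i hi m hm := by
    rcases (F.vertical_hull i hi m hm).2.2.2 with H | H
    · exact Or.inl fun z hz hx => H z ⟨hz, hx⟩
    · exact Or.inr fun z hz hx => H z ⟨hz, hx⟩
  horizontal_hull j hj m hm := by
    rcases (F.horizontal_hull j hj m hm).2.2.2 with H | H
    · exact Or.inl fun z hz hy => H z ⟨hz, hy⟩
    · exact Or.inr fun z hz hy => H z ⟨hz, hy⟩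
  cone_southWest := F.cone_southWest

variable (hw : 0 < w) (hh : 0 < h)

theorem mem_present_of_color (i : Fin w) (j : Fin h) {a b : CellVertex} {k : EdgeColor}
    (hk : (F.gadget i j).color s(a, b) = some k) :
    a ∈ (F.layout hw hh).present i j ∧ b ∈ (F.layout hw hh).present i j := by
  change a ∈ F.present i j ∧ b ∈ F.present i j
  rw [F.present_eq i j]
  exact (F.gadget i j).mem_verts_of_color hk

/-- `drawn_inside` speaks of local colorings, but every color is used by one of them. -/
theorem segment_subset_of_color (i : Fin w) (j : Fin h) {a b : CellVertex} {k : EdgeColor}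
    (hk : (F.gadget i j).color s(a, b) = some k) :
    segment ℝ (F.cell i j a) (F.cell i j b) ⊆ cellRegion (F.cell i j) := by
  have hp := F.mem_present_of_color (i.pos) (j.pos) i j hk
  have hne : F.cell i j a ≠ F.cell i j b := fun e => (F.gadget i j).ne_of_color hk
    (Layout.pos_cell_injective (Λ := F.layout i.pos j.pos) i.2 j.2 hp.1 hp.2 e)
  have key : ∀ χ : LocalColoring, χ.Uses k →
      segment ℝ (F.cell i j a) (F.cell i j b) ⊆ cellRegion (F.cell i j) := fun χ hχ =>
    F.drawn_inside i j χ _ _ ⟨hne, Or.inl ⟨a, b, k, hk, hχ, rfl, rfl⟩⟩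
  rcases k with _ | ⟨c, s⟩
  · exact key (fun _ => .light) trivial
  · exact key (fun _ => s) rfl

/-- The edges of a color in a cell. -/
noncomputable def cellColor (F : FrameGraph S X) (k : EdgeColor) (c : Fin w × Fin h) :
    SimpleGraph Plane :=
  drawn (F.cell c.1 c.2) ((F.gadget c.1 c.2).colorEdges k)

theorem cellColor_adj {k : EdgeColor} {c : Fin w × Fin h} {x y : Plane} :
    (F.cellColor k c).Adj x y ↔ ∃ a b, (F.gadget c.1 c.2).color s(a, b) = some k ∧
      F.cell c.1 c.2 a = x ∧ F.cell c.1 c.2 b = y := by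
  refine (Layout.drawn_adj (Λ := F.layout c.1.pos c.2.pos) c.1.2 c.2.2
    (fun a b hab => F.mem_present_of_color _ _ c.1 c.2 hab)
    (fun a ha => (F.gadget c.1 c.2).ne_of_color ha rfl)).trans ?_
  constructor
  · rintro ⟨a, b, hab, rfl, rfl⟩
    exact ⟨a, b, hab, rfl, rfl⟩
  · rintro ⟨a, b, hab, rfl, rfl⟩
    exact ⟨a, b, hab, rfl, rfl⟩

theorem cardinalDegree_cellColor (k : EdgeColor) (c : Fin w × Fin h) {a : CellVertex}
    (ha : a ∈ (F.gadget c.1 c.2).verts) (d : Dir) :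
    cardinalDegree (F.cellColor k c) d (F.cell c.1 c.2 a) = (F.gadget c.1 c.2).colorDegree k d a :=
  Layout.cardinalDegree_drawn (Λ := F.layout c.1.pos c.2.pos) c.1.2 c.2.2
    (fun _ _ hab => F.mem_present_of_color _ _ c.1 c.2 hab)
    (fun _ ha => (F.gadget c.1 c.2).ne_of_color ha rfl) (by
      rw [← F.present_eq c.1 c.2] at ha
      exact ha) d

theorem cardinalDegree_cellColor_eq_zero (k : EdgeColor) (c : Fin w × Fin h) {v : Plane}
    (hv : ∀ a ∈ (F.gadget c.1 c.2).verts, v ≠ F.cell c.1 c.2 a) (d : Dir) :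
    cardinalDegree (F.cellColor k c) d v = 0 := by
  have : {u | (F.cellColor k c).Adj v u ∧ Toward d v u} = ∅ := by
    refine Set.eq_empty_of_forall_notMem fun u hu => ?_
    obtain ⟨a, b, hab, e, -⟩ := F.cellColor_adj.1 hu.1
    exact hv a ((F.gadget c.1 c.2).mem_verts_of_color hab).1 e.symm
  rw [cardinalDegree, this, Set.ncard_empty]

theorem edges_present (χ : LocalColoring) (c : Fin w × Fin h) {a b : CellVertex}
    (hab : s(a, b) ∈ (F.gadget c.1 c.2).edges χ) :
    a ∈ (F.layout hw hh).present c.1 c.2 ∧ b ∈ (F.layout hw hh).present c.1 c.2 := by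
  obtain ⟨k, hk, -⟩ := hab
  exact F.mem_present_of_color _ _ c.1 c.2 hk

theorem edges_loop (χ : LocalColoring) (c : Fin w × Fin h) (a : CellVertex) :
    s(a, a) ∉ (F.gadget c.1 c.2).edges χ := by
  rintro ⟨k, hk, -⟩
  exact (F.gadget c.1 c.2).ne_of_color hk rfl

theorem cardinalDegree_graph (χ : LocalColoring) (c : Fin w × Fin h) {a : CellVertex}
    (ha : a ∈ (F.gadget c.1 c.2).verts) (d : Dir) :
    cardinalDegree ((F.gadget c.1 c.2).graph (F.cell c.1 c.2) χ) d (F.cell c.1 c.2 a) =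
      (F.gadget c.1 c.2).colorDegree .black d a + (F.gadget c.1 c.2).tintDegree .red (χ .red) d a +
        (F.gadget c.1 c.2).tintDegree .blue (χ .blue) d a := by
  rw [Gadget.graph_eq_drawn, ← Gadget.ncard_edges]
  exact Layout.cardinalDegree_drawn (Λ := F.layout c.1.pos c.2.pos) c.1.2 c.2.2
    (fun _ _ hab => F.edges_present _ _ χ c hab) (F.edges_loop χ c) (by
      rw [← F.present_eq c.1 c.2] at ha
      exact ha) d

theorem cardinalDegree_graph_eq_zero (χ : LocalColoring) (c : Fin w × Fin h) {v : Plane}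
    (hv : ∀ a ∈ (F.gadget c.1 c.2).verts, v ≠ F.cell c.1 c.2 a) (d : Dir) :
    cardinalDegree ((F.gadget c.1 c.2).graph (F.cell c.1 c.2) χ) d v = 0 := by
  rw [Gadget.graph_eq_drawn]
  refine Layout.cardinalDegree_drawn_eq_zero (Λ := F.layout c.1.pos c.2.pos) c.1.2 c.2.2
    (fun _ _ hab => F.edges_present _ _ χ c hab) (F.edges_loop χ c) (fun a ha => ?_) d
  change a ∈ F.present c.1 c.2 at ha
  rw [F.present_eq c.1 c.2] at ha
  exact hv a ha

theorem cardinalDegree_graph_eq (χ : LocalColoring) (c : Fin w × Fin h) (v : Plane) (d : Dir) :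
    cardinalDegree ((F.gadget c.1 c.2).graph (F.cell c.1 c.2) χ) d v =
      cardinalDegree (F.cellColor .black c) d v +
      cardinalDegree (F.cellColor (.tint .red (χ .red)) c) d v +
      cardinalDegree (F.cellColor (.tint .blue (χ .blue)) c) d v := by
  by_cases hv : ∃ a ∈ (F.gadget c.1 c.2).verts, v = F.cell c.1 c.2 a
  · obtain ⟨a, ha, rfl⟩ := hv
    rw [F.cardinalDegree_graph χ c ha, F.cardinalDegree_cellColor _ c ha,
      F.cardinalDegree_cellColor _ c ha, F.cardinalDegree_cellColor _ c ha]
    rfl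
  · push Not at hv
    rw [F.cardinalDegree_graph_eq_zero χ c hv, F.cardinalDegree_cellColor_eq_zero _ c hv,
      F.cardinalDegree_cellColor_eq_zero _ c hv, F.cardinalDegree_cellColor_eq_zero _ c hv]

theorem cellColor_isOwnFamily (k : EdgeColor) : (F.layout hw hh).IsOwnFamily fun c =>
    F.cellColor k c \ southWestGraph (cellAt F.pos c.1 c.2) := by
  refine Layout.isOwnFamily_sdiff (Λ := F.layout hw hh) (G := F.cellColor k) ?_ ?_
  · intro c x y hxy
    obtain ⟨a, b, hab, rfl, rfl⟩ := F.cellColor_adj.1 hxy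
    exact ⟨a, (F.mem_present_of_color hw hh _ _ hab).1, b, (F.mem_present_of_color hw hh _ _ hab).2,
      rfl, rfl⟩
  · intro c x y hxy
    obtain ⟨a, b, hab, rfl, rfl⟩ := F.cellColor_adj.1 hxy
    exact F.segment_subset_of_color _ _ hab

theorem southWestGraph_le_cellColor (c : Fin w × Fin h) :
    southWestGraph (cellAt F.pos c.1 c.2) ≤ F.cellColor .black c := by
  rw [← drawn_southWestSet]
  rintro x y ⟨hne, ⟨a, b, hab, e⟩ | ⟨a, b, hab, e⟩⟩
  · exact ⟨hne, Or.inl ⟨a, b, (F.gadget c.1 c.2).color_southWest hab, e⟩⟩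
  · exact ⟨hne, Or.inr ⟨a, b, (F.gadget c.1 c.2).color_southWest hab, e⟩⟩

theorem southWestGraph_not_adj_tint (c : Fin w × Fin h) (γ : Hue) (s : Shade) {x y : Plane}
    (hxy : (F.cellColor (.tint γ s) c).Adj x y) :
    ¬ (southWestGraph (cellAt F.pos c.1 c.2)).Adj x y := by
  intro hsw
  obtain ⟨a, b, hab, rfl, rfl⟩ := F.cellColor_adj.1 hxy
  obtain ⟨a', b', hab', e1, e2⟩ := F.cellColor_adj.1 (F.southWestGraph_le_cellColor c hsw)
  have m := F.mem_present_of_color c.1.pos c.2.pos _ _ hab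
  have m' := F.mem_present_of_color c.1.pos c.2.pos _ _ hab'
  obtain rfl := Layout.pos_cell_injective (Λ := F.layout c.1.pos c.2.pos) c.1.2 c.2.2 m'.1 m.1 e1
  obtain rfl := Layout.pos_cell_injective (Λ := F.layout c.1.pos c.2.pos) c.1.2 c.2.2 m'.2 m.2 e2
  cases hab.symm.trans hab'

theorem cellColor_mem {k : EdgeColor} {c : Fin w × Fin h} {x y : Plane}
    (hxy : (F.cellColor k c).Adj x y) : x ∈ F.verts ∧ y ∈ F.verts := by
  obtain ⟨a, b, hab, rfl, rfl⟩ := F.cellColor_adj.1 hxy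
  have m := F.mem_present_of_color c.1.pos c.2.pos _ _ hab
  exact ⟨(Layout.used_of_cell (Λ := F.layout c.1.pos c.2.pos) c.1.2 c.2.2 m.1).mem,
    (Layout.used_of_cell (Λ := F.layout c.1.pos c.2.pos) c.1.2 c.2.2 m.2).mem⟩

theorem colorGraph_tint_adj (γ : Hue) (s : Shade) (x y : Plane) :
    (F.colorGraph (.tint γ s)).Adj x y ↔ ∃ c, (F.cellColor (.tint γ s) c).Adj x y := by
  constructor
  · rintro ⟨hne, (⟨i, j, a, b, hab, e⟩ | ⟨e, -⟩) | (⟨i, j, a, b, hab, e⟩ | ⟨e, -⟩)⟩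
    · exact ⟨(i, j), hne, Or.inl ⟨a, b, hab, e⟩⟩
    · cases e
    · exact ⟨(i, j), hne, Or.inr ⟨a, b, hab, e⟩⟩
    · cases e
  · rintro ⟨c, hne, ⟨a, b, hab, e⟩ | ⟨a, b, hab, e⟩⟩
    · exact ⟨hne, Or.inl (Or.inl ⟨c.1, c.2, a, b, hab, e⟩)⟩
    · exact ⟨hne, Or.inr (Or.inl ⟨c.1, c.2, a, b, hab, e⟩)⟩

/-- The edges of west and south sides are black, so a colored edge belongs to one cell only and
degrees add up without correction. -/
theorem cardinalDegree_colorGraph_tint (γ : Hue) (s : Shade) (d : Dir) (v : Plane) :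
    cardinalDegree (F.colorGraph (.tint γ s)) d v =
      ∑ c, cardinalDegree (F.cellColor (.tint γ s) c) d v := by
  have h1 := cardinalDegree_eq_add_sum (G := F.colorGraph (.tint γ s)) (K := ⊥)
    (H := F.cellColor (.tint γ s)) (V := F.verts) (v := v) ?_ ?_ ?_ ?_ d
  · rw [h1, Nat.add_eq_right]
    simp [cardinalDegree]
  · intro x y hxy
    obtain ⟨c, hc⟩ := (F.colorGraph_tint_adj γ s x y).1 hxy
    exact F.cellColor_mem hc
  · intro u
    rw [F.colorGraph_tint_adj]
    simp
  · intro u c hu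
    exact absurd hu (by simp)
  · intro u c c' hc hc'
    exact (F.cellColor_isOwnFamily c.1.pos c.2.pos (.tint γ s)).eq_of_adj
      ⟨hc, F.southWestGraph_not_adj_tint c γ s hc⟩ ⟨hc', F.southWestGraph_not_adj_tint c' γ s hc'⟩

end FrameGraph

/-! ### Balance, and the signature as a model -/

namespace CellVertex

set_option maxRecDepth 10000 in
theorem exists_west_edge : ∀ y < 4, ∃ e ∈ southWestEdges, e.1.offset = (0, y + 1) ∧
    e.2.offset = (0, y) := by decide

set_option maxRecDepth 10000 in
theorem exists_south_edge : ∀ x < 4, ∃ e ∈ southWestEdges, e.1.offset = (x, 0) ∧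
    e.2.offset = (x + 1, 0) := by decide

theorem mem_corners_of_offset : ∀ a : CellVertex, a.offset.1 % 4 = 0 → a.offset.2 % 4 = 0 →
    a ∈ corners := by decide

theorem eq_p_or_q_of_offset : ∀ a : CellVertex, a.offset.1 % 4 ≠ 0 → a.offset.2 % 4 ≠ 0 →
    a = .p ∨ a = .q := by decide

theorem eq_sideVertex_vertical : ∀ a : CellVertex, a.offset.1 % 4 = 0 → a.offset.2 % 4 ≠ 0 →
    ∃ t : Fin 3, (a.offset.1 = 0 ∧ a = sideVertex .west t) ∨
      (a.offset.1 = 4 ∧ a = sideVertex .east t) := by decide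

theorem eq_sideVertex_horizontal : ∀ a : CellVertex, a.offset.1 % 4 ≠ 0 → a.offset.2 % 4 = 0 →
    ∃ t : Fin 3, (a.offset.2 = 0 ∧ a = sideVertex .south t) ∨
      (a.offset.2 = 4 ∧ a = sideVertex .north t) := by decide

theorem offset_sideVertex : ∀ t : Fin 3,
    ((sideVertex .west t).offset.1 = 0 ∧ (sideVertex .east t).offset.1 = 4 ∧
      (sideVertex .west t).offset.2 = (sideVertex .east t).offset.2) ∧
    (sideVertex .south t).offset.2 = 0 ∧ (sideVertex .north t).offset.2 = 4 ∧
      (sideVertex .south t).offset.1 = (sideVertex .north t).offset.1 := by decide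

theorem sideVertex_ne : ∀ d, ∀ t : Fin 3, sideVertex d t ≠ .p ∧ sideVertex d t ≠ .q := by
  intro d; cases d <;> decide

theorem corners_ne : ∀ a ∈ corners, a ≠ .p ∧ a ≠ .q := by decide

end CellVertex

theorem Gadget.mem_verts_of_ne (g : Gadget) {a : CellVertex} (hp : a ≠ .p) (hq : a ≠ .q) :
    a ∈ g.verts :=
  Finset.mem_filter.2 ⟨Finset.mem_univ a, fun e => absurd e hp, fun e => absurd e hq⟩

/-- Vertices of a cell that are not on a common side in the west or south are not adjacent on the
south-west path. -/
theorem Layout.not_adj_southWest {w h : ℕ} {Λ : Layout w h} {i j : ℕ} (hi : i < w) (hj : j < h)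
    {a b : CellVertex} (ha : a ∈ Λ.present i j) (hb : b ∈ Λ.present i j)
    (h1 : 0 < a.offset.1 ∨ 0 < b.offset.1) (h2 : 0 < a.offset.2 ∨ 0 < b.offset.2) :
    ¬ (southWestGraph (cellAt Λ.pos i j)).Adj (Λ.pos (cellIndex i j a)) (Λ.pos (cellIndex i j b)) := by
  intro hsw
  obtain ⟨a', b', p1, p2, p3, p4, e1, e2, hm⟩ := southWestGraph_adj hsw
  obtain rfl := pos_cell_injective hi hj ha (Λ.mem_present i j _ p1 p2) e1
  obtain rfl := pos_cell_injective hi hj hb (Λ.mem_present i j _ p3 p4) e2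
  rcases hm with hm | hm
  · have := (CellVertex.southWestEdges_same_side _ hm).2.2.2.2.2
    dsimp only at this
    omega
  · have := (CellVertex.southWestEdges_same_side _ hm).2.2.2.2.2
    dsimp only at this
    omega

namespace FrameGraph

variable {w h : ℕ} {S : GadgetSystem} {X : Tiling w h} (F : FrameGraph S X) (hw : 0 < w) (hh : 0 < h)

/-- The edges on the west and south sides of a cell belong to the base graph or to the north or east
side of another cell. -/
theorem adj_of_southWestGraph (c : Fin w × Fin h) {x y : Plane}
    (hxy : (southWestGraph (cellAt F.pos c.1 c.2)).Adj x y) :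
    (F.layout hw hh).baseGraph.Adj x y ∨
      ∃ c', (F.cellColor .black c' \ southWestGraph (cellAt F.pos c'.1 c'.2)).Adj x y := by
  obtain ⟨⟨i, hi⟩, ⟨j, hj⟩⟩ := c
  -- edges on the north and east sides
  have north : ∀ i' (hi' : i' < w), ∀ j' (hj' : j' < h), ∀ e' ∈ CellVertex.northEastEdges,
      (0 < e'.2.offset.1 ∨ 0 < e'.1.offset.1) → (0 < e'.2.offset.2 ∨ 0 < e'.1.offset.2) →
      ∃ c', (F.cellColor .black c' \ southWestGraph (cellAt F.pos c'.1 c'.2)).Adj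
        (F.pos (cellIndex i' j' e'.2)) (F.pos (cellIndex i' j' e'.1)) := by
    intro i' hi' j' hj' e' he' h1 h2
    obtain ⟨p1, p2, p3, p4, -⟩ := CellVertex.northEastEdges_spec e' he'
    have hb := (F.gadget ⟨i', hi'⟩ ⟨j', hj'⟩).boundary_black e' (List.mem_append_right _ he')
    refine ⟨(⟨i', hi'⟩, ⟨j', hj'⟩), F.cellColor_adj.2 ⟨e'.2, e'.1, by rwa [Sym2.eq_swap], rfl, rfl⟩, ?_⟩
    exact Layout.not_adj_southWest (Λ := F.layout hw hh) hi' hj'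
      ((F.layout hw hh).mem_present _ _ _ p3 p4) ((F.layout hw hh).mem_present _ _ _ p1 p2) h1 h2
  have key : ∀ e ∈ CellVertex.southWestEdges, F.pos (cellIndex i j e.1) ≠ F.pos (cellIndex i j e.2) →
      ((F.layout hw hh).baseGraph.Adj (F.pos (cellIndex i j e.1)) (F.pos (cellIndex i j e.2)) ∨
        ∃ c', (F.cellColor .black c' \ southWestGraph (cellAt F.pos c'.1 c'.2)).Adj
          (F.pos (cellIndex i j e.1)) (F.pos (cellIndex i j e.2))) := by
    intro e he hne
    have o1 := e.1.offset_fst_le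
    have o2 := e.1.offset_snd_le
    have o3 := e.2.offset_fst_le
    have o4 := e.2.offset_snd_le
    rcases CellVertex.southWestEdges_cases e he with ⟨h1, h2, h3, e', he', h5, h6⟩ |
      ⟨h1, h2, h3, e', he', h5, h6⟩
    · rcases Nat.eq_zero_or_pos i with rfl | hpos
      · left
        refine ⟨hne, Or.inl (Or.inr (Or.inl ⟨4 * j + e.2.offset.2, by omega, ?_, ?_⟩))⟩
        · change F.pos _ = F.pos _
          rw [cellIndex, h1, h3]
          rfl
        · change F.pos _ = F.pos _
          rw [cellIndex, h2]
      · right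
        have q1 : cellIndex i j e.1 = cellIndex (i - 1) j e'.2 := by
          rw [cellIndex, cellIndex, h1, h5]
          exact Prod.ext (by dsimp only; omega) rfl
        have q2 : cellIndex i j e.2 = cellIndex (i - 1) j e'.1 := by
          rw [cellIndex, cellIndex, h2, h6]
          exact Prod.ext (by dsimp only; omega) rfl
        rw [q1, q2]
        exact north (i - 1) (by omega) j hj e' he' (Or.inl (by rw [h5]; omega))
          (Or.inl (by rw [h5]; dsimp only; omega))
    · rcases Nat.eq_zero_or_pos j with rfl | hpos
      · left
        refine ⟨hne, Or.inr (Or.inr (Or.inr ⟨4 * i + e.1.offset.1, by omega, ?_, ?_⟩))⟩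
        · change F.pos _ = F.pos _
          rw [cellIndex, h2, h3]
          rfl
        · change F.pos _ = F.pos _
          rw [cellIndex, h1]
      · right
        have q1 : cellIndex i j e.1 = cellIndex i (j - 1) e'.2 := by
          rw [cellIndex, cellIndex, h1, h5]
          exact Prod.ext rfl (by dsimp only; omega)
        have q2 : cellIndex i j e.2 = cellIndex i (j - 1) e'.1 := by
          rw [cellIndex, cellIndex, h2, h6]
          exact Prod.ext rfl (by dsimp only; omega)
        rw [q1, q2]
        exact north i hi (j - 1) (by omega) e' he' (Or.inr (by rw [h6]; dsimp only; omega))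
          (Or.inl (by rw [h5]; omega))
  rcases hxy.2 with ⟨e, he, rfl, rfl⟩ | ⟨e, he, rfl, rfl⟩
  · exact key e he hxy.1
  · rcases key e he hxy.1.symm with H | ⟨c', H⟩
    · exact Or.inl H.symm
    · exact Or.inr ⟨c', H.symm⟩

/-- Black side edges occur in both adjacent cells. Keeping them only as north or east sides, and
those of the first column and bottom row in the base graph, writes the black graph as an
edge-disjoint union. -/
theorem colorGraph_black_adj (x y : Plane) : (F.colorGraph .black).Adj x y ↔
    (F.layout hw hh).baseGraph.Adj x y ∨
      ∃ c, (F.cellColor .black c \ southWestGraph (cellAt F.pos c.1 c.2)).Adj x y := by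
  have cell : ∀ c x y, (F.cellColor .black c).Adj x y → (F.colorGraph .black).Adj x y := by
    rintro c x y ⟨hne, ⟨a, b, hab, e⟩ | ⟨a, b, hab, e⟩⟩
    · exact ⟨hne, Or.inl (Or.inl ⟨c.1, c.2, a, b, hab, e⟩)⟩
    · exact ⟨hne, Or.inr (Or.inl ⟨c.1, c.2, a, b, hab, e⟩)⟩
  have side : ∀ i (hi : i < w), ∀ j (hj : j < h), ∀ e ∈ CellVertex.southWestEdges,
      (F.colorGraph .black).Adj (F.pos (cellIndex i j e.1)) (F.pos (cellIndex i j e.2)) :=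
    fun i hi j hj e he => cell (⟨i, hi⟩, ⟨j, hj⟩) _ _ (F.southWestGraph_le_cellColor _
      (Layout.southWestGraph_adj_of_mem (Λ := F.layout hw hh) hi hj (Or.inl he)))
  constructor
  · intro hxy
    have hcell : ∀ i j a b, (F.gadget i j).color s(a, b) = some .black →
        (F.layout hw hh).baseGraph.Adj (F.cell i j a) (F.cell i j b) ∨
          ∃ c, (F.cellColor .black c \ southWestGraph (cellAt F.pos c.1 c.2)).Adj
            (F.cell i j a) (F.cell i j b) := by
      intro i j a b hab
      by_cases hsw : (southWestGraph (cellAt F.pos i j)).Adj (F.cell i j a) (F.cell i j b)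
      · exact F.adj_of_southWestGraph hw hh (i, j) hsw
      · exact Or.inr ⟨(i, j), F.cellColor_adj.2 ⟨a, b, hab, rfl, rfl⟩, hsw⟩
    rcases hxy with ⟨hne, (⟨i, j, a, b, hab, rfl, rfl⟩ | ⟨-, e⟩) | (⟨i, j, a, b, hab, rfl, rfl⟩ | ⟨-, e⟩)⟩
    · exact hcell i j a b hab
    · exact Or.inl ⟨hne, Or.inl (Or.inl e)⟩
    · rcases hcell i j a b hab with H | ⟨c', H⟩
      · exact Or.inl H.symm
      · exact Or.inr ⟨c', H.symm⟩
    · exact Or.inl ⟨hne, Or.inr (Or.inl e)⟩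
  · have base : ∀ x y, x ≠ y → ((x = F.cone ∧ ((∃ n ≤ 4 * h, y = F.pos (0, n)) ∨
        ∃ m ≤ 4 * w, y = F.pos (m, 0))) ∨
        (∃ n < 4 * h, x = F.pos (0, n + 1) ∧ y = F.pos (0, n)) ∨
        (∃ m < 4 * w, x = F.pos (m + 1, 0) ∧ y = F.pos (m, 0))) → (F.colorGraph .black).Adj x y := by
      rintro x y hne (⟨rfl, e⟩ | ⟨n, hn, rfl, rfl⟩ | ⟨m, hm, rfl, rfl⟩)
      · exact ⟨hne, Or.inl (Or.inr ⟨rfl, rfl, e⟩)⟩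
      · obtain ⟨e, he, h1, h2⟩ := CellVertex.exists_west_edge (n % 4) (by omega)
        have := side 0 hw (n / 4) (by omega) e he
        rw [cellIndex, cellIndex, h1, h2] at this
        dsimp only at this
        rwa [show 4 * (n / 4) + (n % 4 + 1) = n + 1 by omega,
          show 4 * (n / 4) + n % 4 = n by omega] at this
      · obtain ⟨e, he, h1, h2⟩ := CellVertex.exists_south_edge (m % 4) (by omega)
        have := side (m / 4) (by omega) 0 hh e he
        rw [cellIndex, cellIndex, h1, h2] at this
        dsimp only at this
        rw [show 4 * (m / 4) + (m % 4 + 1) = m + 1 by omega,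
          show 4 * (m / 4) + m % 4 = m by omega] at this
        exact this.symm
    rintro (⟨hne, H | H⟩ | ⟨c, H⟩)
    · exact base x y hne H
    · exact (base y x hne.symm H).symm
    · exact cell c x y H.1

/-- The side degrees are added on the left instead of subtracted on the right, which avoids
truncated subtraction and is the form of `IsModel.degree`. -/
theorem cardinalDegree_colorGraph_black (d : Dir) (v : Plane) :
    cardinalDegree (F.colorGraph .black) d v +
      ∑ c : Fin w × Fin h, cardinalDegree (southWestGraph (cellAt F.pos c.1 c.2)) d v =
    cardinalDegree (F.layout hw hh).baseGraph d v +
      ∑ c, cardinalDegree (F.cellColor .black c) d v := by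
  have hown := F.cellColor_isOwnFamily hw hh .black
  have h1 := cardinalDegree_eq_add_sum (G := F.colorGraph .black) (V := F.verts) (v := v) (by
      intro x y hxy
      rcases (F.colorGraph_black_adj hw hh x y).1 hxy with H | ⟨c, H⟩
      · exact Layout.baseGraph_mem H
      · exact F.cellColor_mem H.1)
    (fun u => F.colorGraph_black_adj hw hh v u) (fun u c => hown.not_adj_base (c := c))
    (fun u c c' => hown.eq_of_adj) d
  rw [h1, add_assoc, ← Finset.sum_add_distrib]
  congr 1
  exact Finset.sum_congr rfl fun c _ => cardinalDegree_sdiff_add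
    (fun _ _ hxy => F.cellColor_mem hxy) (F.southWestGraph_le_cellColor c) d v

/-- The position of a cell vertex determines its index. -/
theorem cellIndex_eq_of_cell_eq (c : Fin w × Fin h) {a : CellVertex}
    (ha : a ∈ (F.gadget c.1 c.2).verts) {k : ℕ × ℕ} (hk : (F.layout hw hh).Used k)
    (e : F.pos k = F.cell c.1 c.2 a) : k = cellIndex c.1 c.2 a := by
  rw [← F.present_eq c.1 c.2] at ha
  exact Layout.pos_injOn hk (Layout.used_of_cell (Λ := F.layout hw hh) c.1.2 c.2.2 ha) e

theorem cellColor_balanced_of {γ : Hue} {d : Dir} {v : Plane} {c : Fin w × Fin h}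
    (H : ∀ a ∈ (F.gadget c.1 c.2).verts, v = F.cell c.1 c.2 a → (F.gadget c.1 c.2).BalancedAt a) :
    cardinalDegree (F.cellColor (.tint γ .light) c) d v =
      cardinalDegree (F.cellColor (.tint γ .dark) c) d v := by
  by_cases hv : ∃ a ∈ (F.gadget c.1 c.2).verts, v = F.cell c.1 c.2 a
  · obtain ⟨a, ha, rfl⟩ := hv
    rw [F.cardinalDegree_cellColor _ c ha, F.cardinalDegree_cellColor _ c ha]
    exact H a ha rfl γ d
  · push Not at hv
    rw [F.cardinalDegree_cellColor_eq_zero _ c hv, F.cardinalDegree_cellColor_eq_zero _ c hv]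

/-- A vertex inside a side of an inner vertical path lies in exactly two cells, whose tile sides
match. On the first and last path nothing passes through the side, and each gadget is balanced on
its own. -/
theorem cellColor_balanced_vertical {k : ℕ × ℕ} (hk : (F.layout hw hh).Used k) (h1 : k.1 % 4 = 0)
    (h2 : k.2 % 4 ≠ 0) (γ : Hue) (d : Dir) :
    ∑ c, cardinalDegree (F.cellColor (.tint γ .light) c) d (F.pos k) =
      ∑ c, cardinalDegree (F.cellColor (.tint γ .dark) c) d (F.pos k) := by
  have hle := hk.le
  have key : ∀ (c : Fin w × Fin h), ∀ a ∈ (F.gadget c.1 c.2).verts, F.pos k = F.cell c.1 c.2 a →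
      ∃ t, (4 * (c.1 : ℕ) = k.1 ∧ a = CellVertex.sideVertex .west t) ∨
        (4 * (c.1 : ℕ) + 4 = k.1 ∧ a = CellVertex.sideVertex .east t) := by
    intro c a ha e
    have e' := F.cellIndex_eq_of_cell_eq hw hh c ha hk e
    rw [e'] at h1 h2 ⊢
    simp only [cellIndex] at h1 h2 ⊢
    obtain ⟨t, ⟨h3, h4⟩ | ⟨h3, h4⟩⟩ := CellVertex.eq_sideVertex_vertical a (by omega) (by omega)
    · exact ⟨t, Or.inl ⟨by omega, h4⟩⟩
    · exact ⟨t, Or.inr ⟨by omega, h4⟩⟩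
  by_cases hin : 0 < k.1 ∧ k.1 < 4 * w
  · obtain ⟨i, hi⟩ : ∃ i, k.1 = 4 * i + 4 := ⟨k.1 / 4 - 1, by omega⟩
    obtain ⟨a, ha, e⟩ := hk.exists_cell (i := i) (j := k.2 / 4) (by omega) (by omega) (by omega)
      (by omega)
    have e1 := congrArg Prod.fst e
    have e2 := congrArg Prod.snd e
    simp only [cellIndex] at e1 e2
    have ho : a.offset.1 = 4 := by omega
    obtain ⟨t, ⟨h3, -⟩ | ⟨-, rfl⟩⟩ := CellVertex.eq_sideVertex_vertical a (by omega) (by omega)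
    · omega
    obtain ⟨⟨s1, s2, s3⟩, -⟩ := CellVertex.offset_sideVertex t
    let c : Fin w × Fin h := (⟨i, by omega⟩, ⟨k.2 / 4, by omega⟩)
    let c' : Fin w × Fin h := (⟨i + 1, by omega⟩, ⟨k.2 / 4, by omega⟩)
    have hv : F.pos k = F.cell c.1 c.2 (CellVertex.sideVertex .east t) := congrArg F.pos e
    have hv' : F.pos k = F.cell c'.1 c'.2 (CellVertex.sideVertex .west t) := by
      refine congrArg F.pos (e.trans ?_)
      rw [cellIndex, s3.symm, s2, s1]
      exact Prod.ext (by dsimp only [c']; omega) rfl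
    have hcc : c' ≠ c := fun e => by
      have := congrArg (fun c : Fin w × Fin h => (c.1 : ℕ)) e
      simp [c, c'] at this
    refine (sum_eq_iff_of_eq_off_pair hcc fun c'' n1 n2 => F.cellColor_balanced_of ?_).2 ?_
    · intro a ha ea
      exfalso
      have e' := F.cellIndex_eq_of_cell_eq hw hh c'' ha hk ea
      have e3 := congrArg Prod.snd e'
      simp only [cellIndex] at e3
      have ho' := a.offset_snd_le
      have hc2 : (c''.2 : ℕ) = k.2 / 4 := by omega
      obtain ⟨t', ⟨h3, -⟩ | ⟨h3, -⟩⟩ := key c'' a ha ea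
      · exact n2 (Prod.ext (Fin.ext (by dsimp only [c']; omega)) (Fin.ext hc2))
      · exact n1 (Prod.ext (Fin.ext (by dsimp only [c]; omega)) (Fin.ext hc2))
    · have m := (F.gadget c.1 c.2).mem_verts_of_ne (CellVertex.sideVertex_ne .east t).1
        (CellVertex.sideVertex_ne .east t).2
      have m' := (F.gadget c'.1 c'.2).mem_verts_of_ne (CellVertex.sideVertex_ne .west t).1
        (CellVertex.sideVertex_ne .west t).2
      have hB := S.balanced_horizontal (X.tile c.1 c.2) (X.tile c'.1 c'.2)
        (X.horizontal c.1 c'.1 c.2 rfl) t γ d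
      rw [hv, F.cardinalDegree_cellColor _ c m, F.cardinalDegree_cellColor _ c m, ← hv, hv',
        F.cardinalDegree_cellColor _ c' m', F.cardinalDegree_cellColor _ c' m']
      exact hB
  · refine Finset.sum_congr rfl fun c _ => F.cellColor_balanced_of fun a ha ea => ?_
    obtain ⟨t, ⟨h3, rfl⟩ | ⟨h3, rfl⟩⟩ := key c a ha ea
    · exact S.balanced_free _ .west (X.west_end c.1 c.2 (by have := c.1.2; omega)) t
    · exact S.balanced_free _ .east (X.east_end c.1 c.2 (by have := c.1.2; omega)) t

theorem cellColor_balanced_horizontal {k : ℕ × ℕ} (hk : (F.layout hw hh).Used k) (h1 : k.1 % 4 ≠ 0)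
    (h2 : k.2 % 4 = 0) (γ : Hue) (d : Dir) :
    ∑ c, cardinalDegree (F.cellColor (.tint γ .light) c) d (F.pos k) =
      ∑ c, cardinalDegree (F.cellColor (.tint γ .dark) c) d (F.pos k) := by
  have hle := hk.le
  have key : ∀ (c : Fin w × Fin h), ∀ a ∈ (F.gadget c.1 c.2).verts, F.pos k = F.cell c.1 c.2 a →
      ∃ t, (4 * (c.2 : ℕ) = k.2 ∧ a = CellVertex.sideVertex .south t) ∨
        (4 * (c.2 : ℕ) + 4 = k.2 ∧ a = CellVertex.sideVertex .north t) := by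
    intro c a ha e
    have e' := F.cellIndex_eq_of_cell_eq hw hh c ha hk e
    rw [e'] at h1 h2 ⊢
    simp only [cellIndex] at h1 h2 ⊢
    obtain ⟨t, ⟨h3, h4⟩ | ⟨h3, h4⟩⟩ := CellVertex.eq_sideVertex_horizontal a (by omega) (by omega)
    · exact ⟨t, Or.inl ⟨by omega, h4⟩⟩
    · exact ⟨t, Or.inr ⟨by omega, h4⟩⟩
  by_cases hin : 0 < k.2 ∧ k.2 < 4 * h
  · obtain ⟨j, hj⟩ : ∃ j, k.2 = 4 * j + 4 := ⟨k.2 / 4 - 1, by omega⟩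
    obtain ⟨a, ha, e⟩ := hk.exists_cell (i := k.1 / 4) (j := j) (by omega) (by omega) (by omega)
      (by omega)
    have e1 := congrArg Prod.fst e
    have e2 := congrArg Prod.snd e
    simp only [cellIndex] at e1 e2
    have ho : a.offset.2 = 4 := by omega
    obtain ⟨t, ⟨h3, -⟩ | ⟨-, rfl⟩⟩ := CellVertex.eq_sideVertex_horizontal a (by omega) (by omega)
    · omega
    obtain ⟨-, s1, s2, s3⟩ := CellVertex.offset_sideVertex t
    let c : Fin w × Fin h := (⟨k.1 / 4, by omega⟩, ⟨j, by omega⟩)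
    let c' : Fin w × Fin h := (⟨k.1 / 4, by omega⟩, ⟨j + 1, by omega⟩)
    have hv : F.pos k = F.cell c.1 c.2 (CellVertex.sideVertex .north t) := congrArg F.pos e
    have hv' : F.pos k = F.cell c'.1 c'.2 (CellVertex.sideVertex .south t) := by
      refine congrArg F.pos (e.trans ?_)
      rw [cellIndex, s3.symm, s2, s1]
      exact Prod.ext rfl (by dsimp only [c']; omega)
    have hcc : c' ≠ c := fun e => by
      have := congrArg (fun c : Fin w × Fin h => (c.2 : ℕ)) e
      simp [c, c'] at this
    refine (sum_eq_iff_of_eq_off_pair hcc fun c'' n1 n2 => F.cellColor_balanced_of ?_).2 ?_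
    · intro a ha ea
      exfalso
      have e' := F.cellIndex_eq_of_cell_eq hw hh c'' ha hk ea
      have e3 := congrArg Prod.fst e'
      simp only [cellIndex] at e3
      have ho' := a.offset_fst_le
      have hc1 : (c''.1 : ℕ) = k.1 / 4 := by omega
      obtain ⟨t', ⟨h3, -⟩ | ⟨h3, -⟩⟩ := key c'' a ha ea
      · exact n2 (Prod.ext (Fin.ext hc1) (Fin.ext (by dsimp only [c']; omega)))
      · exact n1 (Prod.ext (Fin.ext hc1) (Fin.ext (by dsimp only [c]; omega)))
    · have m := (F.gadget c.1 c.2).mem_verts_of_ne (CellVertex.sideVertex_ne .north t).1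
        (CellVertex.sideVertex_ne .north t).2
      have m' := (F.gadget c'.1 c'.2).mem_verts_of_ne (CellVertex.sideVertex_ne .south t).1
        (CellVertex.sideVertex_ne .south t).2
      have hB := S.balanced_vertical (X.tile c.1 c.2) (X.tile c'.1 c'.2)
        (X.vertical c.1 c.2 c'.2 rfl) t γ d
      rw [hv, F.cardinalDegree_cellColor _ c m, F.cardinalDegree_cellColor _ c m, ← hv, hv',
        F.cardinalDegree_cellColor _ c' m', F.cardinalDegree_cellColor _ c' m']
      exact hB
  · refine Finset.sum_congr rfl fun c _ => F.cellColor_balanced_of fun a ha ea => ?_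
    obtain ⟨t, ⟨h3, rfl⟩ | ⟨h3, rfl⟩⟩ := key c a ha ea
    · exact S.balanced_free _ .south (X.south_end c.1 c.2 (by have := c.2.2; omega)) t
    · exact S.balanced_free _ .north (X.north_end c.1 c.2 (by have := c.2.2; omega)) t

/-- Every vertex has in each direction as many light as dark edges of each hue. -/
theorem cellColor_balanced (hw : 0 < w) (hh : 0 < h) {v : Plane} (hv : v ∈ F.verts) (γ : Hue) (d : Dir) :
    ∑ c, cardinalDegree (F.cellColor (.tint γ .light) c) d v =
      ∑ c, cardinalDegree (F.cellColor (.tint γ .dark) c) d v := by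
  rcases Layout.mem_verts_iff (Λ := F.layout hw hh).1 hv with rfl | ⟨k, hk, rfl⟩
  · refine Finset.sum_congr rfl fun c _ => F.cellColor_balanced_of fun a ha ea => ?_
    rw [← F.present_eq c.1 c.2] at ha
    exact absurd ea.symm
      (Layout.pos_ne_cone (Layout.used_of_cell (Λ := F.layout hw hh) c.1.2 c.2.2 ha))
  by_cases h1 : k.1 % 4 = 0
  · by_cases h2 : k.2 % 4 = 0
    · refine Finset.sum_congr rfl fun c _ => F.cellColor_balanced_of fun a ha ea => ?_
      rw [F.cellIndex_eq_of_cell_eq hw hh c ha hk ea] at h1 h2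
      simp only [cellIndex] at h1 h2
      exact S.balanced_corner _ a (CellVertex.mem_corners_of_offset a (by omega) (by omega))
    · exact F.cellColor_balanced_vertical hw hh hk h1 h2 γ d
  · by_cases h2 : k.2 % 4 = 0
    · exact F.cellColor_balanced_horizontal hw hh hk h1 h2 γ d
    · refine Finset.sum_congr rfl fun c _ => F.cellColor_balanced_of fun a ha ea => ?_
      rw [F.cellIndex_eq_of_cell_eq hw hh c ha hk ea] at h1 h2
      simp only [cellIndex] at h1 h2
      rcases CellVertex.eq_p_or_q_of_offset a (by omega) (by omega) with rfl | rfl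
      · exact S.balanced_p _
      · exact S.balanced_q _

theorem card_own (c : Fin w × Fin h) : ((F.layout hw hh).own c.1 c.2).card =
    7 + (F.gadget c.1 c.2).hasP.toNat + (F.gadget c.1 c.2).hasQ.toNat := by
  have h1 := (F.layout hw hh).card_present c.1 c.2
  have h2 := (F.gadget c.1 c.2).card_verts
  rw [← F.present_eq c.1 c.2] at h2
  change (F.present c.1 c.2).card = _ at h1
  omega

theorem cardinalDegree_eq {T : SimpleGraph Plane} (hT : IsRealization F.signature T) (d : Dir)
    {v : Plane} (hv : v ∈ F.verts) : cardinalDegree T d v =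
      cardinalDegree (F.colorGraph .black) d v +
        (∑ c : Hue, ∑ s : Shade, cardinalDegree (F.colorGraph (.tint c s)) d v) / 2 := by
  have h2 := hT.2
  simp only [signatureOf, signature, CardinalSignature.mk.injEq, heq_eq_eq, true_and] at h2
  exact congrFun (congrFun h2 d) ⟨v, hv⟩

/-- The edges of the light local coloring are a model for every realization of the signature. -/
theorem isModel {T : SimpleGraph Plane} (hT : IsRealization F.signature T) :
    (F.layout hw hh).IsModel (fun c => (F.gadget c.1 c.2).edges fun _ => .light) T where
  psl := hT.1
  present c _ _ hab := F.edges_present hw hh _ c hab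
  loop c a := F.edges_loop _ c a
  southWest c _ he := ⟨_, (F.gadget c.1 c.2).color_southWest he, trivial⟩
  ncard c := by
    rw [F.card_own]
    refine ((F.gadget c.1 c.2).edge_count fun _ => .light).trans ?_
    ring
  degree d v hv := by
    have h1 := F.cardinalDegree_eq hT d hv
    have h2 := F.cardinalDegree_colorGraph_black hw hh d v
    have h3 : ∀ c : Fin w × Fin h, cardinalDegree (drawn (cellAt F.pos c.1 c.2)
        ((F.gadget c.1 c.2).edges fun _ => .light)) d v = cardinalDegree (F.cellColor .black c) d v +
        cardinalDegree (F.cellColor (.tint .red .light) c) d v +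
        cardinalDegree (F.cellColor (.tint .blue .light) c) d v := fun c => by
      have := F.cardinalDegree_graph_eq (fun _ => .light) c v d
      rw [Gadget.graph_eq_drawn] at this
      exact this
    -- By balance, the light and dark totals agree at every vertex, so the halving in the signature
    -- is exact and leaves the light degrees.
    have h4 : ∀ γ, ∑ s : Shade, cardinalDegree (F.colorGraph (.tint γ s)) d v =
        2 * ∑ c, cardinalDegree (F.cellColor (.tint γ .light) c) d v := fun γ => by
      rw [show (Finset.univ : Finset Shade) = {.light, .dark} from rfl, Finset.sum_pair (by decide),
        F.cardinalDegree_colorGraph_tint, F.cardinalDegree_colorGraph_tint,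
        ← F.cellColor_balanced hw hh hv γ d, two_mul]
    rw [show (Finset.univ : Finset Hue) = {.red, .blue} from rfl, Finset.sum_pair (by decide),
      h4, h4] at h1
    change _ + ∑ c : Fin w × Fin h, cardinalDegree (southWestGraph (cellAt F.pos c.1 c.2)) d v =
      _ + ∑ c : Fin w × Fin h, cardinalDegree (drawn (cellAt F.pos c.1 c.2)
        ((F.gadget c.1 c.2).edges fun _ => .light)) d v
    rw [Finset.sum_congr rfl fun c _ => h3 c, Finset.sum_add_distrib, Finset.sum_add_distrib]
    omega

end FrameGraph

/-! ### Induction over the cells -/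

namespace CellVertex

/-- In direction `d` from `a`, there are only vertices on the west or south side that contains `a`. -/
def PathOnly (d : Dir) (a : CellVertex) : Prop :=
  ∀ b, Toward d a b → (a.offset.1 = 0 ∧ b.offset.1 = 0) ∨ (a.offset.2 = 0 ∧ b.offset.2 = 0)

instance (d : Dir) (a : CellVertex) : Decidable (PathOnly d a) := by
  unfold PathOnly; infer_instance

instance (d : Dir) (a : CellVertex) : Decidable (Unconstrained d a) := by
  cases d <;> unfold Unconstrained <;> infer_instance

/-- The vertices inside the west and south sides. -/
def southWestSideInner : List CellVertex := [b5, b6, b7, v5, v6, v7]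

/-- A constrained direction at a vertex of a cell that is a vertex of a second cell, too, and not
inside the west or south side of the first cell. -/
theorem pathOnly_or_corner : ∀ (d : Dir) (a a' : CellVertex), a ≠ a' →
    (a.offset.1 = a'.offset.1 ∨ (a.offset.1 = 0 ∧ a'.offset.1 = 4) ∨
      (a.offset.1 = 4 ∧ a'.offset.1 = 0)) →
    (a.offset.2 = a'.offset.2 ∨ (a.offset.2 = 0 ∧ a'.offset.2 = 4) ∨
      (a.offset.2 = 4 ∧ a'.offset.2 = 0)) →
    a ∉ southWestSideInner → ¬ Unconstrained d a → PathOnly d a ∨ PathOnly d a' ∨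
      (a' ∈ corners ∧ a.offset.1 ≤ a'.offset.1 ∧ a.offset.2 ≤ a'.offset.2) := by
  intro d
  cases d <;> decide

theorem westBoundary_cases : ∀ a ∈ westBoundary, (a ∈ corners ∧ a ∉ southWestSideInner) ∨
    ∃ t, a = sideVertex .west t := by decide

theorem southBoundary_cases : ∀ a ∈ southBoundary, (a ∈ corners ∧ a ∉ southWestSideInner) ∨
    ∃ t, a = sideVertex .south t := by decide

theorem mem_southWestSideInner : ∀ a ∈ southWestSideInner, a ∈ westBoundary ∨ a ∈ southBoundary := by
  decide

theorem offset_sideVertex_pos : ∀ t : Fin 3,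
    (0 < (sideVertex .west t).offset.2 ∧ (sideVertex .west t).offset.2 < 4) ∧
    0 < (sideVertex .south t).offset.1 ∧ (sideVertex .south t).offset.1 < 4 := by decide

set_option maxRecDepth 10000 in
theorem northEastEdges_cases : ∀ e ∈ northEastEdges,
    (e.1.offset.1 = 4 ∧ e.2.offset.1 = 4 ∧ e.2.offset.2 = e.1.offset.2 + 1) ∨
    (e.1.offset.2 = 4 ∧ e.2.offset.2 = 4 ∧ e.1.offset.1 = e.2.offset.1 + 1) := by decide

end CellVertex

namespace Layout

variable {w h : ℕ} {Λ : Layout w h} {T : SimpleGraph Plane}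

/-- An edge in such a direction joins two vertices of the west or of the south side. Within the cell
region it must be an edge of this side, so the degree does not depend on the graph. -/
theorem cardinalDegree_of_pathOnly {i j : ℕ} (hi : i < w) (hj : j < h) {G : SimpleGraph Plane}
    (hmem : ∀ x y, G.Adj x y → x ∈ Λ.cellPoints i j ∧ y ∈ Λ.cellPoints i j)
    (hreg : ∀ x y, G.Adj x y → segment ℝ x y ⊆ cellRegion (cellAt Λ.pos i j))
    (hsw : southWestGraph (cellAt Λ.pos i j) ≤ G) {a : CellVertex} (ha : a ∈ Λ.present i j) {d : Dir}
    (hp : CellVertex.PathOnly d a) : cardinalDegree G d (Λ.pos (cellIndex i j a)) =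
      cardinalDegree (southWestGraph (cellAt Λ.pos i j)) d (Λ.pos (cellIndex i j a)) := by
  unfold cardinalDegree
  congr 1
  ext u
  refine ⟨fun hu => ⟨?_, hu.2⟩, fun hu => ⟨hsw hu.1, hu.2⟩⟩
  obtain ⟨b, hb, rfl⟩ := mem_cellPoints.1 (hmem _ _ hu.1).2
  exact southWestGraph_adj_of_mem hi hj (mem_southWestEdges_of_inside hi hj
    (fun e => hu.1.ne (by rw [e])) (hreg _ _ hu.1) (hp b ((toward_iff hi hj ha hb d).1 hu.2)))

theorem IsFramed.boundaryGraph_le (hT : Λ.IsFramed T) {i j : ℕ} (hi : i < w) (hj : j < h) :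
    boundaryGraph (cellAt Λ.pos i j) ≤ Λ.cellPart T i j := by
  have key : ∀ e ∈ CellVertex.boundaryEdges, Λ.pos (cellIndex i j e.1) ≠ Λ.pos (cellIndex i j e.2) →
      (Λ.cellPart T i j).Adj (Λ.pos (cellIndex i j e.1)) (Λ.pos (cellIndex i j e.2)) := by
    intro e he hne
    rcases List.mem_append.1 he with he | he
    · exact hT.southWestGraph_le hi hj ⟨hne, Or.inl ⟨e, he, rfl, rfl⟩⟩
    · obtain ⟨p1, p2, p3, p4, -⟩ := CellVertex.northEastEdges_spec e he
      have m1 := Λ.mem_present i j _ p1 p2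
      have m2 := Λ.mem_present i j _ p3 p4
      have := e.1.offset_fst_le
      have := e.1.offset_snd_le
      have := e.2.offset_fst_le
      have := e.2.offset_snd_le
      have hadj : T.Adj (Λ.pos (cellIndex i j e.1)) (Λ.pos (cellIndex i j e.2)) := by
        rcases CellVertex.northEastEdges_cases e he with ⟨h1, h2, h3⟩ | ⟨h1, h2, h3⟩
        · have H := (hT.path (i + 1) (by omega) (4 * j + e.1.offset.2) (by omega)).symm
          rw [cellIndex, cellIndex, h1, h2, h3]
          exact H
        · have H := hT.row (j + 1) (by omega) (4 * i + e.2.offset.1) (by omega)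
          rw [cellIndex, cellIndex, h1, h2, h3]
          exact H
      refine ⟨hadj, ⟨_, m1, rfl⟩, ⟨_, m2, rfl⟩, hT.segment_subset hi hj m1 m2 hadj ?_ ?_⟩
      · rcases CellVertex.northEastEdges_cases e he with h | h <;> omega
      · rcases CellVertex.northEastEdges_cases e he with h | h <;> omega
  rintro x y ⟨hne, ⟨e, he, rfl, rfl⟩ | ⟨e, he, rfl, rfl⟩⟩
  · exact key e he hne
  · exact (key e he hne.symm).symm

end Layout

namespace FrameGraph

variable {w h : ℕ} {S : GadgetSystem} {X : Tiling w h} {F : FrameGraph S X} {T : SimpleGraph Plane}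

/-- The part of a graph in a cell of a frame graph. -/
noncomputable def part (F : FrameGraph S X) (T : SimpleGraph Plane) (c : Fin w × Fin h) :
    SimpleGraph Plane :=
  (F.layout c.1.pos c.2.pos).cellPart T c.1 c.2

/-- The graph of a local coloring in a cell of a frame graph. -/
def coloring (F : FrameGraph S X) (χ : LocalColoring) (c : Fin w × Fin h) : SimpleGraph Plane :=
  (F.gadget c.1 c.2).graph (F.cell c.1 c.2) χ

theorem part_le (c : Fin w × Fin h) : F.part T c ≤ T := fun _ _ hxy => hxy.1

theorem mem_present {c : Fin w × Fin h} {a : CellVertex} (ha : a ∈ (F.gadget c.1 c.2).verts) :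
    a ∈ (F.layout c.1.pos c.2.pos).present c.1 c.2 := by
  rw [← F.present_eq c.1 c.2] at ha
  exact ha

theorem points_eq (c : Fin w × Fin h) :
    (F.gadget c.1 c.2).points (F.cell c.1 c.2) = (F.layout c.1.pos c.2.pos).cellPoints c.1 c.2 := by
  rw [Gadget.points, ← F.present_eq c.1 c.2]
  rfl

theorem sum_part (hT : IsRealization F.signature T) (d : Dir) {v : Plane} (hv : v ∈ F.verts)
    (c : Fin w × Fin h) : ∑ c, cardinalDegree (F.part T c) d v =
      ∑ c, cardinalDegree (F.coloring (fun _ => .light) c) d v := by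
  refine ((F.isModel c.1.pos c.2.pos hT).sum_cellPart d hv).trans (Finset.sum_congr rfl fun c' _ => ?_)
  rw [coloring, Gadget.graph_eq_drawn]
  rfl

theorem cell_mem {c : Fin w × Fin h} {a : CellVertex} (ha : a ∈ (F.gadget c.1 c.2).verts) :
    F.cell c.1 c.2 a ∈ F.verts :=
  (Layout.used_of_cell (Λ := F.layout c.1.pos c.2.pos) c.1.2 c.2.2 (mem_present ha)).mem

theorem cellIndex_eq {c c' : Fin w × Fin h} {a a' : CellVertex}
    (ha : a ∈ (F.gadget c.1 c.2).verts) (ha' : a' ∈ (F.gadget c'.1 c'.2).verts)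
    (e : F.cell c.1 c.2 a = F.cell c'.1 c'.2 a') : cellIndex c.1 c.2 a = cellIndex c'.1 c'.2 a' :=
  F.cellIndex_eq_of_cell_eq c.1.pos c.2.pos c' ha'
    (Layout.used_of_cell (Λ := F.layout c.1.pos c.2.pos) c.1.2 c.2.2 (mem_present ha)) e

theorem cardinalDegree_part_eq_zero (c : Fin w × Fin h) {v : Plane}
    (hv : ∀ a ∈ (F.gadget c.1 c.2).verts, v ≠ F.cell c.1 c.2 a) (d : Dir) :
    cardinalDegree (F.part T c) d v = 0 := by
  have : {u | (F.part T c).Adj v u ∧ Toward d v u} = ∅ := by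
    refine Set.eq_empty_of_forall_notMem fun u hu => ?_
    obtain ⟨a, ha, e⟩ := hu.1.2.1
    change a ∈ F.present c.1 c.2 at ha
    rw [F.present_eq c.1 c.2] at ha
    exact hv a ha e
  rw [cardinalDegree, this, Set.ncard_empty]

theorem part_eq_coloring_of_pathOnly (hT : IsRealization F.signature T) (χ : LocalColoring)
    (c : Fin w × Fin h) {a : CellVertex} (ha : a ∈ (F.gadget c.1 c.2).verts) {d : Dir}
    (hp : CellVertex.PathOnly d a) : cardinalDegree (F.part T c) d (F.cell c.1 c.2 a) =
      cardinalDegree (F.coloring χ c) d (F.cell c.1 c.2 a) := by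
  have hM := (F.isModel c.1.pos c.2.pos hT)
  refine (Layout.cardinalDegree_of_pathOnly c.1.2 c.2.2 (fun _ _ => Layout.cellPart_mem)
    (fun _ _ hxy => hxy.2.2.2) (hM.isFramed.southWestGraph_le c.1.2 c.2.2) (mem_present ha) hp).trans
    (Layout.cardinalDegree_of_pathOnly (Λ := F.layout c.1.pos c.2.pos) c.1.2 c.2.2 ?_
      (F.drawn_inside c.1 c.2 χ) ?_ (mem_present ha) hp).symm
  · intro x y hxy
    rw [Gadget.graph_eq_drawn] at hxy
    obtain ⟨a, b, hab, rfl, rfl⟩ := (Layout.drawn_adj (Λ := F.layout c.1.pos c.2.pos) c.1.2 c.2.2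
      (fun _ _ hab => F.edges_present _ _ χ c hab) (F.edges_loop χ c)).1 hxy
    have := F.edges_present c.1.pos c.2.pos χ c hab
    exact ⟨Layout.mem_cellPoints.2 ⟨a, this.1, rfl⟩, Layout.mem_cellPoints.2 ⟨b, this.2, rfl⟩⟩
  · rw [← drawn_southWestSet, Gadget.graph_eq_drawn]
    rintro x y ⟨hne, ⟨a, b, hab, e⟩ | ⟨a, b, hab, e⟩⟩
    · exact ⟨hne, Or.inl ⟨a, b, ⟨_, (F.gadget c.1 c.2).color_southWest hab, trivial⟩, e⟩⟩
    · exact ⟨hne, Or.inr ⟨a, b, ⟨_, (F.gadget c.1 c.2).color_southWest hab, trivial⟩, e⟩⟩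

/-- All local colorings have the same degrees at the corners. -/
theorem coloring_corner (χ χ' : LocalColoring) (c : Fin w × Fin h) {a : CellVertex}
    (ha : a ∈ CellVertex.corners) (d : Dir) : cardinalDegree (F.coloring χ c) d (F.cell c.1 c.2 a) =
      cardinalDegree (F.coloring χ' c) d (F.cell c.1 c.2 a) := by
  have m := (F.gadget c.1 c.2).mem_verts_of_ne (CellVertex.corners_ne a ha).1
    (CellVertex.corners_ne a ha).2
  have key : ∀ γ s s', (F.gadget c.1 c.2).tintDegree γ s d a =
      (F.gadget c.1 c.2).tintDegree γ s' d a := by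
    intro γ s s'
    have hB := S.balanced_corner (X.tile c.1 c.2) a ha γ d
    cases s <;> cases s'
    · rfl
    · exact hB
    · exact hB.symm
    · rfl
  rw [coloring, coloring, F.cardinalDegree_graph _ c m, F.cardinalDegree_graph _ c m,
    key .red (χ .red) (χ' .red), key .blue (χ .blue) (χ' .blue)]

/-- Degrees in the light local coloring, at vertices that are not inside the west or south side. -/
theorem part_eq_light (hT : IsRealization F.signature T) (c : Fin w × Fin h)
    (hIH : ∀ c' : Fin w × Fin h, c'.1 ≤ c.1 → c'.2 ≤ c.2 → c' ≠ c →
      ∃ χ, F.part T c' = F.coloring χ c')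
    {a : CellVertex} (ha : a ∈ (F.gadget c.1 c.2).verts) (hin : a ∉ CellVertex.southWestSideInner)
    {d : Dir} (hd : ¬ CellVertex.Unconstrained d a) :
    cardinalDegree (F.part T c) d (F.cell c.1 c.2 a) =
      cardinalDegree (F.coloring (fun _ => .light) c) d (F.cell c.1 c.2 a) := by
  by_cases hp : CellVertex.PathOnly d a
  · exact part_eq_coloring_of_pathOnly hT _ c ha hp
  -- The total over all cells is that of the light colorings, so it suffices that every other cell
  -- contributes as its light coloring does.
  refine (sum_eq_iff_of_eq_off c fun c' hne => ?_).1 (sum_part hT d (cell_mem ha) c)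
  by_cases hv : ∃ a' ∈ (F.gadget c'.1 c'.2).verts, F.cell c.1 c.2 a = F.cell c'.1 c'.2 a'
  · obtain ⟨a', ha', e⟩ := hv
    have ei := cellIndex_eq ha ha' e
    simp only [cellIndex, Prod.mk.injEq] at ei
    have := a.offset_fst_le
    have := a.offset_snd_le
    have := a'.offset_fst_le
    have := a'.offset_snd_le
    have haa : a ≠ a' := by
      rintro rfl
      exact hne (Prod.ext (Fin.ext (by omega)) (Fin.ext (by omega)))
    -- Either the other cell has only side edges in this direction, or it lies weakly south-west and
    -- has the vertex at a corner, where its coloring from the induction and the light one have the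
    -- same degrees.
    rcases CellVertex.pathOnly_or_corner d a a' haa (by omega) (by omega) hin hd with
      hp' | hp' | ⟨hc, h1, h2⟩
    · exact absurd hp' hp
    · rw [e]
      exact part_eq_coloring_of_pathOnly hT _ c' ha' hp'
    · obtain ⟨χ, hχ⟩ := hIH c' (Fin.le_def.2 (by omega)) (Fin.le_def.2 (by omega)) hne
      rw [e, hχ]
      exact coloring_corner _ _ c' hc d
  · push Not at hv
    rw [cardinalDegree_part_eq_zero c' hv, coloring, F.cardinalDegree_graph_eq_zero _ c' hv]

/-- Degrees at a vertex of exactly two cells. -/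
theorem part_eq_of_pair (hT : IsRealization F.signature T) {c c' : Fin w × Fin h} (hcc : c' ≠ c)
    {a a' : CellVertex} (ha : a ∈ (F.gadget c.1 c.2).verts) (ha' : a' ∈ (F.gadget c'.1 c'.2).verts)
    (e : F.cell c.1 c.2 a = F.cell c'.1 c'.2 a')
    (honly : ∀ c'', c'' ≠ c → c'' ≠ c' → ∀ b ∈ (F.gadget c''.1 c''.2).verts,
      F.cell c.1 c.2 a ≠ F.cell c''.1 c''.2 b)
    (hB : (F.gadget c'.1 c'.2).BalancedWith a' (F.gadget c.1 c.2) a) {χ : LocalColoring}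
    (hχ : F.part T c' = F.coloring χ c') (d : Dir) :
    cardinalDegree (F.part T c) d (F.cell c.1 c.2 a) =
      cardinalDegree (F.coloring χ c) d (F.cell c.1 c.2 a) := by
  have h1 := (sum_eq_iff_of_eq_off_pair hcc fun c'' n1 n2 => by
    rw [cardinalDegree_part_eq_zero c'' (honly c'' n1 n2), coloring,
      F.cardinalDegree_graph_eq_zero _ c'' (honly c'' n1 n2)]).1 (sum_part hT d (cell_mem ha) c)
  have hdeg : ∀ χ, cardinalDegree (F.coloring χ c) d (F.cell c.1 c.2 a) = _ := fun χ =>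
    F.cardinalDegree_graph χ c ha d
  have hdeg' : ∀ χ, cardinalDegree (F.coloring χ c') d (F.cell c.1 c.2 a) = _ := fun χ =>
    (by rw [e]; rfl : _ = cardinalDegree ((F.gadget c'.1 c'.2).graph (F.cell c'.1 c'.2) χ) d
      (F.cell c'.1 c'.2 a')).trans (F.cardinalDegree_graph χ c' ha' d)
  rw [hχ, hdeg, hdeg', hdeg'] at h1
  rw [hdeg]
  have hr := hB .red d
  have hb := hB .blue d
  generalize χ .red = r at h1 ⊢
  generalize χ .blue = b at h1 ⊢
  -- By balance of each hue, the light total of the two cells is also their total in the coloring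
  -- `χ`. Subtracting the degree of `χ` in `c'` leaves that of `χ` in `c`.
  cases r <;> cases b <;> omega

theorem part_eq_of_single (hT : IsRealization F.signature T) {c : Fin w × Fin h}
    {a : CellVertex} (ha : a ∈ (F.gadget c.1 c.2).verts)
    (honly : ∀ c', c' ≠ c → ∀ b ∈ (F.gadget c'.1 c'.2).verts,
      F.cell c.1 c.2 a ≠ F.cell c'.1 c'.2 b) (d : Dir) :
    cardinalDegree (F.part T c) d (F.cell c.1 c.2 a) =
      cardinalDegree (F.coloring (fun _ => .light) c) d (F.cell c.1 c.2 a) :=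
  (sum_eq_iff_of_eq_off c fun c' hne => by
    rw [cardinalDegree_part_eq_zero c' (honly c' hne), coloring,
      F.cardinalDegree_graph_eq_zero _ c' (honly c' hne)]).1 (sum_part hT d (cell_mem ha) c)

theorem matches_corner (hT : IsRealization F.signature T) (c : Fin w × Fin h)
    (hIH : ∀ c' : Fin w × Fin h, c'.1 ≤ c.1 → c'.2 ≤ c.2 → c' ≠ c →
      ∃ χ, F.part T c' = F.coloring χ c')
    {a : CellVertex} (ha : a ∈ CellVertex.corners) (hin : a ∉ CellVertex.southWestSideInner)
    (χ : LocalColoring) : (F.gadget c.1 c.2).Matches (F.cell c.1 c.2) (F.part T c) χ a := fun d hd =>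
  (part_eq_light hT c hIH ((F.gadget c.1 c.2).mem_verts_of_ne (CellVertex.corners_ne a ha).1
    (CellVertex.corners_ne a ha).2) hin hd).trans (coloring_corner _ _ c ha d)

/-- The inner vertices of the west side lie only in this cell and its western neighbor, so the
neighbor's coloring serves for all three at once, in every direction. The two corners match every
coloring. In the first column there is no neighbor and the light coloring serves. -/
theorem exists_matches_west (hT : IsRealization F.signature T) (c : Fin w × Fin h)
    (hIH : ∀ c' : Fin w × Fin h, c'.1 ≤ c.1 → c'.2 ≤ c.2 → c' ≠ c →
      ∃ χ, F.part T c' = F.coloring χ c') :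
    ∃ χ, ∀ a ∈ CellVertex.westBoundary,
      (F.gadget c.1 c.2).Matches (F.cell c.1 c.2) (F.part T c) χ a := by
  have m : ∀ (c : Fin w × Fin h) d t, CellVertex.sideVertex d t ∈ (F.gadget c.1 c.2).verts :=
    fun c d t => (F.gadget c.1 c.2).mem_verts_of_ne (CellVertex.sideVertex_ne d t).1
      (CellVertex.sideVertex_ne d t).2
  have other : ∀ t, ∀ c' : Fin w × Fin h, ∀ b ∈ (F.gadget c'.1 c'.2).verts,
      F.cell c.1 c.2 (CellVertex.sideVertex .west t) = F.cell c'.1 c'.2 b → c' ≠ c →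
      (c'.1 : ℕ) + 1 = c.1 ∧ c'.2 = c.2 := by
    intro t c' b hb e hne
    have ei := cellIndex_eq (m c .west t) hb e
    obtain ⟨⟨s1, -, -⟩, -⟩ := CellVertex.offset_sideVertex t
    obtain ⟨⟨s2, s3⟩, -⟩ := CellVertex.offset_sideVertex_pos t
    simp only [cellIndex, Prod.mk.injEq] at ei
    have := b.offset_fst_le
    have := b.offset_snd_le
    have h2 : c'.2 = c.2 := Fin.ext (by omega)
    refine ⟨?_, h2⟩
    by_contra hc
    exact hne (Prod.ext (Fin.ext (by omega)) h2)
  rcases Nat.eq_zero_or_pos (c.1 : ℕ) with h0 | hpos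
  · refine ⟨fun _ => .light, fun a ha => ?_⟩
    rcases CellVertex.westBoundary_cases a ha with ⟨h1, h2⟩ | ⟨t, rfl⟩
    · exact matches_corner hT c hIH h1 h2 _
    · exact fun d _ => part_eq_of_single hT (m c .west t)
        (fun c' hne b hb e => by have := (other t c' b hb e hne).1; omega) d
  · have hw := c.1.2
    obtain ⟨c', hc'1, hc'2⟩ : ∃ c' : Fin w × Fin h, (c'.1 : ℕ) + 1 = c.1 ∧ c'.2 = c.2 :=
      ⟨(⟨c.1 - 1, by omega⟩, c.2), by dsimp only; omega, rfl⟩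
    have hcc : c' ≠ c := fun e => by
      rw [e] at hc'1
      omega
    obtain ⟨χ, hχ⟩ := hIH c' (Fin.le_def.2 (by omega)) hc'2.le hcc
    refine ⟨χ, fun a ha => ?_⟩
    rcases CellVertex.westBoundary_cases a ha with ⟨h1, h2⟩ | ⟨t, rfl⟩
    · exact matches_corner hT c hIH h1 h2 _
    · obtain ⟨⟨s1, s2, s3⟩, -⟩ := CellVertex.offset_sideVertex t
      refine fun d _ => part_eq_of_pair hT hcc (m c .west t) (m c' .east t) ?_ ?_ ?_ hχ d
      · refine congrArg F.pos ?_
        rw [s1, s2, s3, hc'2, ← hc'1]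
        exact Prod.ext (by dsimp only; omega) rfl
      · intro c'' n1 n2 b hb e
        obtain ⟨h1, h2⟩ := other t c'' b hb e n1
        exact n2 (Prod.ext (Fin.ext (by omega)) (h2.trans hc'2.symm))
      · refine S.balanced_horizontal _ _ ?_ t
        rw [hc'2]
        exact X.horizontal _ _ _ hc'1.symm

theorem exists_matches_south (hT : IsRealization F.signature T) (c : Fin w × Fin h)
    (hIH : ∀ c' : Fin w × Fin h, c'.1 ≤ c.1 → c'.2 ≤ c.2 → c' ≠ c →
      ∃ χ, F.part T c' = F.coloring χ c') :
    ∃ χ, ∀ a ∈ CellVertex.southBoundary,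
      (F.gadget c.1 c.2).Matches (F.cell c.1 c.2) (F.part T c) χ a := by
  have m : ∀ (c : Fin w × Fin h) d t, CellVertex.sideVertex d t ∈ (F.gadget c.1 c.2).verts :=
    fun c d t => (F.gadget c.1 c.2).mem_verts_of_ne (CellVertex.sideVertex_ne d t).1
      (CellVertex.sideVertex_ne d t).2
  have other : ∀ t, ∀ c' : Fin w × Fin h, ∀ b ∈ (F.gadget c'.1 c'.2).verts,
      F.cell c.1 c.2 (CellVertex.sideVertex .south t) = F.cell c'.1 c'.2 b → c' ≠ c →
      c'.1 = c.1 ∧ (c'.2 : ℕ) + 1 = c.2 := by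
    intro t c' b hb e hne
    have ei := cellIndex_eq (m c .south t) hb e
    obtain ⟨-, s1, -, -⟩ := CellVertex.offset_sideVertex t
    obtain ⟨-, s2, s3⟩ := CellVertex.offset_sideVertex_pos t
    simp only [cellIndex, Prod.mk.injEq] at ei
    have := b.offset_fst_le
    have := b.offset_snd_le
    have h1 : c'.1 = c.1 := Fin.ext (by omega)
    refine ⟨h1, ?_⟩
    by_contra hc
    exact hne (Prod.ext h1 (Fin.ext (by omega)))
  rcases Nat.eq_zero_or_pos (c.2 : ℕ) with h0 | hpos
  · refine ⟨fun _ => .light, fun a ha => ?_⟩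
    rcases CellVertex.southBoundary_cases a ha with ⟨h1, h2⟩ | ⟨t, rfl⟩
    · exact matches_corner hT c hIH h1 h2 _
    · exact fun d _ => part_eq_of_single hT (m c .south t)
        (fun c' hne b hb e => by have := (other t c' b hb e hne).2; omega) d
  · have hh := c.2.2
    obtain ⟨c', hc'1, hc'2⟩ : ∃ c' : Fin w × Fin h, c'.1 = c.1 ∧ (c'.2 : ℕ) + 1 = c.2 :=
      ⟨(c.1, ⟨c.2 - 1, by omega⟩), rfl, by dsimp only; omega⟩
    have hcc : c' ≠ c := fun e => by
      rw [e] at hc'2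
      omega
    obtain ⟨χ, hχ⟩ := hIH c' hc'1.le (Fin.le_def.2 (by omega)) hcc
    refine ⟨χ, fun a ha => ?_⟩
    rcases CellVertex.southBoundary_cases a ha with ⟨h1, h2⟩ | ⟨t, rfl⟩
    · exact matches_corner hT c hIH h1 h2 _
    · obtain ⟨-, s1, s2, s3⟩ := CellVertex.offset_sideVertex t
      refine fun d _ => part_eq_of_pair hT hcc (m c .south t) (m c' .north t) ?_ ?_ ?_ hχ d
      · refine congrArg F.pos ?_
        rw [s1, s2, s3, hc'1, ← hc'2]
        exact Prod.ext rfl (by dsimp only; omega)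
      · intro c'' n1 n2 b hb e
        obtain ⟨h1, h2⟩ := other t c'' b hb e n1
        exact n2 (Prod.ext (h1.trans hc'1.symm) (Fin.ext (by omega)))
      · refine S.balanced_vertical _ _ ?_ t
        rw [hc'1]
        exact X.vertical _ _ _ hc'2.symm

theorem part_isTriangulation (hT : IsRealization F.signature T) (c : Fin w × Fin h) :
    (F.gadget c.1 c.2).IsTriangulation (F.cell c.1 c.2) (F.part T c) := by
  have hM := F.isModel c.1.pos c.2.pos hT
  refine ⟨⟨?_, hM.isFramed.boundaryGraph_le c.1.2 c.2.2, fun _ _ hxy => hxy.2.2.2⟩, ?_⟩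
  · rw [points_eq]
    exact Layout.cellPart_psl hM.psl c.1.2 c.2.2
  · intro G hG hle
    refine hM.cellPart_maximal c ?_ hG.inside hle
    rw [← points_eq]
    exact hG.psl

/-- If the parts of a realization in the cells to the south and west of a cell are graphs of local
colorings, the part in the cell is a valid triangulation. -/
theorem part_isValid (hT : IsRealization F.signature T) (c : Fin w × Fin h)
    (hIH : ∀ c' : Fin w × Fin h, c'.1 ≤ c.1 → c'.2 ≤ c.2 → c' ≠ c →
      ∃ χ, F.part T c' = F.coloring χ c') :
    (F.gadget c.1 c.2).IsValid (F.cell c.1 c.2) (F.part T c) where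
  triangulation := part_isTriangulation hT c
  vertex a ha := by
    by_cases hin : a ∈ CellVertex.southWestSideInner
    · rcases CellVertex.mem_southWestSideInner a hin with hb | hb
      · obtain ⟨χ, hχ⟩ := exists_matches_west hT c hIH
        exact ⟨χ, hχ a hb⟩
      · obtain ⟨χ, hχ⟩ := exists_matches_south hT c hIH
        exact ⟨χ, hχ a hb⟩
    · exact ⟨fun _ => .light, fun d hd => part_eq_light hT c hIH ha hin hd⟩
  west := exists_matches_west hT c hIH
  south := exists_matches_south hT c hIH

/-- If all gadgets are correct, the part of a realization in every cell is an intended realization of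
the gadget. -/
theorem part_mem_intended (hF : F.AllCorrect) (hT : IsRealization F.signature T) (c : Fin w × Fin h) :
    F.part T c ∈ (F.gadget c.1 c.2).intended (F.cell c.1 c.2) := by
  -- Column plus row decreases strictly to every other cell that is weakly south-west, which are the
  -- cells whose colorings validity relies on.
  induction hn : (c.1 : ℕ) + c.2 using Nat.strong_induction_on generalizing c with
  | _ n ih =>
    rw [← hF c.1 c.2]
    refine part_isValid hT c fun c' h1 h2 hne => ?_
    obtain ⟨χ, hχ, -⟩ := ih ((c'.1 : ℕ) + c'.2) (by
      rw [Fin.le_def] at h1 h2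
      by_contra hc
      exact hne (Prod.ext (Fin.ext (by omega)) (Fin.ext (by omega)))) c' rfl
    exact ⟨χ, hχ⟩

end FrameGraph
end CardinalRealization

theorem mainTheorem4 {w h : ℕ} (S : CardinalRealization.GadgetSystem)
    (X : CardinalRealization.Tiling w h) (F : CardinalRealization.FrameGraph S X)
    (hcorrect : F.AllCorrect) :
    ∀ T : SimpleGraph CardinalRealization.Plane,
      CardinalRealization.IsRealization F.signature T → T ∈ F.intendedRealizations :=
  fun T hT => ⟨hT, fun i j => ⟨F.part T (i, j),
    CardinalRealization.FrameGraph.part_mem_intended hcorrect hT (i, j),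
    CardinalRealization.FrameGraph.part_le (i, j)⟩⟩
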